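/- **Theorem 4 (Rapid mixing, known connectivity matrix).** Fix an integer $K\ge 2$ and constants $\alpha>\beta\ge 1$. For each $n$ let $0<q_n<p_n<1$, with $p_n\to 0$ and $p_n\le c\,q_n$ for a constant $c$ (so $p_n\asymp q_n$), and let $B$ be the $K\times K$ matrix with $B_{aa}=p_n$ and $B_{ab}=q_n$ for $a\ne b$. For $a\ge 1$ let $S_a$ be the set of $Z\in[K]^n$ such that $\frac{n}{aK}\le\#\{i:Z_i=k\}\le\frac{an}{K}$ for all $k\in[K]$. The true label vector is $Z^*\in S_\beta$. The observed graph $A$ on $[n]$ has independent edges, the edge $\{i,j\}$, $i<j$, being present with probability $B_{Z^*_iZ^*_j}$. With $B$ known, the posterior is the likelihood restricted to $S_\alpha$: for $Z\in S_\alpha$, $$\Pi(Z|A)=\frac{L(Z)}{\sum_{Z'\in S_\alpha}L(Z')},\qquad L(Z)=\prod_{i<j}B_{Z_iZ_j}^{A_{ij}}(1-B_{Z_iZ_j})^{1-A_{ij}},$$ and $\Pi(Z|A)=0$ for $Z\notin S_\alpha$. Let $\Gamma(Z)=\{\sigma\circ Z:\sigma \text{ a permutation of }[K]\}$, $\check S_\alpha=\{\Gamma(Z):Z\in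 S_\alpha\}$, $\check H(\Gamma,\Gamma')=\min_{Z\in\Gamma,Z'\in\Gamma'}\#\{i:Z_i\neq Z'_i\}$, $\Pi(\Gamma|A)=\sum_{Z\in\Gamma}\Pi(Z|A)$ and $\ell(Z,Z^*)=\frac1n\check H(\Gamma(Z),\Gamma(Z^*))$. For an inverse temperature $\xi=\xi_n\ge 1$, the Metropolis–Hastings chain on $\check S_\alpha$ has transition probabilities $$\check P(\Gamma,\Gamma')=\frac{1}{n(K-1)}\min\Big\{1,\Big[\frac{\Pi(\Gamma'|A)}{\Pi(\Gamma|A)}\Big]^{\xi}\Big\}\quad\text{if }\check H(\Gamma,\Gamma')=1,$$ $\check P(\Gamma,\Gamma')=0$ if $\check H(\Gamma,\Gamma')>1$, and $\check P(\Gamma,\Gamma)=1-\sum_{\Gamma'\ne\Gamma}\check P(\Gamma,\Gamma')$; its lazy version is $(\check P+\mathrm{Id})/2$. The target is $\check\Pi(\Gamma|A)=\sum_{Z\in\Gamma}\Pi(Z|A)^\xi\big/\sum_{Z\in S_\alpha}\Pi(Z|A)^\xi$. For either chain, with $t$-step law $\nu_t$ started from $\Gamma(Z_0)$, $Z_0\in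 S_\alpha$, let $$\tau_\varepsilon(Z_0)=\min\{t\in\mathbb N:\ \|\nu_{t'}-\check\Pi(\cdot|A)\|_{\mathrm{TV}}\le\varepsilon\text{ for all }t'\ge t\}.$$ Let $I=-2\log\big(\sqrt{p_nq_n}+\sqrt{(1-p_n)(1-q_n)}\big)$, let $\bar n=n/2$ if $K=2$ and $\bar n=n/(K\beta)$ if $K\ge3$, and suppose that $\limsup_{n\to\infty}\log n/(\bar nI)=1-\varepsilon_0$ with $\varepsilon_0>0$. Let $\gamma_0=\gamma_0(n)>0$ be such that one of the following holds. * Case 1: $\gamma_0\to0$, and $\xi\ge\frac{1-\varepsilon_0}{2\varepsilon_0}$ for all large $n$. * Case 2: $(1-K\alpha\gamma_0)^2nI\to\infty$ and, for all large $n$, $K\alpha\gamma_0<1$ and $$\xi>(1-\varepsilon_0)\Big(\frac1{2\varepsilon_0}\vee\frac{\alpha}{4(1-K\alpha\gamma_0)}\Big)\ \text{ if }K=2,\qquad \xi>(1-\varepsilon_0)\Big(\frac1{2\varepsilon_0}\vee\frac{\alpha}{4\beta(1-K\alpha\gamma_0)}\Big)\ \text{ if }K\ge3.$$ Then for every sufficiently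 small constant $\tau>0$ and every constant $\varepsilon\in(0,1)$ there are constants $C_7,C_8>0$ such that the following holds for all $n\ge1$, all $Z^*\in S_\beta$, all $\eta>0$ and every random initial assignment $Z_0\in S_\alpha$ (possibly depending on $A$) with $\mathbb P\{\ell(Z_0,Z^*)\le\gamma_0\}\ge1-\eta$: with probability at least $1-C_7n^{-C_8}-\eta$, both the Metropolis–Hastings chain and its lazy version satisfy $$\tau_\varepsilon(Z_0)\le4Kn^2\max\{\gamma_0,n^{-\tau}\}\cdot\big(\xi\log\Pi(Z_0|A)^{-1}+\log\varepsilon^{-1}\big).$$ -/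

import Mathlib

open MeasureTheory ProbabilityTheory Filter Topology

noncomputable section

namespace SBM

open scoped Classical

/-- Label assignments of `n` nodes to `K` communities. -/
abbrev Labels (n K : ℕ) : Type := Fin n → Fin K

/-- The size of community `k` under `Z`. -/
def communitySize {n K : ℕ} (Z : Labels n K) (k : Fin K) : ℕ :=
  (Finset.univ.filter fun i => Z i = k).card

/-- The set `S_α` of assignments all of whose community sizes lie in `[n/(αK), αn/K]`. -/
def feasible (n K : ℕ) (α : ℝ) : Finset (Labels n K) :=
  Finset.univ.filter fun Z => ∀ k : Fin K,
    (n : ℝ) / (α * K) ≤ communitySize Z k ∧ (communitySize Z k : ℝ) ≤ α * n / K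

/-- The homogeneous connectivity matrix: `p` on the diagonal, `q` off the diagonal. -/
def connMatrix (K : ℕ) (p q : ℝ) : Matrix (Fin K) (Fin K) ℝ :=
  fun a b => if a = b then p else q

/-- The random graph `A` on `Fin n` is drawn from the stochastic block model with labels `Z` and
connectivity matrix `B`: the edges `i < j` are independent, and `{i, j}` is present with
probability `B (Z i) (Z j)`. -/
structure IsSBM {Ω : Type*} [MeasurableSpace Ω] (μ : Measure Ω) {n K : ℕ}
    (A : Ω → SimpleGraph (Fin n)) (Z : Labels n K) (B : Matrix (Fin K) (Fin K) ℝ) : Prop where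
  measurableSet_adj : ∀ i j, MeasurableSet {ω | (A ω).Adj i j}
  indep : iIndepSet
    (fun e : {e : Fin n × Fin n // e.1 < e.2} => {ω | (A ω).Adj e.1.1 e.1.2}) μ
  prob_adj : ∀ i j, i < j → μ.real {ω | (A ω).Adj i j} = B (Z i) (Z j)

/-- The likelihood `∏_{i<j} B_{Z_i Z_j}^{A_ij} (1 - B_{Z_i Z_j})^{1 - A_ij}`. -/
def likelihood {n K : ℕ} (B : Matrix (Fin K) (Fin K) ℝ) (A : SimpleGraph (Fin n))
    (Z : Labels n K) : ℝ :=
  ∏ i, ∏ j ∈ Finset.Ioi i, if A.Adj i j then B (Z i) (Z j) else 1 - B (Z i) (Z j)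

/-- The posterior `Π(Z | A)` for known `B` and the uniform prior on `S_α`. -/
def posterior {n K : ℕ} (α : ℝ) (B : Matrix (Fin K) (Fin K) ℝ) (A : SimpleGraph (Fin n))
    (Z : Labels n K) : ℝ :=
  if Z ∈ feasible n K α then
    likelihood B A Z / ∑ Z' ∈ feasible n K α, likelihood B A Z'
  else 0

/-- The tempered posterior, proportional to `Π(Z | A) ^ ξ` on `S_α`. -/
def tempered {n K : ℕ} (α : ℝ) (B : Matrix (Fin K) (Fin K) ℝ) (ξ : ℝ) (A : SimpleGraph (Fin n))
    (Z : Labels n K) : ℝ :=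
  if Z ∈ feasible n K α then
    posterior α B A Z ^ ξ / ∑ Z' ∈ feasible n K α, posterior α B A Z' ^ ξ
  else 0

/-- The clustering `Γ(Z) = {σ ∘ Z : σ a permutation of the labels}`. -/
def cluster {n K : ℕ} (Z : Labels n K) : Finset (Labels n K) :=
  Finset.univ.image fun σ : Equiv.Perm (Fin K) => σ ∘ Z

/-- The clustering space `{Γ(Z) : Z ∈ S_α}`. -/
def clusterSpace (n K : ℕ) (α : ℝ) : Finset (Finset (Labels n K)) :=
  (feasible n K α).image cluster

/-- The state `Γ(Z)` of the clustering space, for `Z ∈ S_α`. -/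
def toCluster {n K : ℕ} {α : ℝ} (Z : feasible n K α) : clusterSpace n K α :=
  ⟨cluster Z.1, Finset.mem_image_of_mem _ Z.2⟩

/-- The distance of two clusterings: the least Hamming distance of their representatives. -/
def clusterDist {n K : ℕ} (Γ Γ' : Finset (Labels n K)) : ℕ :=
  sInf {d | ∃ Z ∈ Γ, ∃ Z' ∈ Γ', hammingDist Z Z' = d}

/-- The misclassification proportion of `Z` with respect to `Z'`. -/
def loss {n K : ℕ} (Z Z' : Labels n K) : ℝ :=
  (clusterDist (cluster Z) (cluster Z') : ℝ) / n

/-- The Metropolis-Hastings probability of moving between two different clusterings. -/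
def moveProb {n K : ℕ} {α : ℝ} (B : Matrix (Fin K) (Fin K) ℝ) (ξ : ℝ) (A : SimpleGraph (Fin n))
    (Γ Γ' : clusterSpace n K α) : ℝ :=
  if clusterDist Γ.1 Γ'.1 = 1 then
    1 / ((n : ℝ) * ((K : ℝ) - 1)) *
      min 1 (((∑ Z ∈ Γ'.1, posterior α B A Z) / ∑ Z ∈ Γ.1, posterior α B A Z) ^ ξ)
  else 0

/-- The transition matrix of the Metropolis-Hastings chain with single-flip proposals and inverse
temperature `ξ`, on the clustering space. -/
def transition {n K : ℕ} (α : ℝ) (B : Matrix (Fin K) (Fin K) ℝ) (ξ : ℝ)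
    (A : SimpleGraph (Fin n)) : Matrix (clusterSpace n K α) (clusterSpace n K α) ℝ :=
  fun Γ Γ' =>
    if Γ' = Γ then 1 - ∑ Γ'' ∈ Finset.univ.erase Γ, moveProb B ξ A Γ Γ''
    else moveProb B ξ A Γ Γ'

/-- The lazy version `(P + I) / 2` of the Metropolis-Hastings chain. -/
def lazyTransition {n K : ℕ} (α : ℝ) (B : Matrix (Fin K) (Fin K) ℝ) (ξ : ℝ)
    (A : SimpleGraph (Fin n)) : Matrix (clusterSpace n K α) (clusterSpace n K α) ℝ :=
  (1 / 2 : ℝ) • (transition α B ξ A + 1)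

/-- The target distribution on the clustering space. -/
def target {n K : ℕ} (α : ℝ) (B : Matrix (Fin K) (Fin K) ℝ) (ξ : ℝ) (A : SimpleGraph (Fin n))
    (Γ : clusterSpace n K α) : ℝ :=
  ∑ Z ∈ Γ.1, tempered α B ξ A Z

/-- Total variation distance between the law at time `t` of the chain with transition matrix `P`
started at `x`, and the distribution `π`. -/
def tvAt {S : Type*} [Fintype S] [DecidableEq S] (P : Matrix S S ℝ) (π : S → ℝ) (x : S)
    (t : ℕ) : ℝ :=
  1 / 2 * ∑ y, |(P ^ t) x y - π y|

/-- The `ε`-mixing time `min {t : TV at t' is ≤ ε for all t' ≥ t}`, equal to `⊤` if there is no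
such `t`. -/
def mixingTime {S : Type*} [Fintype S] [DecidableEq S] (P : Matrix S S ℝ) (π : S → ℝ) (ε : ℝ)
    (x : S) : ℕ∞ :=
  ⨅ t ∈ {t : ℕ | ∀ t' ≥ t, tvAt P π x t' ≤ ε}, (t : ℕ∞)

/-- The Rényi divergence of order `1/2` between Bernoulli(`p`) and Bernoulli(`q`). -/
def renyiHalf (p q : ℝ) : ℝ :=
  -2 * Real.log (√(p * q) + √((1 - p) * (1 - q)))

/-- The effective sample size. -/
def effSize (K : ℕ) (β : ℝ) (n : ℕ) : ℝ :=
  if K = 2 then (n : ℝ) / 2 else n / (K * β)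

/-- `limsup log n / (n̄ I) = 1 - ε₀`, the limit superior being taken in the extended reals. -/
def SignalCondition (K : ℕ) (β ε₀ : ℝ) (p q : ℕ → ℝ) : Prop :=
  limsup (fun n : ℕ =>
    ((Real.log n / (effSize K β n * renyiHalf (p n) (q n)) : ℝ) : EReal)) atTop
      = ((1 - ε₀ : ℝ) : EReal)

/-- The condition on the initial error `γ₀` and the inverse temperature `ξ` for known `B`. -/
def InitTempCondition (K : ℕ) (α β ε₀ : ℝ) (p q γ₀ ξ : ℕ → ℝ) : Prop :=
  (Tendsto γ₀ atTop (𝓝 0) ∧ ∀ᶠ n in atTop, (1 - ε₀) / (2 * ε₀) ≤ ξ n) ∨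
  ((∀ᶠ n in atTop, K * α * γ₀ n < 1) ∧
    Tendsto (fun n : ℕ => (1 - K * α * γ₀ n) ^ 2 * n * renyiHalf (p n) (q n)) atTop atTop ∧
    ∀ᶠ n in atTop,
      (1 - ε₀) * max (1 / (2 * ε₀))
        (if K = 2 then α / (4 * (1 - K * α * γ₀ n))
          else α / (4 * β * (1 - K * α * γ₀ n))) < ξ n)

end SBM

end

namespace SBM

section Chain

variable {S : Type*} [Fintype S]

/-- `P` is a stochastic matrix. -/
structure IsStochastic (P : Matrix S S ℝ) : Prop where
  nonneg : ∀ x y, 0 ≤ P x y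
  row_sum : ∀ x, ∑ y, P x y = 1

/-- `π` is a probability vector that is invariant under `P`. -/
structure IsInvariant (P : Matrix S S ℝ) (π : S → ℝ) : Prop where
  nonneg : ∀ x, 0 ≤ π x
  sum_eq_one : ∑ x, π x = 1
  invariant : ∀ y, ∑ x, π x * P x y = π y

theorem isInvariant_of_reversible {P : Matrix S S ℝ} {π : S → ℝ} (hP : IsStochastic P)
    (h0 : ∀ x, 0 ≤ π x) (h1 : ∑ x, π x = 1) (hrev : ∀ x y, π x * P x y = π y * P y x) :
    IsInvariant P π := by
  refine ⟨h0, h1, fun y => ?_⟩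
  simp_rw [fun x => hrev x y, ← Finset.mul_sum, hP.row_sum, mul_one]

theorem drift_of_rates {P : Matrix S S ℝ} (hP : IsStochastic P) (f : S → ℕ) (x : S)
    (hstep : ∀ y, P x y ≠ 0 → f y ≤ f x + 1 ∧ f x ≤ f y + 1) (u d : ℝ)
    (hup : ∑ y with f x < f y, P x y ≤ u) (hdown : d ≤ ∑ y with f y < f x, P x y)
    (hud : 2 * u ≤ d) :
    ∑ y, P x y * f y ≤ f x + u - d ∧ ∑ y, P x y * (2 : ℝ) ^ f y ≤ 2 ^ f x := by
  classical
  have hsum : ∀ g : S → ℝ, ∀ a b : ℝ,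
      (∀ y, P x y ≠ 0 → g y = g x + (if f x < f y then a else 0) - if f y < f x then b else 0) →
      ∑ y, P x y * g y = g x + a * (∑ y with f x < f y, P x y)
        - b * ∑ y with f y < f x, P x y := by
    intro g a b h
    have : ∀ y, P x y * g y = P x y * g x + a * (if f x < f y then P x y else 0)
        - b * (if f y < f x then P x y else 0) := by
      intro y
      by_cases h0 : P x y = 0
      · simp [h0]
      · rw [h y h0]; split_ifs <;> ring
    simp_rw [this, Finset.sum_sub_distrib, Finset.sum_add_distrib, ← Finset.mul_sum,
      ← Finset.sum_mul, hP.row_sum, one_mul, Finset.sum_filter]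
  have hd0 : 0 ≤ ∑ y with f x < f y, P x y := Finset.sum_nonneg fun y _ => hP.nonneg x y
  constructor
  · rw [hsum (fun y => (f y : ℝ)) 1 1]
    · linarith
    · intro y h0
      obtain ⟨h1, h2⟩ := hstep y h0
      rcases lt_trichotomy (f x) (f y) with h | h | h
      · have : f y = f x + 1 := by omega
        simp [this]
      · simp [h]
      · have : f x = f y + 1 := by omega
        simp [this]
  · rw [hsum (fun y => (2 : ℝ) ^ f y) (2 ^ f x) (2 ^ f x / 2)]
    · have : (0 : ℝ) < 2 ^ f x := by positivity
      nlinarith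
    · intro y h0
      obtain ⟨h1, h2⟩ := hstep y h0
      rcases lt_trichotomy (f x) (f y) with h | h | h
      · have : f y = f x + 1 := by omega
        simp [this, pow_succ]; ring
      · simp [h]
      · have : f x = f y + 1 := by omega
        simp [this, pow_succ]; ring

variable [DecidableEq S]

theorem IsStochastic.pow {P : Matrix S S ℝ} (hP : IsStochastic P) (t : ℕ) :
    IsStochastic (P ^ t) := by
  induction t with
  | zero =>
    refine ⟨fun x y => ?_, fun x => ?_⟩
    · rw [pow_zero, Matrix.one_apply]; split_ifs <;> norm_num
    · simp [Matrix.one_apply]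
  | succ t ih =>
    rw [pow_succ]
    refine ⟨fun x y => ?_, fun x => ?_⟩
    · rw [Matrix.mul_apply]
      exact Finset.sum_nonneg fun z _ => mul_nonneg (ih.nonneg _ _) (hP.nonneg _ _)
    · simp_rw [Matrix.mul_apply]
      rw [Finset.sum_comm]
      simp_rw [← Finset.mul_sum, hP.row_sum, mul_one, ih.row_sum]

theorem IsInvariant.pow {P : Matrix S S ℝ} {π : S → ℝ} (hπ : IsInvariant P π) (t : ℕ) :
    IsInvariant (P ^ t) π := by
  refine ⟨hπ.nonneg, hπ.sum_eq_one, ?_⟩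
  induction t with
  | zero => intro y; simp [Matrix.one_apply]
  | succ t ih =>
    intro y
    simp_rw [pow_succ, Matrix.mul_apply, Finset.mul_sum]
    rw [Finset.sum_comm]
    simp_rw [← mul_assoc, ← Finset.sum_mul, ih]
    exact hπ.invariant y

theorem IsStochastic.lazy {P : Matrix S S ℝ} (hP : IsStochastic P) :
    IsStochastic ((1 / 2 : ℝ) • (P + 1)) := by
  refine ⟨fun x y => ?_, fun x => ?_⟩
  · have h := hP.nonneg x y
    simp only [Matrix.smul_apply, Matrix.add_apply, Matrix.one_apply, smul_eq_mul]
    split_ifs <;> linarith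
  · simp only [Matrix.smul_apply, Matrix.add_apply, smul_eq_mul]
    rw [← Finset.mul_sum, Finset.sum_add_distrib, hP.row_sum]
    simp [Matrix.one_apply]
    norm_num

theorem IsInvariant.lazy {P : Matrix S S ℝ} {π : S → ℝ} (hπ : IsInvariant P π) :
    IsInvariant ((1 / 2 : ℝ) • (P + 1)) π := by
  refine ⟨hπ.nonneg, hπ.sum_eq_one, fun y => ?_⟩
  have h : ∀ x, π x * ((1 / 2 : ℝ) • (P + 1)) x y
      = 1 / 2 * (π x * P x y) + 1 / 2 * (π x * (1 : Matrix S S ℝ) x y) := by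
    intro x
    simp only [Matrix.smul_apply, Matrix.add_apply, smul_eq_mul]
    ring
  simp_rw [h, Finset.sum_add_distrib, ← Finset.mul_sum, hπ.invariant]
  simp [Matrix.one_apply]
  ring

theorem tvAt_le_one {P : Matrix S S ℝ} {π : S → ℝ} (hP : IsStochastic P)
    (hπ : IsInvariant P π) (x : S) (t : ℕ) : tvAt P π x t ≤ 1 := by
  have h : ∑ y, |(P ^ t) x y - π y| ≤ ∑ y, ((P ^ t) x y + π y) := by
    refine Finset.sum_le_sum fun y _ => ?_
    have h1 := (hP.pow t).nonneg x y
    have h2 := hπ.nonneg y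
    rw [abs_le]; constructor <;> linarith
  rw [Finset.sum_add_distrib, (hP.pow t).row_sum, hπ.sum_eq_one] at h
  unfold tvAt; linarith

theorem tvAt_le_one_sub {P : Matrix S S ℝ} {π : S → ℝ} (hP : IsStochastic P)
    (hπ : IsInvariant P π) (x : S) (t : ℕ) : tvAt P π x t ≤ 1 - π x := by
  have h : ∀ y, |(P ^ t) x y - π y| ≤ (π y - (P ^ t) x y) + 2 * ((1 - π x) * (P ^ t) x y) := by
    intro y
    have h1 := (hP.pow t).nonneg x y
    have h2 : π x * (P ^ t) x y ≤ π y := by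
      rw [← (hπ.pow t).invariant y]
      exact Finset.single_le_sum (f := fun x => π x * (P ^ t) x y)
        (fun z _ => mul_nonneg (hπ.nonneg z) ((hP.pow t).nonneg z y)) (Finset.mem_univ x)
    have h3 : π x ≤ 1 := by
      rw [← hπ.sum_eq_one]
      exact Finset.single_le_sum (fun z _ => hπ.nonneg z) (Finset.mem_univ x)
    have h4 : 0 ≤ (1 - π x) * (P ^ t) x y := mul_nonneg (by linarith) h1
    rw [abs_le]; constructor <;> nlinarith
  have h' := Finset.sum_le_sum fun y (_ : y ∈ Finset.univ) => h y
  rw [Finset.sum_add_distrib, Finset.sum_sub_distrib, ← Finset.mul_sum, ← Finset.mul_sum,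
    (hP.pow t).row_sum, hπ.sum_eq_one] at h'
  unfold tvAt; linarith

theorem tvAt_succ_le {P : Matrix S S ℝ} {π : S → ℝ} (hP : IsStochastic P) (x : S) (t : ℕ) :
    tvAt P π x (t + 1) ≤ ∑ y, P x y * tvAt P π y t := by
  have h : ∀ z, |(P ^ (t + 1)) x z - π z| ≤ ∑ y, P x y * |(P ^ t) y z - π z| := by
    intro z
    have : (P ^ (t + 1)) x z - π z = ∑ y, P x y * ((P ^ t) y z - π z) := by
      simp_rw [mul_sub, Finset.sum_sub_distrib, ← Finset.sum_mul, hP.row_sum, one_mul, pow_succ',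
        Matrix.mul_apply]
    rw [this]
    refine (Finset.abs_sum_le_sum_abs _ _).trans (le_of_eq ?_)
    simp_rw [abs_mul, abs_of_nonneg (hP.nonneg _ _)]
  have h' := Finset.sum_le_sum fun z (_ : z ∈ Finset.univ) => h z
  rw [Finset.sum_comm] at h'
  simp_rw [← Finset.mul_sum] at h'
  unfold tvAt
  calc _ ≤ 1 / 2 * ∑ y, P x y * ∑ z, |(P ^ t) y z - π z| := by linarith
    _ = _ := by rw [Finset.mul_sum]; exact Finset.sum_congr rfl fun y _ => by ring

/-- If `f` contracts in mean and `2 ^ f` does not grow in mean on `{0 < f < M}`, the chain comes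
close to a heavy state `x₀ = {f = 0}` before leaving `{f < M}`. -/
theorem tvAt_le_of_drift {P : Matrix S S ℝ} {π : S → ℝ} (hP : IsStochastic P)
    (hπ : IsInvariant P π) (f : S → ℕ) (x₀ : S) (hf : ∀ x, f x = 0 → x = x₀) (M l : ℝ)
    (hl : l ≤ 1)
    (hmean : ∀ x, f x ≠ 0 → (f x : ℝ) < M → ∑ y, P x y * f y ≤ (1 - l) * f x)
    (hexp : ∀ x, f x ≠ 0 → (f x : ℝ) < M → ∑ y, P x y * (2 : ℝ) ^ f y ≤ 2 ^ f x) (t : ℕ) :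
    ∀ x, tvAt P π x t ≤ (1 - π x₀) + (1 - l) ^ t * f x + 2 ^ f x * (2 : ℝ) ^ (-M) := by
  have hl' : 0 ≤ 1 - l := by linarith
  have hM : (0 : ℝ) < 2 ^ (-M) := by positivity
  have hπ0 : 0 ≤ 1 - π x₀ := by
    rw [← hπ.sum_eq_one, sub_nonneg]
    exact Finset.single_le_sum (fun z _ => hπ.nonneg z) (Finset.mem_univ x₀)
  have key : ∀ t x, (f x ≠ 0 → (f x : ℝ) < M →
      tvAt P π x t ≤ (1 - π x₀) + (1 - l) ^ t * f x + 2 ^ f x * (2 : ℝ) ^ (-M)) →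
      tvAt P π x t ≤ (1 - π x₀) + (1 - l) ^ t * f x + 2 ^ f x * (2 : ℝ) ^ (-M) := by
    intro t x h
    have h1 : 0 ≤ (1 - l) ^ t * f x := by positivity
    by_cases h0 : f x = 0
    · have := tvAt_le_one_sub hP hπ x t
      rw [hf x h0] at this ⊢
      have h1 : 0 ≤ (1 - l) ^ t * f x₀ := by positivity
      have : (0 : ℝ) < 2 ^ f x₀ * 2 ^ (-M) := by positivity
      linarith
    · by_cases h2 : (f x : ℝ) < M
      · exact h h0 h2
      · have h3 := tvAt_le_one hP hπ x t
        have h4 : (1 : ℝ) ≤ 2 ^ f x * (2 : ℝ) ^ (-M) := by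
          rw [← Real.rpow_natCast, ← Real.rpow_add (by norm_num)]
          exact Real.one_le_rpow (by norm_num) (by linarith)
        linarith
  induction t with
  | zero =>
    refine fun x => key 0 x fun h0 _ => ?_
    have h3 := tvAt_le_one hP hπ x 0
    have h4 : (1 : ℝ) ≤ f x := by exact_mod_cast Nat.one_le_iff_ne_zero.mpr h0
    have : (0 : ℝ) < 2 ^ f x * 2 ^ (-M) := by positivity
    simp only [pow_zero, one_mul]
    linarith
  | succ t ih =>
    refine fun x => key (t + 1) x fun h0 h1 => ?_
    refine (tvAt_succ_le hP x t).trans ?_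
    calc ∑ y, P x y * tvAt P π y t
        ≤ ∑ y, P x y * ((1 - π x₀) + (1 - l) ^ t * f y + 2 ^ f y * (2 : ℝ) ^ (-M)) :=
          Finset.sum_le_sum fun y _ => mul_le_mul_of_nonneg_left (ih y) (hP.nonneg x y)
      _ = (1 - π x₀) * ∑ y, P x y + (1 - l) ^ t * ∑ y, P x y * f y
            + (∑ y, P x y * (2 : ℝ) ^ f y) * (2 : ℝ) ^ (-M) := by
          simp_rw [Finset.mul_sum, Finset.sum_mul, ← Finset.sum_add_distrib]
          exact Finset.sum_congr rfl fun y _ => by ring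
      _ ≤ _ := by
          rw [hP.row_sum, mul_one, pow_succ, mul_assoc ((1 - l) ^ t)]
          gcongr
          · exact hmean x h0 h1
          · exact hexp x h0 h1

theorem exists_mixingTime_eq {P : Matrix S S ℝ} {π : S → ℝ} {ε : ℝ} {x : S} {T : ℝ} (hT : 0 ≤ T)
    (h : ∀ t : ℕ, T < t + 1 → tvAt P π x t ≤ ε) :
    ∃ t : ℕ, mixingTime P π ε x = t ∧ (t : ℝ) ≤ T := by
  have hmem : ⌊T⌋₊ ∈ {t : ℕ | ∀ t' ≥ t, tvAt P π x t' ≤ ε} := by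
    intro t' ht'
    refine h t' ((Nat.lt_floor_add_one T).trans_le ?_)
    have : (⌊T⌋₊ : ℝ) ≤ t' := by exact_mod_cast ht'
    linarith
  have hle : mixingTime P π ε x ≤ (⌊T⌋₊ : ℕ∞) := iInf₂_le _ hmem
  obtain ⟨t, ht⟩ := ENat.ne_top_iff_exists.mp (ne_top_of_le_ne_top (ENat.natCast_ne_top _) hle)
  refine ⟨t, ht.symm, ?_⟩
  rw [← ht] at hle
  have : t ≤ ⌊T⌋₊ := by exact_mod_cast hle
  exact (Nat.cast_le.mpr this).trans (Nat.floor_le hT)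

end Chain

section Clusters

variable {n K : ℕ} {α : ℝ}

theorem mem_cluster {Z W : Labels n K} : W ∈ cluster Z ↔ ∃ σ : Equiv.Perm (Fin K), σ ∘ Z = W := by
  simp [cluster]

theorem self_mem_cluster (Z : Labels n K) : Z ∈ cluster Z := mem_cluster.mpr ⟨1, rfl⟩

theorem cluster_eq_of_mem {Z W : Labels n K} (h : W ∈ cluster Z) : cluster W = cluster Z := by
  obtain ⟨σ, rfl⟩ := mem_cluster.mp h
  ext V
  rw [mem_cluster, mem_cluster]
  constructor
  · rintro ⟨τ, rfl⟩
    exact ⟨τ * σ, rfl⟩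
  · rintro ⟨τ, rfl⟩
    refine ⟨τ * σ⁻¹, ?_⟩
    ext i
    simp

theorem communitySize_comp (σ : Equiv.Perm (Fin K)) (Z : Labels n K) (k : Fin K) :
    communitySize (σ ∘ Z) k = communitySize Z (σ.symm k) := by
  unfold communitySize
  congr 1
  ext i
  simp [Equiv.eq_symm_apply]

theorem comp_mem_feasible {Z : Labels n K} (σ : Equiv.Perm (Fin K)) (h : Z ∈ feasible n K α) :
    σ ∘ Z ∈ feasible n K α := by
  simp only [feasible, Finset.mem_filter, Finset.mem_univ, true_and] at h ⊢
  intro k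
  rw [communitySize_comp]
  exact h _

theorem mem_feasible_of_mem_cluster {Z W : Labels n K} (hZ : Z ∈ feasible n K α)
    (h : W ∈ cluster Z) : W ∈ feasible n K α := by
  obtain ⟨σ, rfl⟩ := mem_cluster.mp h
  exact comp_mem_feasible σ hZ

theorem exists_toCluster_eq (Γ : clusterSpace n K α) : ∃ Z, toCluster Z = Γ := by
  obtain ⟨Γ, hΓ⟩ := Γ
  obtain ⟨Z, hZ, rfl⟩ := Finset.mem_image.mp hΓ
  exact ⟨⟨Z, hZ⟩, rfl⟩

theorem toCluster_eq_iff {Z W : feasible n K α} :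
    toCluster Z = toCluster W ↔ Z.1 ∈ cluster W.1 := by
  constructor
  · intro h
    have h' : cluster Z.1 = cluster W.1 := congrArg Subtype.val h
    rw [← h']
    exact self_mem_cluster _
  · intro h
    exact Subtype.ext (cluster_eq_of_mem h)

theorem hammingDist_perm (σ : Equiv.Perm (Fin K)) (Z W : Labels n K) :
    hammingDist (σ ∘ Z) (σ ∘ W) = hammingDist Z W :=
  hammingDist_comp (fun _ => σ) fun _ => σ.injective

theorem clusterDist_le (σ : Equiv.Perm (Fin K)) (Z W : Labels n K) :
    clusterDist (cluster Z) (cluster W) ≤ hammingDist (σ ∘ Z) W :=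
  Nat.sInf_le ⟨σ ∘ Z, mem_cluster.mpr ⟨σ, rfl⟩, W, self_mem_cluster W, rfl⟩

theorem clusterDist_le_hammingDist (Z W : Labels n K) :
    clusterDist (cluster Z) (cluster W) ≤ hammingDist Z W := clusterDist_le 1 Z W

theorem exists_clusterDist_eq (Z W : Labels n K) :
    ∃ σ : Equiv.Perm (Fin K), hammingDist (σ ∘ Z) W = clusterDist (cluster Z) (cluster W) := by
  have hne : {d | ∃ Z' ∈ cluster Z, ∃ W' ∈ cluster W, hammingDist Z' W' = d}.Nonempty :=
    ⟨_, Z, self_mem_cluster Z, W, self_mem_cluster W, rfl⟩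
  obtain ⟨Z', hZ', W', hW', h⟩ := Nat.sInf_mem hne
  obtain ⟨σ, rfl⟩ := mem_cluster.mp hZ'
  obtain ⟨τ, rfl⟩ := mem_cluster.mp hW'
  refine ⟨τ⁻¹ * σ, ?_⟩
  rw [clusterDist, ← h, ← hammingDist_perm τ]
  congr 1
  ext i
  simp

theorem clusterDist_comm (Γ Γ' : Finset (Labels n K)) : clusterDist Γ Γ' = clusterDist Γ' Γ := by
  unfold clusterDist
  congr 1
  ext d
  constructor
  · rintro ⟨Z, hZ, W, hW, h⟩
    exact ⟨W, hW, Z, hZ, by rw [hammingDist_comm, h]⟩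
  · rintro ⟨Z, hZ, W, hW, h⟩
    exact ⟨W, hW, Z, hZ, by rw [hammingDist_comm, h]⟩

theorem clusterDist_eq_zero {Z W : Labels n K} (h : clusterDist (cluster Z) (cluster W) = 0) :
    Z ∈ cluster W := by
  obtain ⟨σ, hσ⟩ := exists_clusterDist_eq Z W
  rw [h, hammingDist_eq_zero] at hσ
  have : W ∈ cluster Z := mem_cluster.mpr ⟨σ, hσ⟩
  rw [cluster_eq_of_mem this]
  exact self_mem_cluster Z

theorem clusterDist_triangle (Z W V : Labels n K) :
    clusterDist (cluster Z) (cluster V) ≤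
      clusterDist (cluster Z) (cluster W) + clusterDist (cluster W) (cluster V) := by
  obtain ⟨σ, hσ⟩ := exists_clusterDist_eq Z W
  obtain ⟨τ, hτ⟩ := exists_clusterDist_eq W V
  rw [← hσ, ← hτ, ← hammingDist_perm τ]
  refine (clusterDist_le (τ * σ) Z V).trans ?_
  exact hammingDist_triangle _ _ _

theorem mem_feasible {Z : Labels n K} : Z ∈ feasible n K α ↔ ∀ k : Fin K,
    (n : ℝ) / (α * K) ≤ communitySize Z k ∧ (communitySize Z k : ℝ) ≤ α * n / K := by
  simp [feasible]

theorem communitySize_pos {Z : Labels n K} (hn : 1 ≤ n) (hα : 0 < α) (hZ : Z ∈ feasible n K α)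
    (k : Fin K) : 0 < communitySize Z k := by
  have h := (mem_feasible.mp hZ k).1
  have hK : 0 < K := Fin.pos k
  have : (0 : ℝ) < n / (α * K) := by positivity
  exact_mod_cast this.trans_le h

theorem surjective_of_feasible {Z : Labels n K} (hn : 1 ≤ n) (hα : 0 < α)
    (hZ : Z ∈ feasible n K α) : Function.Surjective Z := by
  intro k
  have h := communitySize_pos hn hα hZ k
  unfold communitySize at h
  obtain ⟨i, hi⟩ := Finset.card_pos.mp h
  exact ⟨i, (Finset.mem_filter.mp hi).2⟩

theorem card_cluster {Z : Labels n K} (hZ : Function.Surjective Z) :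
    (cluster Z).card = K.factorial := by
  unfold cluster
  rw [Finset.card_image_of_injective, Finset.card_univ, Fintype.card_perm, Fintype.card_fin]
  intro σ τ h
  ext k
  obtain ⟨i, rfl⟩ := hZ k
  exact congrArg Fin.val (congrFun h i)

/-- Two different representatives of a clustering differ on at least two whole communities. -/
theorem two_mul_le_hammingDist {Z : Labels n K} (hZ : Z ∈ feasible n K α)
    {σ : Equiv.Perm (Fin K)} (hσ : σ ≠ 1) :
    2 * ((n : ℝ) / (α * K)) ≤ hammingDist (σ ∘ Z) Z := by
  obtain ⟨k, hk⟩ : ∃ k, σ k ≠ k := by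
    by_contra! h
    exact hσ (Equiv.ext h)
  have hk' : σ (σ k) ≠ σ k := fun h => hk (σ.injective h)
  have hsub : (Finset.univ.filter fun i => Z i = k) ∪ (Finset.univ.filter fun i => Z i = σ k) ⊆
      Finset.univ.filter fun i => (σ ∘ Z) i ≠ Z i := by
    intro i hi
    simp only [Finset.mem_union, Finset.mem_filter, Finset.mem_univ, true_and] at hi
    simp only [Finset.mem_filter, Finset.mem_univ, true_and, Function.comp]
    rcases hi with h | h <;> rw [h] <;> assumption
  have hdisj : Disjoint (Finset.univ.filter fun i => Z i = k)
      (Finset.univ.filter fun i => Z i = σ k) := by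
    rw [Finset.disjoint_filter]
    intro i _ h1 h2
    exact hk (h2.symm.trans h1)
  have h := Finset.card_le_card hsub
  rw [Finset.card_union_of_disjoint hdisj] at h
  have h' : communitySize Z k + communitySize Z (σ k) ≤ hammingDist (σ ∘ Z) Z := h
  have h1 := (mem_feasible.mp hZ k).1
  have h2 := (mem_feasible.mp hZ (σ k)).1
  have h3 : (communitySize Z k : ℝ) + communitySize Z (σ k) ≤ hammingDist (σ ∘ Z) Z := by
    exact_mod_cast h'
  linarith

theorem eq_of_mem_cluster_of_close {Z W V : Labels n K} (hZ : Z ∈ feasible n K α)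
    (hW : W ∈ cluster Z)
    (h : (hammingDist Z V : ℝ) + hammingDist W V < 2 * (n / (α * K))) : W = Z := by
  obtain ⟨σ, rfl⟩ := mem_cluster.mp hW
  by_cases hσ : σ = 1
  · rw [hσ]; rfl
  · have h1 := two_mul_le_hammingDist hZ hσ
    have h2 := hammingDist_triangle_right (σ ∘ Z) Z V
    have h3 : (hammingDist (σ ∘ Z) Z : ℝ) ≤ hammingDist (σ ∘ Z) V + hammingDist Z V := by
      exact_mod_cast h2
    linarith

end Clusters

section Posterior

variable {n K : ℕ} {α p q ξ : ℝ}

theorem connMatrix_comp (σ : Equiv.Perm (Fin K)) (a b : Fin K) :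
    connMatrix K p q (σ a) (σ b) = connMatrix K p q a b := by
  simp [connMatrix]

theorem likelihood_comp (A : SimpleGraph (Fin n)) (σ : Equiv.Perm (Fin K)) (Z : Labels n K) :
    likelihood (connMatrix K p q) A (σ ∘ Z) = likelihood (connMatrix K p q) A Z := by
  simp only [likelihood, Function.comp, connMatrix_comp]

theorem likelihood_of_mem_cluster (A : SimpleGraph (Fin n)) {Z W : Labels n K}
    (h : W ∈ cluster Z) :
    likelihood (connMatrix K p q) A W = likelihood (connMatrix K p q) A Z := by
  obtain ⟨σ, rfl⟩ := mem_cluster.mp h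
  exact likelihood_comp A σ Z

theorem connMatrix_pos (hq : 0 < q) (hqp : q < p) (a b : Fin K) : 0 < connMatrix K p q a b := by
  unfold connMatrix; split_ifs <;> linarith

theorem connMatrix_lt_one (hqp : q < p) (hp : p < 1) (a b : Fin K) :
    connMatrix K p q a b < 1 := by
  unfold connMatrix; split_ifs <;> linarith

theorem likelihood_pos (hq : 0 < q) (hqp : q < p) (hp : p < 1) (A : SimpleGraph (Fin n))
    (Z : Labels n K) : 0 < likelihood (connMatrix K p q) A Z := by
  unfold likelihood
  refine Finset.prod_pos fun i _ => Finset.prod_pos fun j _ => ?_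
  split_ifs
  · exact connMatrix_pos hq hqp _ _
  · exact sub_pos.mpr (connMatrix_lt_one hqp hp _ _)

theorem sum_likelihood_pos (hq : 0 < q) (hqp : q < p) (hp : p < 1) (A : SimpleGraph (Fin n))
    {Z : Labels n K} (hZ : Z ∈ feasible n K α) :
    0 < ∑ Z' ∈ feasible n K α, likelihood (connMatrix K p q) A Z' :=
  Finset.sum_pos (fun _ _ => likelihood_pos hq hqp hp A _) ⟨Z, hZ⟩

theorem posterior_pos (hq : 0 < q) (hqp : q < p) (hp : p < 1) (A : SimpleGraph (Fin n))
    {Z : Labels n K} (hZ : Z ∈ feasible n K α) : 0 < posterior α (connMatrix K p q) A Z := by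
  rw [posterior, if_pos hZ]
  exact div_pos (likelihood_pos hq hqp hp A Z) (sum_likelihood_pos hq hqp hp A hZ)

theorem posterior_le_one (hq : 0 < q) (hqp : q < p) (hp : p < 1) (A : SimpleGraph (Fin n))
    {Z : Labels n K} (hZ : Z ∈ feasible n K α) : posterior α (connMatrix K p q) A Z ≤ 1 := by
  rw [posterior, if_pos hZ, div_le_one (sum_likelihood_pos hq hqp hp A hZ)]
  exact Finset.single_le_sum (f := fun Z => likelihood (connMatrix K p q) A Z)
    (fun Z _ => (likelihood_pos hq hqp hp A Z).le) hZ

theorem posterior_of_mem_cluster (A : SimpleGraph (Fin n)) {Z W : Labels n K}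
    (hZ : Z ∈ feasible n K α) (h : W ∈ cluster Z) :
    posterior α (connMatrix K p q) A W = posterior α (connMatrix K p q) A Z := by
  rw [posterior, posterior, if_pos hZ, if_pos (mem_feasible_of_mem_cluster hZ h),
    likelihood_of_mem_cluster A h]

theorem sum_cluster_posterior (hn : 1 ≤ n) (hα : 0 < α) (A : SimpleGraph (Fin n))
    {Z : Labels n K} (hZ : Z ∈ feasible n K α) :
    ∑ W ∈ cluster Z, posterior α (connMatrix K p q) A W
      = K.factorial * posterior α (connMatrix K p q) A Z := by
  rw [Finset.sum_congr rfl fun W hW => posterior_of_mem_cluster A hZ hW, Finset.sum_const,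
    card_cluster (surjective_of_feasible hn hα hZ), nsmul_eq_mul]

theorem moveProb_toCluster (hq : 0 < q) (hqp : q < p) (hp : p < 1) (hn : 1 ≤ n) (hα : 0 < α)
    (A : SimpleGraph (Fin n)) (Z W : feasible n K α) :
    moveProb (connMatrix K p q) ξ A (toCluster Z) (toCluster W) =
      if clusterDist (cluster Z.1) (cluster W.1) = 1 then
        1 / ((n : ℝ) * ((K : ℝ) - 1)) * min 1
          ((likelihood (connMatrix K p q) A W.1 / likelihood (connMatrix K p q) A Z.1) ^ ξ)
      else 0 := by
  unfold moveProb toCluster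
  simp only
  rw [sum_cluster_posterior hn hα A W.2, sum_cluster_posterior hn hα A Z.2,
    mul_div_mul_left _ _ (by positivity), posterior, posterior, if_pos W.2, if_pos Z.2,
    div_div_div_cancel_right₀ (sum_likelihood_pos hq hqp hp A Z.2).ne']

theorem target_toCluster (hq : 0 < q) (hqp : q < p) (hp : p < 1) (hn : 1 ≤ n) (hα : 0 < α)
    (A : SimpleGraph (Fin n)) (Z : feasible n K α) :
    target α (connMatrix K p q) ξ A (toCluster Z) =
      K.factorial * (likelihood (connMatrix K p q) A Z.1 ^ ξ /
        ∑ W ∈ feasible n K α, likelihood (connMatrix K p q) A W ^ ξ) := by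
  have hN := sum_likelihood_pos hq hqp hp A Z.2
  have htemp : ∀ W ∈ feasible n K α, tempered α (connMatrix K p q) ξ A W =
      likelihood (connMatrix K p q) A W ^ ξ /
        ∑ W ∈ feasible n K α, likelihood (connMatrix K p q) A W ^ ξ := by
    intro W hW
    have hpost : ∀ V ∈ feasible n K α, posterior α (connMatrix K p q) A V ^ ξ =
        likelihood (connMatrix K p q) A V ^ ξ /
          (∑ Z' ∈ feasible n K α, likelihood (connMatrix K p q) A Z') ^ ξ := by
      intro V hV
      rw [posterior, if_pos hV, Real.div_rpow (likelihood_pos hq hqp hp A V).le hN.le]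
    rw [tempered, if_pos hW, Finset.sum_congr rfl hpost, hpost W hW, ← Finset.sum_div,
      div_div_div_cancel_right₀ (Real.rpow_pos_of_pos hN _).ne']
  unfold target toCluster
  simp only
  rw [Finset.sum_congr rfl fun W hW => (htemp W (mem_feasible_of_mem_cluster Z.2 hW)).trans
    (by rw [likelihood_of_mem_cluster A hW]), Finset.sum_const,
    card_cluster (surjective_of_feasible hn hα Z.2), nsmul_eq_mul]

theorem target_nonneg (hq : 0 < q) (hqp : q < p) (hp : p < 1) (hn : 1 ≤ n) (hα : 0 < α)
    (A : SimpleGraph (Fin n)) (Γ : clusterSpace n K α) :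
    0 ≤ target α (connMatrix K p q) ξ A Γ := by
  obtain ⟨Z, rfl⟩ := exists_toCluster_eq Γ
  rw [target_toCluster hq hqp hp hn hα]
  have h : ∀ W, 0 < likelihood (connMatrix K p q) A W ^ ξ := fun W =>
    Real.rpow_pos_of_pos (likelihood_pos hq hqp hp A W) ξ
  exact mul_nonneg (by positivity) (div_nonneg (h _).le (Finset.sum_nonneg fun W _ => (h W).le))

/-- Summing over the clustering space the sums over its members is summing over `S_α`. -/
theorem sum_clusterSpace (g : Labels n K → ℝ) :
    ∑ Γ : clusterSpace n K α, ∑ Z ∈ Γ.1, g Z = ∑ Z ∈ feasible n K α, g Z := by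
  rw [Finset.sum_coe_sort (clusterSpace n K α) fun Γ => ∑ Z ∈ Γ, g Z, clusterSpace,
    ← Finset.sum_fiberwise_of_maps_to (s := feasible n K α) (g := cluster)
      (t := (feasible n K α).image cluster) fun Z hZ => Finset.mem_image_of_mem _ hZ]
  refine Finset.sum_congr rfl fun Γ hΓ => Finset.sum_congr ?_ fun _ _ => rfl
  obtain ⟨Z, hZ, rfl⟩ := Finset.mem_image.mp hΓ
  ext W
  rw [Finset.mem_filter]
  constructor
  · exact fun h => ⟨mem_feasible_of_mem_cluster hZ h, cluster_eq_of_mem h⟩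
  · rintro ⟨_, h⟩
    rw [← h]
    exact self_mem_cluster W

theorem sum_tempered (hq : 0 < q) (hqp : q < p) (hp : p < 1) (A : SimpleGraph (Fin n))
    {Z : Labels n K} (hZ : Z ∈ feasible n K α) :
    ∑ W ∈ feasible n K α, tempered α (connMatrix K p q) ξ A W = 1 := by
  simp_rw [tempered]
  rw [Finset.sum_congr rfl fun W hW => if_pos hW, ← Finset.sum_div, div_self]
  exact (Finset.sum_pos (fun W hW => Real.rpow_pos_of_pos (posterior_pos hq hqp hp A hW) ξ)
    ⟨Z, hZ⟩).ne'

theorem sum_target (hq : 0 < q) (hqp : q < p) (hp : p < 1) (A : SimpleGraph (Fin n))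
    {Z : Labels n K} (hZ : Z ∈ feasible n K α) :
    ∑ Γ, target α (connMatrix K p q) ξ A Γ = 1 := by
  unfold target
  rw [sum_clusterSpace, sum_tempered hq hqp hp A hZ]

/-- The mass that the target does not give to `Γ(Z)` is controlled by likelihood ratios. -/
theorem one_sub_target_le (hq : 0 < q) (hqp : q < p) (hp : p < 1) (hn : 1 ≤ n) (hα : 0 < α)
    (hξ : 1 ≤ ξ) (A : SimpleGraph (Fin n)) (Z : feasible n K α) {e : ℝ} (he : e ≤ 1)
    (h : ∑ W ∈ feasible n K α with W ∉ cluster Z.1,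
      √(likelihood (connMatrix K p q) A W / likelihood (connMatrix K p q) A Z.1) ≤ e) :
    1 - target α (connMatrix K p q) ξ A (toCluster Z) ≤ e := by
  set L := likelihood (connMatrix K p q) A
  have hL : ∀ W, 0 < L W := likelihood_pos hq hqp hp A
  have hLξ : ∀ W, 0 < L W ^ ξ := fun W => Real.rpow_pos_of_pos (hL W) ξ
  set N := ∑ W ∈ feasible n K α, L W ^ ξ with hNdef
  have hN : 0 < N := Finset.sum_pos (fun W _ => hLξ W) ⟨Z.1, Z.2⟩
  have hcl : (feasible n K α).filter (fun W => W ∈ cluster Z.1) = cluster Z.1 := by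
    ext W
    simp only [Finset.mem_filter, and_iff_right_iff_imp]
    exact mem_feasible_of_mem_cluster Z.2
  have hsplit : N = K.factorial * L Z.1 ^ ξ
      + ∑ W ∈ feasible n K α with W ∉ cluster Z.1, L W ^ ξ := by
    rw [hNdef, ← Finset.sum_filter_add_sum_filter_not _ (fun W => W ∈ cluster Z.1), hcl]
    congr 1
    rw [Finset.sum_congr rfl fun W hW => by rw [show L W = L Z.1 from
      likelihood_of_mem_cluster A hW], Finset.sum_const,
      card_cluster (surjective_of_feasible hn hα Z.2), nsmul_eq_mul]
  have hsmall : ∑ W ∈ feasible n K α with W ∉ cluster Z.1, L W ^ ξ ≤ e * L Z.1 ^ ξ := by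
    have hterm : ∀ W ∈ (feasible n K α).filter (fun W => W ∉ cluster Z.1),
        L W ^ ξ ≤ √(L W / L Z.1) * L Z.1 ^ ξ := by
      intro W hW
      have h1 : √(L W / L Z.1) ≤ 1 := le_trans (Finset.single_le_sum
        (f := fun W => √(L W / L Z.1)) (fun _ _ => Real.sqrt_nonneg _) hW) (h.trans he)
      have h2 : L W / L Z.1 ≤ 1 := by
        rwa [Real.sqrt_le_one] at h1
      have h3 : (L W / L Z.1) ^ ξ ≤ √(L W / L Z.1) := by
        rw [Real.sqrt_eq_rpow]
        exact Real.rpow_le_rpow_of_exponent_ge (div_pos (hL W) (hL _)) h2 (by linarith)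
      rw [Real.div_rpow (hL W).le (hL _).le, div_le_iff₀ (hLξ _)] at h3
      exact h3
    refine (Finset.sum_le_sum hterm).trans ?_
    rw [← Finset.sum_mul]
    exact mul_le_mul_of_nonneg_right h (hLξ _).le
  have he0 : 0 ≤ e := le_trans (Finset.sum_nonneg fun _ _ => Real.sqrt_nonneg _) h
  rw [target_toCluster hq hqp hp hn hα]
  change 1 - K.factorial * (L Z.1 ^ ξ / N) ≤ e
  have hfac : (1 : ℝ) ≤ K.factorial := by exact_mod_cast K.factorial_pos
  have hNge : L Z.1 ^ ξ ≤ N := by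
    have : 0 ≤ ∑ W ∈ feasible n K α with W ∉ cluster Z.1, L W ^ ξ :=
      Finset.sum_nonneg fun W _ => (hLξ W).le
    nlinarith [hLξ Z.1]
  rw [← mul_div_assoc, sub_le_iff_le_add, ← sub_le_iff_le_add', le_div_iff₀ hN]
  nlinarith [hLξ Z.1]

end Posterior

section Scores

variable {n K : ℕ} {α β p q ξ : ℝ}

/-- The log-likelihood ratio of the pair `{i, j}` being in one community or in two. -/
noncomputable def edgeScore (p q : ℝ) (A : SimpleGraph (Fin n)) (i j : Fin n) : ℝ :=
  open scoped Classical in if A.Adj i j then Real.log (p / q) else Real.log ((1 - p) / (1 - q))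

theorem edgeScore_comm (A : SimpleGraph (Fin n)) (i j : Fin n) :
    edgeScore p q A i j = edgeScore p q A j i := by
  unfold edgeScore
  by_cases h : A.Adj i j
  · rw [if_pos h, if_pos h.symm]
  · rw [if_neg h, if_neg fun h' => h h'.symm]

/-- The indicator that `i` and `j` are in one community. -/
def sameLabel (Z : Labels n K) (i j : Fin n) : ℝ := if Z i = Z j then 1 else 0

theorem sameLabel_comm (Z : Labels n K) (i j : Fin n) : sameLabel Z i j = sameLabel Z j i := by
  simp [sameLabel, eq_comm]

theorem likelihood_eq_mul_exp (hq : 0 < q) (hqp : q < p) (hp : p < 1) (A : SimpleGraph (Fin n))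
    (Z W : Labels n K) :
    likelihood (connMatrix K p q) A W = likelihood (connMatrix K p q) A Z *
      Real.exp (∑ i, ∑ j ∈ Finset.Ioi i,
        (sameLabel W i j - sameLabel Z i j) * edgeScore p q A i j) := by
  have h1p : 0 < 1 - p := by linarith
  have h1q : 0 < 1 - q := by linarith
  have hp0 : 0 < p := hq.trans hqp
  unfold likelihood
  simp_rw [Real.exp_sum, ← Finset.prod_mul_distrib]
  refine Finset.prod_congr rfl fun i _ => Finset.prod_congr rfl fun j _ => ?_
  unfold connMatrix sameLabel edgeScore
  split_ifs <;>
  simp [Real.exp_neg, Real.exp_log, h1p, h1q, hp0, hq] <;> field_simp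

/-- The gain in log-likelihood of giving node `i` label `b` rather than `c`, the other labels
being those of `Z`. -/
noncomputable def advantage (p q : ℝ) (A : SimpleGraph (Fin n)) (Z : Labels n K) (i : Fin n)
    (b c : Fin K) : ℝ :=
  ∑ j ∈ {i}ᶜ, ((if Z j = b then 1 else 0) - if Z j = c then 1 else 0) * edgeScore p q A i j

theorem advantage_swap (A : SimpleGraph (Fin n)) (Z : Labels n K) (i : Fin n) (b c : Fin K) :
    advantage p q A Z i b c = -advantage p q A Z i c b := by
  unfold advantage
  rw [← Finset.sum_neg_distrib]
  exact Finset.sum_congr rfl fun j _ => by ring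

theorem likelihood_update (hq : 0 < q) (hqp : q < p) (hp : p < 1) (A : SimpleGraph (Fin n))
    (Z : Labels n K) (i : Fin n) (b : Fin K) :
    likelihood (connMatrix K p q) A (Function.update Z i b) =
      likelihood (connMatrix K p q) A Z * Real.exp (advantage p q A Z i b (Z i)) := by
  rw [likelihood_eq_mul_exp hq hqp hp A Z]
  congr 2
  set W := Function.update Z i b
  set g : Fin n → Fin n → ℝ := fun k l =>
    (sameLabel W k l - sameLabel Z k l) * edgeScore p q A k l / 2 with hg
  have hsymm : ∀ k l, g k l = g l k := fun k l => by
    simp only [hg]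
    rw [sameLabel_comm W, sameLabel_comm Z, edgeScore_comm]
  have h1 : ∑ k, ∑ l ∈ Finset.Ioi k, (sameLabel W k l - sameLabel Z k l) * edgeScore p q A k l
      = ∑ k, ∑ l ∈ Finset.Ioi k, (g l k + g k l) := by
    refine Finset.sum_congr rfl fun k _ => Finset.sum_congr rfl fun l _ => ?_
    rw [hsymm l k]
    simp only [hg]
    ring
  rw [h1, Finset.sum_sum_Ioi_add_eq_sum_sum_off_diag]
  have h2 : ∀ k ∈ ({i}ᶜ : Finset (Fin n)), ∑ l ∈ {k}ᶜ, g l k = g k i := by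
    intro k hk
    have hki : k ≠ i := by simpa using hk
    rw [hsymm k i]
    refine Finset.sum_eq_single_of_mem i (by simpa using hki.symm) fun l _ hl => ?_
    simp [hg, sameLabel, W, Function.update_of_ne hl, Function.update_of_ne hki]
  rw [← Finset.sum_add_sum_compl {i}, Finset.sum_singleton, Finset.sum_congr rfl h2,
    ← Finset.sum_add_distrib]
  unfold advantage
  refine Finset.sum_congr rfl fun j hj => ?_
  have hji : j ≠ i := by simpa using hj
  rw [hsymm j i]
  simp only [hg, sameLabel, W, Function.update_of_ne hji, Function.update_self]
  simp only [eq_comm (a := Z j)]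
  ring

/-- The total acceptance mass (at temperature two) of the moves that prefer a wrong label. -/
noncomputable def flipMass (p q : ℝ) (A : SimpleGraph (Fin n)) (Zs Z : Labels n K) : ℝ :=
  ∑ i, ∑ b ∈ {Zs i}ᶜ, min 1 (Real.exp (advantage p q A Z i b (Zs i) / 2))

theorem exists_update_of_hammingDist_eq_one {Z W : Labels n K} (h : hammingDist Z W = 1) :
    ∃ i b, b ≠ Z i ∧ W = Function.update Z i b := by
  obtain ⟨i, hi⟩ := Finset.card_eq_one.mp h
  have h1 : ∀ j, Z j ≠ W j ↔ j = i := fun j => by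
    have := Finset.ext_iff.mp hi j
    simpa using this
  refine ⟨i, W i, ((h1 i).mpr rfl).symm, ?_⟩
  ext j
  by_cases hj : j = i
  · rw [hj, Function.update_self]
  · rw [Function.update_of_ne hj]
    have := mt (h1 j).mp hj
    rw [not_not.mp this]

theorem hammingDist_update_le {Z W : Labels n K} (i : Fin n) (b : Fin K) :
    hammingDist (Function.update Z i b) W ≤ hammingDist Z W + 1 := by
  unfold hammingDist
  refine (Finset.card_le_card (t := insert i (Finset.univ.filter fun j => Z j ≠ W j)) ?_).trans
    (Finset.card_insert_le _ _)
  intro j hj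
  by_cases h : j = i
  · simp [h]
  · simpa [Function.update_of_ne h, h] using hj

theorem hammingDist_update_le_of_ne {Z W : Labels n K} (i : Fin n) (b : Fin K)
    (h : Z i ≠ W i ∨ b = W i) : hammingDist (Function.update Z i b) W ≤ hammingDist Z W := by
  unfold hammingDist
  refine Finset.card_le_card ?_
  intro j hj
  by_cases hji : j = i
  · subst hji
    rcases h with h | h
    · simpa using h
    · simp [h] at hj
  · simpa [Function.update_of_ne hji] using hj

theorem hammingDist_update_add_one {Z W : Labels n K} (i : Fin n) (h : Z i ≠ W i) :
    hammingDist (Function.update Z i (W i)) W + 1 = hammingDist Z W := by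
  unfold hammingDist
  have : (Finset.univ.filter fun j => Function.update Z i (W i) j ≠ W j)
      = (Finset.univ.filter fun j => Z j ≠ W j).erase i := by
    ext j
    by_cases hji : j = i
    · subst hji; simp
    · simp [hji]
  rw [this]
  exact Finset.card_erase_add_one (by simpa using h)

theorem sum_moveProb_le (hq : 0 < q) (hqp : q < p) (hp : p < 1) (hn : 1 ≤ n) (hα : 0 < α)
    (hK : 2 ≤ K) (A : SimpleGraph (Fin n)) (Z : feasible n K α)
    (T : Finset (clusterSpace n K α)) (h : Fin n → Fin K → ℝ) (h0 : ∀ i b, 0 ≤ h i b)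
    (hT : ∀ i b, b ≠ Z.1 i → ∀ W : feasible n K α, W.1 = Function.update Z.1 i b →
      toCluster W ∈ T →
      min 1 ((likelihood (connMatrix K p q) A W.1 / likelihood (connMatrix K p q) A Z.1) ^ ξ)
        ≤ h i b) :
    ∑ Γ ∈ T, moveProb (connMatrix K p q) ξ A (toCluster Z) Γ ≤
      1 / ((n : ℝ) * ((K : ℝ) - 1)) * ∑ i, ∑ b, h i b := by
  classical
  have hK' : (2 : ℝ) ≤ K := by exact_mod_cast hK
  have hn' : (1 : ℝ) ≤ n := by exact_mod_cast hn
  have hc : 0 ≤ 1 / ((n : ℝ) * ((K : ℝ) - 1)) := by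
    apply div_nonneg zero_le_one
    nlinarith
  have hbound : ∀ Γ ∈ T, moveProb (connMatrix K p q) ξ A (toCluster Z) Γ ≤
      1 / ((n : ℝ) * ((K : ℝ) - 1)) *
        ∑ i, ∑ b, if cluster (Function.update Z.1 i b) = Γ.1 then h i b else 0 := by
    intro Γ hΓ
    obtain ⟨W, rfl⟩ := exists_toCluster_eq Γ
    have hnn : ∀ i b, 0 ≤ if cluster (Function.update Z.1 i b) = (toCluster W).1 then h i b
        else 0 := fun i b => by split_ifs <;> simp [h0]
    rw [moveProb_toCluster hq hqp hp hn hα]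
    split_ifs with hd
    · refine mul_le_mul_of_nonneg_left ?_ hc
      rw [clusterDist_comm] at hd
      obtain ⟨σ, hσ⟩ := exists_clusterDist_eq W.1 Z.1
      rw [hd, hammingDist_comm] at hσ
      obtain ⟨i, b, hb, hW⟩ := exists_update_of_hammingDist_eq_one hσ
      have hmem : σ ∘ W.1 ∈ cluster W.1 := mem_cluster.mpr ⟨σ, rfl⟩
      let W' : feasible n K α := ⟨σ ∘ W.1, mem_feasible_of_mem_cluster W.2 hmem⟩
      have hW' : toCluster W' = toCluster W := toCluster_eq_iff.mpr hmem
      have h1 := hT i b hb W' hW (by rw [hW']; exact hΓ)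
      rw [show likelihood (connMatrix K p q) A W'.1 = likelihood (connMatrix K p q) A W.1 from
        likelihood_comp A σ W.1] at h1
      refine h1.trans ?_
      calc h i b = if cluster (Function.update Z.1 i b) = (toCluster W).1 then h i b else 0 := by
            rw [if_pos]
            rw [← hW, ← hW']
            rfl
        _ ≤ ∑ b, if cluster (Function.update Z.1 i b) = (toCluster W).1 then h i b else 0 :=
            Finset.single_le_sum (f := fun b => if cluster (Function.update Z.1 i b)
              = (toCluster W).1 then h i b else 0) (fun b _ => hnn i b) (Finset.mem_univ b)
        _ ≤ _ := Finset.single_le_sum (f := fun i => ∑ b, if cluster (Function.update Z.1 i b)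
              = (toCluster W).1 then h i b else 0)
              (fun i _ => Finset.sum_nonneg fun b _ => hnn i b) (Finset.mem_univ i)
    · exact mul_nonneg hc (Finset.sum_nonneg fun i _ => Finset.sum_nonneg fun b _ => hnn i b)
  refine (Finset.sum_le_sum hbound).trans ?_
  rw [← Finset.mul_sum]
  refine mul_le_mul_of_nonneg_left ?_ hc
  rw [Finset.sum_comm]
  refine Finset.sum_le_sum fun i _ => ?_
  rw [Finset.sum_comm]
  refine Finset.sum_le_sum fun b _ => ?_
  by_cases hex : ∃ Γ ∈ T, cluster (Function.update Z.1 i b) = Γ.1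
  · obtain ⟨Γ, hΓ, heq⟩ := hex
    rw [Finset.sum_eq_single_of_mem Γ hΓ, if_pos heq]
    intro Γ' _ hne
    rw [if_neg]
    intro h'
    exact hne (Subtype.ext (h'.symm.trans heq))
  · push Not at hex
    rw [Finset.sum_eq_zero fun Γ hΓ => if_neg (hex Γ hΓ)]
    exact h0 i b

theorem moveProb_nonneg (hn : 1 ≤ n) (hK : 2 ≤ K) (A : SimpleGraph (Fin n))
    (hq : 0 < q) (hqp : q < p) (hp : p < 1) (hα : 0 < α)
    (Γ Γ' : clusterSpace n K α) : 0 ≤ moveProb (connMatrix K p q) ξ A Γ Γ' := by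
  have hK' : (2 : ℝ) ≤ K := by exact_mod_cast hK
  have hn' : (1 : ℝ) ≤ n := by exact_mod_cast hn
  obtain ⟨Z, rfl⟩ := exists_toCluster_eq Γ
  obtain ⟨W, rfl⟩ := exists_toCluster_eq Γ'
  rw [moveProb_toCluster hq hqp hp hn hα]
  split_ifs
  · have h1 := likelihood_pos hq hqp hp A W.1
    have h2 := likelihood_pos hq hqp hp A Z.1
    have h3 : (0 : ℝ) < n * (K - 1) := by nlinarith
    positivity
  · exact le_rfl

theorem isStochastic_transition (hq : 0 < q) (hqp : q < p) (hp : p < 1) (hn : 1 ≤ n) (hα : 0 < α)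
    (hK : 2 ≤ K) (A : SimpleGraph (Fin n)) :
    IsStochastic (transition α (connMatrix K p q) ξ A) := by
  have hK' : (2 : ℝ) ≤ K := by exact_mod_cast hK
  have hn' : (1 : ℝ) ≤ n := by exact_mod_cast hn
  refine ⟨fun Γ Γ' => ?_, fun Γ => ?_⟩
  · unfold transition
    split_ifs
    · rw [sub_nonneg]
      obtain ⟨Z, rfl⟩ := exists_toCluster_eq Γ
      refine (sum_moveProb_le hq hqp hp hn hα hK A Z _ (fun i b => if b = Z.1 i then 0 else 1)
        (fun i b => by split_ifs <;> norm_num) ?_).trans ?_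
      · intro i b hb W _ _
        rw [if_neg hb]
        exact min_le_left _ _
      · have : ∀ i, ∑ b, (if b = Z.1 i then (0 : ℝ) else 1) = K - 1 := by
          intro i
          have h : ∀ b, (if b = Z.1 i then (0 : ℝ) else 1) = 1 - if b = Z.1 i then 1 else 0 :=
            fun b => by split_ifs <;> norm_num
          simp_rw [h, Finset.sum_sub_distrib]
          simp
        simp_rw [this]
        have h3 : (0 : ℝ) < n * (K - 1) := by nlinarith
        simp only [Finset.sum_const, Finset.card_univ, Fintype.card_fin, nsmul_eq_mul]
        rw [one_div_mul_cancel h3.ne']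
    · exact moveProb_nonneg hn hK A hq hqp hp hα _ _
  · rw [← Finset.add_sum_erase _ _ (Finset.mem_univ Γ)]
    have h : ∀ Γ' ∈ Finset.univ.erase Γ, transition α (connMatrix K p q) ξ A Γ Γ'
        = moveProb (connMatrix K p q) ξ A Γ Γ' := fun Γ' hΓ' => by
      rw [transition, if_neg (Finset.ne_of_mem_erase hΓ')]
    rw [Finset.sum_congr rfl h, transition, if_pos rfl]
    convert sub_add_cancel _ _

theorem isInvariant_target (hq : 0 < q) (hqp : q < p) (hp : p < 1) (hn : 1 ≤ n) (hα : 0 < α)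
    (hK : 2 ≤ K) (A : SimpleGraph (Fin n)) (Z : feasible n K α) :
    IsInvariant (transition α (connMatrix K p q) ξ A) (target α (connMatrix K p q) ξ A) := by
  refine isInvariant_of_reversible (isStochastic_transition hq hqp hp hn hα hK A)
    (target_nonneg hq hqp hp hn hα A) (sum_target hq hqp hp A Z.2) fun Γ Γ' => ?_
  by_cases h : Γ' = Γ
  · rw [h]
  · rw [transition, transition, if_neg h, if_neg (Ne.symm h)]
    obtain ⟨V, rfl⟩ := exists_toCluster_eq Γ
    obtain ⟨W, rfl⟩ := exists_toCluster_eq Γ'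
    rw [moveProb_toCluster hq hqp hp hn hα, moveProb_toCluster hq hqp hp hn hα,
      target_toCluster hq hqp hp hn hα, target_toCluster hq hqp hp hn hα,
      clusterDist_comm (cluster W.1)]
    split_ifs
    · have hV := likelihood_pos hq hqp hp A V.1
      have hW := likelihood_pos hq hqp hp A W.1
      have hV' := Real.rpow_pos_of_pos hV ξ
      have hW' := Real.rpow_pos_of_pos hW ξ
      rw [Real.div_rpow hV.le hW.le, Real.div_rpow hW.le hV.le]
      generalize likelihood (connMatrix K p q) A V.1 ^ ξ = a at *
      generalize likelihood (connMatrix K p q) A W.1 ^ ξ = b at *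
      have key : a * min 1 (b / a) = b * min 1 (a / b) := by
        rw [mul_min_of_nonneg _ _ hV'.le, mul_min_of_nonneg _ _ hW'.le, mul_div_cancel₀ _ hV'.ne',
          mul_div_cancel₀ _ hW'.ne', mul_one, mul_one, min_comm]
      have : ∀ c d e : ℝ, c * (a / d) * (e * min 1 (b / a)) = c / d * e * (a * min 1 (b / a)) :=
        fun c d e => by ring
      rw [this, key]
      ring
    · rw [mul_zero, mul_zero]

end Scores

section Rates

variable {n K : ℕ} {α β p q ξ : ℝ}

theorem communitySize_update_le (Z : Labels n K) (i : Fin n) (b k : Fin K) :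
    communitySize (Function.update Z i b) k ≤ communitySize Z k + if k = b then 1 else 0 := by
  unfold communitySize
  split_ifs with h
  · refine (Finset.card_le_card (t := insert i (Finset.univ.filter fun j => Z j = k)) ?_).trans
      (Finset.card_insert_le _ _)
    intro j hj
    by_cases hji : j = i
    · simp [hji]
    · simpa [Function.update_of_ne hji, hji] using hj
  · rw [add_zero]
    refine Finset.card_le_card fun j hj => ?_
    by_cases hji : j = i
    · subst hji
      simp at hj
      exact absurd hj.symm h
    · simpa [Function.update_of_ne hji, hji] using hj

theorem le_communitySize_update (Z : Labels n K) (i : Fin n) (b k : Fin K) :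
    communitySize Z k ≤
      communitySize (Function.update Z i b) k + if k = Z i then 1 else 0 := by
  have h := communitySize_update_le (Function.update Z i b) i (Z i) k
  rwa [Function.update_idem, Function.update_eq_self] at h

theorem card_filter_mem_eq_sum (Z : Labels n K) (L : Finset (Fin K)) :
    (Finset.univ.filter fun i => Z i ∈ L).card = ∑ k ∈ L, communitySize Z k := by
  rw [Finset.card_eq_sum_card_fiberwise (f := Z) (t := L) (fun i hi => by simpa using hi)]
  refine Finset.sum_congr rfl fun k hk => ?_
  unfold communitySize
  congr 1
  ext i
  simp only [Finset.mem_filter, Finset.mem_univ, true_and, and_iff_right_iff_imp]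
  rintro rfl
  exact hk

theorem le_card_filter_diff {Z W : Labels n K} (L : Finset (Fin K)) (hL : L.Nonempty) {c : ℝ}
    (hc : 0 ≤ c) (h : ∀ k ∈ L, (communitySize W k : ℝ) + c ≤ communitySize Z k) :
    c ≤ (Finset.univ.filter fun i => Z i ∈ L ∧ W i ∉ L).card := by
  have h1 : (Finset.univ.filter fun i => Z i ∈ L).card ≤
      (Finset.univ.filter fun i => Z i ∈ L ∧ W i ∉ L).card
        + (Finset.univ.filter fun i => W i ∈ L).card := by
    refine (Finset.card_le_card ?_).trans (Finset.card_union_le _ _)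
    intro i hi
    by_cases hW : W i ∈ L <;> simp_all
  rw [card_filter_mem_eq_sum, card_filter_mem_eq_sum] at h1
  have h2 : (∑ k ∈ L, (communitySize Z k : ℝ)) ≤
      (Finset.univ.filter fun i => Z i ∈ L ∧ W i ∉ L).card
        + ∑ k ∈ L, (communitySize W k : ℝ) := by exact_mod_cast h1
  have h3 := Finset.sum_le_sum h
  rw [Finset.sum_add_distrib, Finset.sum_const, nsmul_eq_mul] at h3
  have h4 : (1 : ℝ) ≤ L.card := by exact_mod_cast hL.card_pos
  nlinarith

/-- A positive fraction of the misclassified nodes can be corrected without leaving `S_α`. -/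
theorem le_card_correctable (hβ : 1 ≤ β) (hαβ : β < α) {c : ℝ}
    (hc : 2 * K * c = 1 / β - 1 / α) (hcn : 1 ≤ c * n) (hK : 2 ≤ K)
    {Z Zs : Labels n K} (hZ : Z ∈ feasible n K α) (hZs : Zs ∈ feasible n K β) :
    c * hammingDist Z Zs ≤ (Finset.univ.filter fun i => Z i ≠ Zs i ∧
      Function.update Z i (Zs i) ∈ feasible n K α).card := by
  classical
  have hα : 1 < α := by linarith
  have hK' : (2 : ℝ) ≤ K := by exact_mod_cast hK
  have hK0 : (0 : ℝ) < K := by linarith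
  have hβ1 : 1 / β ≤ 1 := by rw [div_le_one (by linarith)]; exact hβ
  have hα0 : 0 < 1 / α := by positivity
  have hinv : 1 / α < 1 / β := one_div_lt_one_div_of_lt (by linarith) hαβ
  have hc0 : 0 < c := by
    by_contra h
    push Not at h
    nlinarith
  have hn0 : (0 : ℝ) < n := by
    by_contra h
    push Not at h
    nlinarith
  have hc1 : c ≤ 1 := by nlinarith
  have hdist : (hammingDist Z Zs : ℝ) ≤ n := by
    have h : hammingDist Z Zs ≤ Fintype.card (Fin n) := hammingDist_le_card_fintype
    rw [Fintype.card_fin] at h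
    exact_mod_cast h
  have hlow : ∀ γ : ℝ, γ ≠ 0 → (n : ℝ) / (γ * K) = n * (1 / γ) / K := fun γ hγ => by
    field_simp
  have hgap : n * (1 / β) / K - n * (1 / α) / K = 2 * (c * n) := by
    rw [← sub_div, ← mul_sub, ← hc]
    field_simp
  have hgap2 : 2 * (c * n) ≤ α * n / K - β * n / K := by
    rw [← hgap, ← sub_div, ← sub_div, div_le_div_iff_of_pos_right hK0, ← mul_sub, ← sub_mul,
      mul_comm]
    refine mul_le_mul_of_nonneg_right ?_ hn0.le
    have : 1 / β - 1 / α = (α - β) / (β * α) := by field_simp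
    rw [this, div_le_iff₀ (by nlinarith)]
    nlinarith [mul_le_mul hβ hα.le zero_le_one (by linarith)]
  have hgap3 : 2 ≤ α * n / K - n * (1 / α) / K := by
    have h1 : n * (1 / β) / K ≤ α * n / K := by
      rw [div_le_div_iff_of_pos_right hK0]
      nlinarith
    linarith
  set L : Finset (Fin K) := Finset.univ.filter fun k =>
    (communitySize Z k : ℝ) - 1 < n / (α * K) with hLdef
  set U : Finset (Fin K) := Finset.univ.filter fun k =>
    α * n / K < (communitySize Z k : ℝ) + 1 with hUdef
  have hmove : ∀ i, Z i ≠ Zs i → Z i ∉ L → Zs i ∉ U →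
      Function.update Z i (Zs i) ∈ feasible n K α := by
    intro i hi hiL hiU
    have hiL' : (n : ℝ) / (α * K) ≤ (communitySize Z (Z i) : ℝ) - 1 := by
      simpa [hLdef] using hiL
    have hiU' : (communitySize Z (Zs i) : ℝ) + 1 ≤ α * n / K := by
      simpa [hUdef] using hiU
    rw [mem_feasible] at hZ ⊢
    intro k
    have h1 := communitySize_update_le Z i (Zs i) k
    have h2 := le_communitySize_update Z i (Zs i) k
    have h1' : (communitySize (Function.update Z i (Zs i)) k : ℝ) ≤
        communitySize Z k + if k = Zs i then 1 else 0 := by exact_mod_cast h1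
    have h2' : (communitySize Z k : ℝ) ≤ communitySize (Function.update Z i (Zs i)) k
        + if k = Z i then 1 else 0 := by exact_mod_cast h2
    obtain ⟨h3, h4⟩ := hZ k
    constructor
    · split_ifs at h2' with h
      · rw [← h] at hiL'; linarith
      · linarith
    · split_ifs at h1' with h
      · rw [← h] at hiU'; linarith
      · linarith
  have hLU : ∀ k, k ∈ L → k ∉ U := by
    intro k hkL hkU
    have h1 : (communitySize Z k : ℝ) - 1 < n / (α * K) := by simpa [hLdef] using hkL
    have h2 : α * n / K < (communitySize Z k : ℝ) + 1 := by simpa [hUdef] using hkU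
    rw [hlow α (by linarith)] at h1
    linarith
  have hcard : ∀ s : Finset (Fin n), (∀ i ∈ s, Z i ≠ Zs i ∧ Z i ∉ L ∧ Zs i ∉ U) →
      (s.card : ℝ) ≤ (Finset.univ.filter fun i => Z i ≠ Zs i ∧
        Function.update Z i (Zs i) ∈ feasible n K α).card := by
    intro s hs
    refine Nat.cast_le.mpr (Finset.card_le_card fun i hi => ?_)
    obtain ⟨h1, h2, h3⟩ := hs i hi
    simp only [Finset.mem_filter, Finset.mem_univ, true_and]
    exact ⟨h1, hmove i h1 h2 h3⟩
  by_cases hL : L.Nonempty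
  · refine le_trans ?_ (hcard (Finset.univ.filter fun i => Zs i ∈ L ∧ Z i ∉ L) ?_)
    · refine le_trans ?_ (le_card_filter_diff L hL (c := c * n) (by positivity) ?_)
      · nlinarith
      · intro k hk
        have h1 : (communitySize Z k : ℝ) - 1 < n / (α * K) := by simpa [hLdef] using hk
        have h2 := (mem_feasible.mp hZs k).1
        rw [hlow α (by linarith)] at h1
        rw [hlow β (by linarith)] at h2
        linarith
    · intro i hi
      simp only [Finset.mem_filter, Finset.mem_univ, true_and] at hi
      exact ⟨fun h => hi.2 (h ▸ hi.1), hi.2, hLU _ hi.1⟩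
  · rw [Finset.not_nonempty_iff_eq_empty] at hL
    by_cases hU : U.Nonempty
    · refine le_trans ?_ (hcard (Finset.univ.filter fun i => Z i ∈ U ∧ Zs i ∉ U) ?_)
      · refine le_trans ?_ (le_card_filter_diff U hU (c := c * n) (by positivity) ?_)
        · nlinarith
        · intro k hk
          have h1 : α * n / K < (communitySize Z k : ℝ) + 1 := by simpa [hUdef] using hk
          have h2 := (mem_feasible.mp hZs k).2
          linarith
      · intro i hi
        simp only [Finset.mem_filter, Finset.mem_univ, true_and] at hi
        exact ⟨fun h => hi.2 (h ▸ hi.1), by simp [hL], hi.2⟩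
    · rw [Finset.not_nonempty_iff_eq_empty] at hU
      refine le_trans ?_ (hcard (Finset.univ.filter fun i => Z i ≠ Zs i) ?_)
      · have : (0 : ℝ) ≤ hammingDist Z Zs := by positivity
        change c * hammingDist Z Zs ≤ (hammingDist Z Zs : ℝ)
        nlinarith
      · intro i hi
        simp only [Finset.mem_filter, Finset.mem_univ, true_and] at hi
        exact ⟨hi, by simp [hL], by simp [hU]⟩

theorem likelihood_ratio_update (hq : 0 < q) (hqp : q < p) (hp : p < 1) (A : SimpleGraph (Fin n))
    (Z : Labels n K) (i : Fin n) (b : Fin K) :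
    (likelihood (connMatrix K p q) A (Function.update Z i b) /
      likelihood (connMatrix K p q) A Z) = Real.exp (advantage p q A Z i b (Z i)) := by
  rw [likelihood_update hq hqp hp, mul_div_cancel_left₀ _ (likelihood_pos hq hqp hp A Z).ne']

theorem up_rate_le (hq : 0 < q) (hqp : q < p) (hp : p < 1) (hn : 1 ≤ n) (hα : 0 < α)
    (hK : 2 ≤ K) (hξ : 1 ≤ ξ) (A : SimpleGraph (Fin n)) (Z : feasible n K α) (Zs : Labels n K)
    (hZ : hammingDist Z.1 Zs = clusterDist (cluster Z.1) (cluster Zs)) :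
    ∑ Γ : clusterSpace n K α with
        clusterDist (toCluster Z).1 (cluster Zs) < clusterDist Γ.1 (cluster Zs),
      transition α (connMatrix K p q) ξ A (toCluster Z) Γ ≤
      1 / ((n : ℝ) * ((K : ℝ) - 1)) * flipMass p q A Zs Z.1 := by
  classical
  rw [Finset.sum_congr rfl (g := fun Γ => moveProb (connMatrix K p q) ξ A (toCluster Z) Γ)]
  · refine (sum_moveProb_le hq hqp hp hn hα hK A Z _ (fun i b => if b ∈ ({Zs i}ᶜ : Finset _) then
      min 1 (Real.exp (advantage p q A Z.1 i b (Zs i) / 2)) else 0)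
      (fun i b => by split_ifs <;> positivity) ?_).trans (le_of_eq ?_)
    · intro i b hb W hW hT
      have hT' : clusterDist (cluster Z.1) (cluster Zs) < clusterDist (cluster W.1) (cluster Zs) :=
        (Finset.mem_filter.mp hT).2
      have h1 := (hZ.trans_lt hT').trans_le (clusterDist_le_hammingDist W.1 Zs)
      rw [hW] at h1
      have h2 : ¬(Z.1 i ≠ Zs i ∨ b = Zs i) := fun h =>
        absurd (hammingDist_update_le_of_ne (Z := Z.1) (W := Zs) i b h) (by omega)
      push Not at h2
      rw [if_pos (by simpa using h2.2), hW, likelihood_ratio_update hq hqp hp, h2.1]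
      rw [← Real.exp_mul]
      by_cases hadv : advantage p q A Z.1 i b (Zs i) ≤ 0
      · refine min_le_min le_rfl (Real.exp_le_exp.mpr ?_)
        nlinarith
      · push Not at hadv
        rw [min_eq_left (b := Real.exp (advantage p q A Z.1 i b (Zs i) / 2))]
        · exact min_le_left _ _
        · exact Real.one_le_exp (by linarith)
    · unfold flipMass
      congr 1
      refine Finset.sum_congr rfl fun i _ => ?_
      rw [← Finset.sum_filter]
      exact Finset.sum_congr (by ext; simp) fun _ _ => rfl
  · intro Γ hΓ
    rw [transition, if_neg]
    rintro rfl
    simp at hΓ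

theorem le_down_rate (hq : 0 < q) (hqp : q < p) (hp : p < 1) (hn : 1 ≤ n)
    (hK : 2 ≤ K) (hξ : 1 ≤ ξ) (hβ : 1 ≤ β) (hαβ : β < α) {c : ℝ}
    (hc : 2 * K * c = 1 / β - 1 / α) (hcn : 1 ≤ c * n)
    (A : SimpleGraph (Fin n)) (Z : feasible n K α) {Zs : Labels n K}
    (hZs : Zs ∈ feasible n K β)
    (hZ : hammingDist Z.1 Zs = clusterDist (cluster Z.1) (cluster Zs))
    (hclose : (hammingDist Z.1 Zs : ℝ) < n / (α * K)) :
    1 / ((n : ℝ) * ((K : ℝ) - 1)) * (c * hammingDist Z.1 Zs - flipMass p q A Zs Z.1) ≤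
      ∑ Γ : clusterSpace n K α with
        clusterDist Γ.1 (cluster Zs) < clusterDist (toCluster Z).1 (cluster Zs),
      transition α (connMatrix K p q) ξ A (toCluster Z) Γ := by
  classical
  have hα : 0 < α := by linarith
  have hK' : (2 : ℝ) ≤ K := by exact_mod_cast hK
  have hn' : (1 : ℝ) ≤ n := by exact_mod_cast hn
  have hc0 : (0 : ℝ) ≤ 1 / (n * (K - 1)) := div_nonneg zero_le_one (by nlinarith)
  set D := Finset.univ.filter fun i => Z.1 i ≠ Zs i ∧
    Function.update Z.1 i (Zs i) ∈ feasible n K α with hD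
  set D₁ := D.filter fun i => advantage p q A Z.1 i (Z.1 i) (Zs i) ≤ 0 with hD₁
  have hcard : c * hammingDist Z.1 Zs - flipMass p q A Zs Z.1 ≤ D₁.card := by
    have h1 := le_card_correctable hβ hαβ hc hcn hK Z.2 hZs
    rw [← hD, ← Finset.card_filter_add_card_filter_not
      (fun i => advantage p q A Z.1 i (Z.1 i) (Zs i) ≤ 0), ← hD₁, Nat.cast_add] at h1
    have h2 : ((D.filter fun i => ¬advantage p q A Z.1 i (Z.1 i) (Zs i) ≤ 0).card : ℝ) ≤
        flipMass p q A Zs Z.1 := by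
      rw [Finset.card_eq_sum_ones, Nat.cast_sum]
      unfold flipMass
      have hnn : ∀ i, 0 ≤ ∑ b ∈ ({Zs i}ᶜ : Finset (Fin K)),
          min 1 (Real.exp (advantage p q A Z.1 i b (Zs i) / 2)) :=
        fun i => Finset.sum_nonneg fun b _ => by positivity
      refine le_trans (Finset.sum_le_sum fun i hi => ?_)
        (Finset.sum_le_univ_sum_of_nonneg hnn)
      simp only [hD, Finset.mem_filter, Finset.mem_univ, true_and, not_le] at hi
      refine le_trans (le_of_eq ?_) (Finset.single_le_sum (f := fun b =>
        min 1 (Real.exp (advantage p q A Z.1 i b (Zs i) / 2))) (fun b _ => by positivity)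
        (a := Z.1 i) (by simpa using hi.1.1))
      rw [min_eq_left (Real.one_le_exp (by linarith [hi.2]))]
      simp
    linarith
  have hmem : ∀ i, i ∈ D₁ → Z.1 i ≠ Zs i ∧ Function.update Z.1 i (Zs i) ∈ feasible n K α ∧
      advantage p q A Z.1 i (Z.1 i) (Zs i) ≤ 0 := fun i hi => by
    simp only [hD₁, hD, Finset.mem_filter, Finset.mem_univ, true_and] at hi
    exact ⟨hi.1.1, hi.1.2, hi.2⟩
  let φ : D₁ → clusterSpace n K α := fun i =>
    toCluster ⟨Function.update Z.1 i.1 (Zs i.1), (hmem i.1 i.2).2.1⟩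
  have hlt : ∀ i : D₁, clusterDist (φ i).1 (cluster Zs)
      < clusterDist (toCluster Z).1 (cluster Zs) := by
    intro i
    have h1 := clusterDist_le_hammingDist (Function.update Z.1 i.1 (Zs i.1)) Zs
    have h2 := hammingDist_update_add_one (Z := Z.1) (W := Zs) i.1 (hmem i.1 i.2).1
    change clusterDist (cluster (Function.update Z.1 i.1 (Zs i.1))) _
      < clusterDist (cluster Z.1) (cluster Zs)
    omega
  have hinj : Function.Injective φ := by
    intro i j hij
    have h1 := toCluster_eq_iff.mp hij
    have h2i := hammingDist_update_add_one (Z := Z.1) (W := Zs) i.1 (hmem i.1 i.2).1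
    have h2j := hammingDist_update_add_one (Z := Z.1) (W := Zs) j.1 (hmem j.1 j.2).1
    have h3i : (hammingDist (Function.update Z.1 i.1 (Zs i.1)) Zs : ℝ) + 1
      = hammingDist Z.1 Zs := by exact_mod_cast h2i
    have h3j : (hammingDist (Function.update Z.1 j.1 (Zs j.1)) Zs : ℝ) + 1
      = hammingDist Z.1 Zs := by exact_mod_cast h2j
    have h4 := eq_of_mem_cluster_of_close (hmem j.1 j.2).2.1 h1 (V := Zs) (by simp only; linarith)
    by_contra hne
    have hne' : i.1 ≠ j.1 := fun h => hne (Subtype.ext h)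
    have h5 := congrFun h4 i.1
    simp only [Function.update_self, Function.update_of_ne hne'] at h5
    exact (hmem i.1 i.2).1 h5.symm
  have hval : ∀ i : D₁, transition α (connMatrix K p q) ξ A (toCluster Z) (φ i)
      = 1 / ((n : ℝ) * ((K : ℝ) - 1)) := by
    intro i
    have hne : φ i ≠ toCluster Z := fun h => by
      have := hlt i
      rw [h] at this
      exact lt_irrefl _ this
    obtain ⟨h1, h2, h3⟩ := hmem i.1 i.2
    rw [transition, if_neg hne, moveProb_toCluster hq hqp hp hn hα, if_pos]
    · simp only
      rw [likelihood_ratio_update hq hqp hp, min_eq_left, mul_one]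
      rw [advantage_swap] at h3
      exact Real.one_le_rpow (Real.one_le_exp (by linarith)) (by linarith)
    · simp only
      apply le_antisymm
      · refine (clusterDist_le_hammingDist _ _).trans ?_
        rw [hammingDist_comm]
        have := hammingDist_update_le (Z := Z.1) (W := Z.1) i.1 (Zs i.1)
        simpa using this
      · by_contra h
        have h0 : clusterDist (cluster Z.1) (cluster (Function.update Z.1 i.1 (Zs i.1))) = 0 := by
          omega
        exact hne (toCluster_eq_iff.mpr (by
          rw [clusterDist_comm] at h0
          exact clusterDist_eq_zero h0))
  calc _ ≤ 1 / ((n : ℝ) * ((K : ℝ) - 1)) * D₁.card := mul_le_mul_of_nonneg_left hcard hc0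
    _ = ∑ i : D₁, transition α (connMatrix K p q) ξ A (toCluster Z) (φ i) := by
        rw [Finset.sum_congr rfl fun i _ => hval i, Finset.sum_const, Finset.card_univ,
          Fintype.card_coe, nsmul_eq_mul, mul_comm]
    _ = ∑ Γ ∈ Finset.univ.image φ, transition α (connMatrix K p q) ξ A (toCluster Z) Γ := by
        rw [Finset.sum_image fun i _ j _ h => hinj h]
    _ ≤ _ := by
        refine Finset.sum_le_sum_of_subset_of_nonneg ?_ fun Γ _ _ =>
          (isStochastic_transition hq hqp hp hn hα hK A).nonneg _ _
        intro Γ hΓ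
        obtain ⟨i, _, rfl⟩ := Finset.mem_image.mp hΓ
        simp only [Finset.mem_filter, Finset.mem_univ, true_and]
        exact hlt i

end Rates

section Mixing

variable {n K : ℕ} {α β p q ξ : ℝ}

theorem feasible_mono (hβ : 1 ≤ β) (hαβ : β < α) : feasible n K β ⊆ feasible n K α := by
  intro Z hZ
  rw [mem_feasible] at hZ ⊢
  intro k
  have hK : (0 : ℝ) < K := by exact_mod_cast Fin.pos k
  obtain ⟨h1, h2⟩ := hZ k
  refine ⟨le_trans ?_ h1, h2.trans ?_⟩ <;> gcongr

theorem transition_ne_zero {A : SimpleGraph (Fin n)} {B : Matrix (Fin K) (Fin K) ℝ}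
    {Γ Γ' : clusterSpace n K α} (hne : Γ' ≠ Γ) (h : transition α B ξ A Γ Γ' ≠ 0) :
    clusterDist Γ.1 Γ'.1 = 1 := by
  rw [transition, if_neg hne, moveProb] at h
  by_contra h'
  exact h (if_neg h')

/-- Total variation bound for the chain and its lazy version, on a graph on which wrong flips are
unlikely near the truth and the posterior concentrates. -/
theorem tvAt_le_of_good (hq : 0 < q) (hqp : q < p) (hp : p < 1) (hn : 1 ≤ n)
    (hK : 2 ≤ K) (hξ : 1 ≤ ξ) (hβ : 1 ≤ β) (hαβ : β < α) {c : ℝ}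
    (hc : 2 * K * c = 1 / β - 1 / α) (hcn : 1 ≤ c * n)
    (A : SimpleGraph (Fin n)) {Zs : Labels n K} (hZs : Zs ∈ feasible n K β) {M : ℝ}
    (hM : M ≤ n / (α * K))
    (hflip : ∀ Z ∈ feasible n K α, Z ≠ Zs → (hammingDist Z Zs : ℝ) < M →
      flipMass p q A Zs Z ≤ c / 8 * hammingDist Z Zs)
    {e : ℝ} (he : e ≤ 1)
    (hcontr : ∑ W ∈ feasible n K α with W ∉ cluster Zs,
      √(likelihood (connMatrix K p q) A W / likelihood (connMatrix K p q) A Zs) ≤ e)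
    {P : Matrix (clusterSpace n K α) (clusterSpace n K α) ℝ} {s : ℝ} (hs : 1 / 2 ≤ s)
    (hP : IsStochastic P) (hπ : IsInvariant P (target α (connMatrix K p q) ξ A))
    (hPs : ∀ Γ Γ', Γ' ≠ Γ → P Γ Γ' = s * transition α (connMatrix K p q) ξ A Γ Γ')
    (Z : feasible n K α) (t : ℕ) :
    tvAt P (target α (connMatrix K p q) ξ A) (toCluster Z) t ≤
      e + (1 - c / (4 * n * (K - 1))) ^ t * n
        + (2 : ℝ) ^ ((clusterDist (cluster Z.1) (cluster Zs) : ℝ) - M) := by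
  classical
  have hα : 0 < α := by linarith
  have hK' : (2 : ℝ) ≤ K := by exact_mod_cast hK
  have hn' : (1 : ℝ) ≤ n := by exact_mod_cast hn
  have hnK : (0 : ℝ) < n * (K - 1) := by nlinarith
  have hinv : 1 / α < 1 / β := one_div_lt_one_div_of_lt (by linarith) hαβ
  have hc0 : 0 < c := by
    by_contra h
    push Not at h
    nlinarith
  have hc1 : c ≤ 1 := by
    have : 1 / β ≤ 1 := by rw [div_le_one (by linarith)]; exact hβ
    have : 0 < 1 / α := by positivity
    nlinarith
  let Zα : feasible n K α := ⟨Zs, feasible_mono hβ hαβ hZs⟩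
  let f : clusterSpace n K α → ℕ := fun Γ => clusterDist Γ.1 (cluster Zs)
  have hf : ∀ Γ, f Γ = 0 → Γ = toCluster Zα := by
    intro Γ h
    obtain ⟨W, rfl⟩ := exists_toCluster_eq Γ
    exact toCluster_eq_iff.mpr (clusterDist_eq_zero h)
  set l := c / (4 * n * (K - 1)) with hl
  have hl' : l = c / 4 * (1 / (n * (K - 1))) := by rw [hl]; field_simp
  have hl1 : l ≤ 1 := by
    rw [hl, div_le_one (by nlinarith)]
    nlinarith
  have hdrift : ∀ Γ, f Γ ≠ 0 → (f Γ : ℝ) < M →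
      ∑ Γ', P Γ Γ' * f Γ' ≤ (1 - l) * f Γ ∧ ∑ Γ', P Γ Γ' * (2 : ℝ) ^ f Γ' ≤ 2 ^ f Γ := by
    intro Γ h0 hlt
    obtain ⟨V, rfl⟩ := exists_toCluster_eq Γ
    obtain ⟨σ, hσ⟩ := exists_clusterDist_eq V.1 Zs
    have hmem : σ ∘ V.1 ∈ cluster V.1 := mem_cluster.mpr ⟨σ, rfl⟩
    let W : feasible n K α := ⟨σ ∘ V.1, mem_feasible_of_mem_cluster V.2 hmem⟩
    have hW : toCluster W = toCluster V := toCluster_eq_iff.mpr hmem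
    rw [← hW] at h0 hlt ⊢
    have hWd : hammingDist W.1 Zs = clusterDist (cluster W.1) (cluster Zs) := by
      rw [show cluster W.1 = cluster V.1 from congrArg Subtype.val hW]
      exact hσ
    have hfW : f (toCluster W) = hammingDist W.1 Zs := hWd.symm
    have hflipW := hflip W.1 W.2 (fun h => h0 (by rw [hfW, h, hammingDist_self]))
      (by rw [← hfW]; exact hlt)
    have hu := up_rate_le hq hqp hp hn hα hK hξ A W Zs hWd
    have hd := le_down_rate hq hqp hp hn hK hξ hβ hαβ hc hcn A W hZs hWd
      (by rw [← hfW]; exact hlt.trans_le hM)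
    have hr0 : (0 : ℝ) < 1 / (n * (K - 1)) := by positivity
    set r := 1 / ((n : ℝ) * (K - 1))
    set m : ℝ := (hammingDist W.1 Zs : ℝ) with hm
    have hm0 : 0 ≤ m := by positivity
    have hrm : 0 ≤ r * (c * m) := by positivity
    have key := drift_of_rates hP f (toCluster W) ?_ (s * (r * (c / 8 * m)))
      (s * (r * (7 * c / 8 * m))) ?_ ?_ ?_
    · refine ⟨key.1.trans ?_, key.2⟩
      rw [hfW, ← hm, hl']
      nlinarith
    · intro Γ' hΓ'
      by_cases hne : Γ' = toCluster W
      · rw [hne]; constructor <;> omega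
      · rw [hPs _ _ hne] at hΓ'
        have h1 := transition_ne_zero hne (right_ne_zero_of_mul hΓ')
        obtain ⟨V', rfl⟩ := exists_toCluster_eq Γ'
        have h2 := clusterDist_triangle W.1 V'.1 Zs
        have h3 := clusterDist_triangle V'.1 W.1 Zs
        rw [clusterDist_comm (cluster V'.1) (cluster W.1)] at h3
        have h1' : clusterDist (cluster W.1) (cluster V'.1) = 1 := h1
        change clusterDist (cluster V'.1) _ ≤ clusterDist (cluster W.1) _ + 1 ∧
          clusterDist (cluster W.1) _ ≤ clusterDist (cluster V'.1) _ + 1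
        omega
    · rw [Finset.sum_congr rfl fun Γ' hΓ' => hPs _ Γ' (by
        rintro rfl
        simp at hΓ'), ← Finset.mul_sum]
      refine mul_le_mul_of_nonneg_left (hu.trans ?_) (by linarith)
      exact mul_le_mul_of_nonneg_left hflipW hr0.le
    · rw [Finset.sum_congr rfl fun Γ' hΓ' => hPs _ Γ' (by
        rintro rfl
        simp at hΓ'), ← Finset.mul_sum]
      refine mul_le_mul_of_nonneg_left (le_trans ?_ hd) (by linarith)
      exact mul_le_mul_of_nonneg_left (by linarith) hr0.le
    · nlinarith
  have hmain := tvAt_le_of_drift hP hπ f (toCluster Zα) hf M l hl1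
    (fun Γ h0 h1 => (hdrift Γ h0 h1).1) (fun Γ h0 h1 => (hdrift Γ h0 h1).2) t (toCluster Z)
  refine hmain.trans ?_
  have h1 := one_sub_target_le (ξ := ξ) hq hqp hp hn hα hξ A Zα he hcontr
  have h2 : (f (toCluster Z) : ℝ) ≤ n := by
    have h : hammingDist Z.1 Zs ≤ Fintype.card (Fin n) := hammingDist_le_card_fintype
    rw [Fintype.card_fin] at h
    exact_mod_cast (clusterDist_le_hammingDist Z.1 Zs).trans h
  have h3 : (2 : ℝ) ^ f (toCluster Z) * (2 : ℝ) ^ (-M)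
      = (2 : ℝ) ^ ((clusterDist (cluster Z.1) (cluster Zs) : ℝ) - M) := by
    rw [← Real.rpow_natCast, ← Real.rpow_add (by norm_num)]
    rfl
  rw [h3]
  have : 0 ≤ 1 - l := by linarith
  gcongr

theorem mixing_of_good (hq : 0 < q) (hqp : q < p) (hp : p < 1) (hn : 1 ≤ n)
    (hK : 2 ≤ K) (hξ : 1 ≤ ξ) (hβ : 1 ≤ β) (hαβ : β < α) {c : ℝ}
    (hc : 2 * K * c = 1 / β - 1 / α) (hcn : 1 ≤ c * n)
    (A : SimpleGraph (Fin n)) {Zs : Labels n K} (hZs : Zs ∈ feasible n K β) {M : ℝ}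
    (hM : M ≤ n / (α * K))
    (hflip : ∀ Z ∈ feasible n K α, Z ≠ Zs → (hammingDist Z Zs : ℝ) < M →
      flipMass p q A Zs Z ≤ c / 8 * hammingDist Z Zs)
    {ε : ℝ} (hε1 : ε ≤ 1)
    (hcontr : ∑ W ∈ feasible n K α with W ∉ cluster Zs,
      √(likelihood (connMatrix K p q) A W / likelihood (connMatrix K p q) A Zs) ≤ ε / 4)
    (hε0 : 0 < ε) (Z : feasible n K α) {γ : ℝ} (hγ : loss Z.1 Zs ≤ γ)
    (hexit : (2 : ℝ) ^ (γ * n - M) ≤ ε / 4) {T : ℝ} (hT0 : 0 ≤ T)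
    (hT : ∀ t : ℕ, T < t + 1 → (1 - c / (4 * n * (K - 1))) ^ t * n ≤ ε / 4) :
    ∀ P ∈ ({transition α (connMatrix K p q) ξ A, lazyTransition α (connMatrix K p q) ξ A} :
        Set (Matrix (clusterSpace n K α) (clusterSpace n K α) ℝ)),
      ∃ t : ℕ, mixingTime P (target α (connMatrix K p q) ξ A) ε (toCluster Z) = t ∧
        (t : ℝ) ≤ T := by
  classical
  have hα : 0 < α := by linarith
  have hn' : (1 : ℝ) ≤ n := by exact_mod_cast hn
  have hst := isStochastic_transition (ξ := ξ) hq hqp hp hn hα hK A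
  have hinv := isInvariant_target (ξ := ξ) hq hqp hp hn hα hK A Z
  have hdist : (clusterDist (cluster Z.1) (cluster Zs) : ℝ) ≤ γ * n := by
    rwa [loss, div_le_iff₀ (by linarith)] at hγ
  have hgen : ∀ (P : Matrix (clusterSpace n K α) (clusterSpace n K α) ℝ) (s : ℝ), 1 / 2 ≤ s →
      IsStochastic P → IsInvariant P (target α (connMatrix K p q) ξ A) →
      (∀ Γ Γ', Γ' ≠ Γ → P Γ Γ' = s * transition α (connMatrix K p q) ξ A Γ Γ') →
      ∃ t : ℕ, mixingTime P (target α (connMatrix K p q) ξ A) ε (toCluster Z) = t ∧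
        (t : ℝ) ≤ T := by
    intro P s hs h1 h2 h3
    refine exists_mixingTime_eq hT0 fun t ht => ?_
    refine (tvAt_le_of_good hq hqp hp hn hK hξ hβ hαβ hc hcn A hZs hM hflip (by linarith) hcontr
      hs h1 h2 h3 Z t).trans ?_
    have h4 := hT t ht
    have h5 : (2 : ℝ) ^ ((clusterDist (cluster Z.1) (cluster Zs) : ℝ) - M) ≤ ε / 4 :=
      le_trans (Real.rpow_le_rpow_of_exponent_le (by norm_num) (by linarith)) hexit
    linarith
  rintro P (rfl | rfl)
  · exact hgen _ 1 (by norm_num) hst hinv fun Γ Γ' _ => by rw [one_mul]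
  · have hlz : lazyTransition α (connMatrix K p q) ξ A
        = (1 / 2 : ℝ) • (transition α (connMatrix K p q) ξ A + 1) := by
      unfold lazyTransition
      congr!
    refine hgen _ (1 / 2) le_rfl ?_ ?_ fun Γ Γ' hne => ?_
    · rw [hlz]; exact hst.lazy
    · rw [hlz]; exact hinv.lazy
    · rw [hlz]
      simp [hne.symm]

end Mixing

section Bernoulli

variable {p q : ℝ}

/-- The mean of the edge score when the edge is present with probability `r`. -/
noncomputable def edgeMean (p q r : ℝ) : ℝ :=
  r * Real.log (p / q) + (1 - r) * Real.log ((1 - p) / (1 - q))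

/-- The moment generating function of the edge score when the edge is present with
probability `r`. -/
noncomputable def edgeMgf (p q r s : ℝ) : ℝ :=
  r * Real.exp (s * Real.log (p / q)) + (1 - r) * Real.exp (s * Real.log ((1 - p) / (1 - q)))

theorem exp_half_log_div {a b : ℝ} (ha : 0 < a) (hb : 0 < b) :
    b * Real.exp (1 / 2 * Real.log (a / b)) = √(a * b) := by
  rw [mul_comm (1 / 2 : ℝ), Real.exp_mul, Real.exp_log (div_pos ha hb), ← Real.sqrt_eq_rpow,
    Real.sqrt_div ha.le, Real.sqrt_mul ha.le]
  have h : √b ≠ 0 := (Real.sqrt_pos.mpr hb).ne'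
  field_simp
  rw [Real.sq_sqrt hb.le]

theorem exp_neg_half_log_div {a b : ℝ} (ha : 0 < a) (hb : 0 < b) :
    a * Real.exp (-(1 / 2) * Real.log (a / b)) = √(a * b) := by
  rw [mul_comm a b, ← exp_half_log_div hb ha]
  congr 2
  rw [← inv_div b a, Real.log_inv]
  ring

theorem exp_neg_renyiHalf (hq : 0 < q) (hqp : q < p) :
    Real.exp (-(renyiHalf p q / 2)) = √(p * q) + √((1 - p) * (1 - q)) := by
  have hpos : 0 < √(p * q) + √((1 - p) * (1 - q)) := by
    have : 0 < p * q := mul_pos (hq.trans hqp) hq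
    positivity
  rw [renyiHalf, show -(-2 * Real.log (√(p * q) + √((1 - p) * (1 - q))) / 2)
    = Real.log (√(p * q) + √((1 - p) * (1 - q))) by ring, Real.exp_log hpos]

theorem edgeMgf_zero (r : ℝ) : edgeMgf p q r 0 = 1 := by
  simp [edgeMgf]

theorem edgeMgf_half (hq : 0 < q) (hqp : q < p) (hp : p < 1) :
    edgeMgf p q q (1 / 2) = Real.exp (-(renyiHalf p q / 2)) := by
  rw [exp_neg_renyiHalf hq hqp, edgeMgf, exp_half_log_div (hq.trans hqp) hq,
    exp_half_log_div (by linarith) (by linarith)]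

theorem edgeMgf_neg_half (hq : 0 < q) (hqp : q < p) (hp : p < 1) :
    edgeMgf p q p (-(1 / 2)) = Real.exp (-(renyiHalf p q / 2)) := by
  rw [exp_neg_renyiHalf hq hqp, edgeMgf, exp_neg_half_log_div (hq.trans hqp) hq,
    exp_neg_half_log_div (by linarith) (by linarith)]

theorem exp_mul_edgeMean_le {r : ℝ} (hr0 : 0 ≤ r) (hr1 : r ≤ 1) (s : ℝ) :
    Real.exp (s * edgeMean p q r) ≤ edgeMgf p q r s := by
  have h := convexOn_exp.2 (Set.mem_univ (s * Real.log (p / q)))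
    (Set.mem_univ (s * Real.log ((1 - p) / (1 - q)))) hr0 (sub_nonneg.mpr hr1) (by ring)
  simp only [smul_eq_mul] at h
  unfold edgeMean edgeMgf
  refine le_trans (le_of_eq ?_) h
  congr 1
  ring

theorem renyiHalf_le_edgeMean (hq : 0 < q) (hqp : q < p) (hp : p < 1) :
    renyiHalf p q ≤ edgeMean p q p := by
  have h := exp_mul_edgeMean_le (p := p) (q := q) (r := p) (by linarith) hp.le (-(1 / 2))
  rw [edgeMgf_neg_half hq hqp hp, Real.exp_le_exp] at h
  linarith

theorem edgeMean_le_neg_renyiHalf (hq : 0 < q) (hqp : q < p) (hp : p < 1) :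
    edgeMean p q q ≤ -renyiHalf p q := by
  have h := exp_mul_edgeMean_le (p := p) (q := q) (r := q) hq.le (by linarith) (1 / 2)
  rw [edgeMgf_half hq hqp hp, Real.exp_le_exp] at h
  linarith

theorem sq_sqrt_sub_le_renyiHalf (hq : 0 < q) (hqp : q < p) (hp : p < 1) :
    (√p - √q) ^ 2 ≤ renyiHalf p q := by
  have h1 := Real.add_one_le_exp (-(renyiHalf p q / 2))
  rw [exp_neg_renyiHalf hq hqp, Real.sqrt_mul (by linarith), Real.sqrt_mul (by linarith)] at h1
  have h2 := Real.sq_sqrt (show 0 ≤ p by linarith)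
  have h3 := Real.sq_sqrt hq.le
  have h4 := Real.sq_sqrt (show 0 ≤ 1 - p by linarith)
  have h5 := Real.sq_sqrt (show 0 ≤ 1 - q by linarith)
  nlinarith [sq_nonneg (√(1 - p) - √(1 - q))]

theorem renyiHalf_pos (hq : 0 < q) (hqp : q < p) (hp : p < 1) : 0 < renyiHalf p q := by
  refine lt_of_lt_of_le ?_ (sq_sqrt_sub_le_renyiHalf hq hqp hp)
  have := Real.sqrt_lt_sqrt hq.le hqp
  have : 0 < √p - √q := by linarith
  positivity

theorem renyiHalf_le_two (hq : 0 < q) (hqp : q < p) (hp : p ≤ 1 / 2) : renyiHalf p q ≤ 2 := by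
  have h1 : (1 / 2 : ℝ) ≤ √(p * q) + √((1 - p) * (1 - q)) := by
    have h2 : (1 / 2 : ℝ) ≤ √((1 - p) * (1 - q)) := by
      apply Real.le_sqrt_of_sq_le
      nlinarith
    have := Real.sqrt_nonneg (p * q)
    linarith
  rw [← exp_neg_renyiHalf hq hqp] at h1
  by_contra h
  push Not at h
  have h3 : Real.exp (-(renyiHalf p q / 2)) ≤ Real.exp (-1) :=
    Real.exp_le_exp.mpr (by linarith)
  have h4 : Real.exp (-1) < 1 / 2 := by
    rw [Real.exp_neg, ← one_div]
    exact one_div_lt_one_div_of_lt (by norm_num) (by linarith [Real.exp_one_gt_d9])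
  linarith

theorem sq_sub_div_le_renyiHalf {c : ℝ} (hq : 0 < q) (hqp : q < p) (hp : p < 1)
    (hc : p ≤ c * q) : (p - q) ^ 2 / q ≤ 4 * c * renyiHalf p q := by
  have h0 := sq_sqrt_sub_le_renyiHalf hq hqp hp
  have hp0 : 0 < p := hq.trans hqp
  have h2 := Real.sq_sqrt hp0.le
  have h3 := Real.sq_sqrt hq.le
  have h4 := Real.sqrt_lt_sqrt hq.le hqp
  have h5 := Real.sqrt_pos.mpr hq
  have h6 : (p - q) ^ 2 = (√p - √q) ^ 2 * (√p + √q) ^ 2 := by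
    rw [← mul_pow]
    congr 1
    nlinarith
  have h7 : (√p + √q) ^ 2 ≤ 4 * p := by nlinarith
  have h8 : 0 ≤ (√p - √q) ^ 2 := sq_nonneg _
  rw [div_le_iff₀ hq, h6]
  have hI := (renyiHalf_pos hq hqp hp).le
  calc (√p - √q) ^ 2 * (√p + √q) ^ 2 ≤ renyiHalf p q * (4 * p) := by gcongr
    _ ≤ renyiHalf p q * (4 * (c * q)) := by gcongr
    _ = _ := by ring

theorem exp_le_one_add_add_sq_mul (x : ℝ) : Real.exp x ≤ 1 + x + x ^ 2 * Real.exp |x| := by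
  have hone : 1 ≤ Real.exp |x| := Real.one_le_exp (abs_nonneg x)
  by_cases h : |x| ≤ 1
  · have h1 := (abs_le.mp (Real.abs_exp_sub_one_sub_id_le h)).2
    nlinarith [sq_nonneg x]
  · push Not at h
    rcases le_total 0 x with hx | hx
    · rw [abs_of_nonneg hx] at h hone ⊢
      nlinarith [mul_le_mul h.le h.le zero_le_one (by linarith)]
    · rw [abs_of_nonpos hx] at h hone ⊢
      have : Real.exp x ≤ 1 := Real.exp_le_one_iff.mpr hx
      nlinarith

theorem exists_edgeMgf_le (c Θ : ℝ) (hΘ : 0 ≤ Θ) : ∃ C : ℝ, 1 ≤ C ∧ ∀ p q : ℝ, 0 < q → q < p →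
    p ≤ 1 / 2 → p ≤ c * q → ∀ r, (r = p ∨ r = q) → |edgeMean p q r| ≤ C * renyiHalf p q ∧
      ∀ s, |s| ≤ Θ →
        edgeMgf p q r s ≤ Real.exp (s * edgeMean p q r + C * s ^ 2 * renyiHalf p q) := by
  refine ⟨max 1 (max (12 * c) (Real.exp (Θ * (c + 1)) * ((c + 4) * (4 * c)))), le_max_left _ _, ?_⟩
  intro p q hq hqp hp hc r hr
  set C := max 1 (max (12 * c) (Real.exp (Θ * (c + 1)) * ((c + 4) * (4 * c))))
  have hC1 : 12 * c ≤ C := (le_max_left _ _).trans (le_max_right _ _)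
  have hC2 : Real.exp (Θ * (c + 1)) * ((c + 4) * (4 * c)) ≤ C :=
    (le_max_right _ _).trans (le_max_right _ _)
  have hp0 : 0 < p := hq.trans hqp
  have hp1 : p < 1 := by linarith
  have hc1 : 1 ≤ c := by
    by_contra h
    push Not at h
    nlinarith
  have hI := renyiHalf_pos hq hqp hp1
  have hsq := sq_sub_div_le_renyiHalf hq hqp hp1 hc
  have hr0 : 0 ≤ r ∧ r ≤ p := by rcases hr with rfl | rfl <;> constructor <;> linarith
  set I := renyiHalf p q
  set y := Real.log (p / q) with hy
  set z := Real.log ((1 - p) / (1 - q)) with hz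
  have hd0 : 0 < p - q := by linarith
  have hdq : (p - q) / q ≤ c := by rw [div_le_iff₀ hq]; linarith
  have hy0 : 0 ≤ y := Real.log_nonneg (by rw [le_div_iff₀ hq]; linarith)
  have hy1 : y ≤ (p - q) / q := by
    have := Real.log_le_sub_one_of_pos (div_pos hp0 hq)
    rw [sub_div, div_self hq.ne']
    exact this
  have hz0 : z ≤ 0 := Real.log_nonpos (div_nonneg (by linarith) (by linarith))
    (by rw [div_le_one (by linarith)]; linarith)
  have hz1 : -z ≤ 2 * (p - q) := by
    have h1 := Real.log_le_sub_one_of_pos (show 0 < (1 - q) / (1 - p) from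
      div_pos (by linarith) (by linarith))
    rw [show Real.log ((1 - q) / (1 - p)) = -z by rw [hz, ← Real.log_inv, inv_div]] at h1
    refine h1.trans ?_
    rw [sub_le_iff_le_add, div_le_iff₀ (by linarith)]
    nlinarith
  have hdsq : (p - q) ^ 2 ≤ (p - q) ^ 2 / q := by
    rw [le_div_iff₀ hq]
    nlinarith [sq_nonneg (p - q)]
  have hpy : (p - q) * y ≤ (p - q) ^ 2 / q := by
    calc (p - q) * y ≤ (p - q) * ((p - q) / q) := by gcongr
      _ = _ := by ring
  have hsecond : r * y ^ 2 + (1 - r) * z ^ 2 ≤ (c + 4) * (4 * c) * I := by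
    have h1 : y ^ 2 ≤ ((p - q) / q) ^ 2 := by gcongr
    have h2 : z ^ 2 ≤ (2 * (p - q)) ^ 2 := by
      rw [← neg_sq z]
      exact pow_le_pow_left₀ (by linarith) hz1 2
    have h3 : r * y ^ 2 ≤ c * ((p - q) ^ 2 / q) := by
      calc r * y ^ 2 ≤ (c * q) * ((p - q) / q) ^ 2 := by
            apply mul_le_mul (hr0.2.trans hc) h1 (sq_nonneg _) (by positivity)
        _ = c * ((p - q) ^ 2 / q) := by field_simp
    have h4 : (1 - r) * z ^ 2 ≤ 4 * ((p - q) ^ 2 / q) := by nlinarith [sq_nonneg z]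
    calc _ ≤ (c + 4) * ((p - q) ^ 2 / q) := by linarith
      _ ≤ (c + 4) * (4 * c * I) := by gcongr
      _ = _ := by ring
  refine ⟨?_, fun s hs => ?_⟩
  · have h1 := renyiHalf_le_edgeMean hq hqp hp1
    have h2 := edgeMean_le_neg_renyiHalf hq hqp hp1
    have h3 : edgeMean p q p - edgeMean p q q ≤ 12 * c * I := by
      have : edgeMean p q p - edgeMean p q q = (p - q) * y + (p - q) * (-z) := by
        unfold edgeMean; ring
      rw [this]
      nlinarith
    have h4 : 12 * c * I ≤ C * I := by gcongr
    rw [abs_le]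
    rcases hr with rfl | rfl <;> constructor <;> linarith
  · have hyb : |s * y| ≤ Θ * (c + 1) := by
      rw [abs_mul, abs_of_nonneg hy0]
      exact mul_le_mul hs (by linarith) hy0 hΘ
    have hzb : |s * z| ≤ Θ * (c + 1) := by
      rw [abs_mul, abs_of_nonpos hz0]
      exact mul_le_mul hs (by linarith) (by linarith) hΘ
    have hbd : ∀ x, |s * x| ≤ Θ * (c + 1) →
        Real.exp (s * x) ≤ 1 + s * x + s ^ 2 * Real.exp (Θ * (c + 1)) * x ^ 2 := by
      intro x hx
      have h1 := exp_le_one_add_add_sq_mul (s * x)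
      have h2 := Real.exp_le_exp.mpr hx
      nlinarith [sq_nonneg (s * x)]
    have h1 : edgeMgf p q r s ≤ 1 + (s * edgeMean p q r
        + s ^ 2 * Real.exp (Θ * (c + 1)) * (r * y ^ 2 + (1 - r) * z ^ 2)) := by
      have h2 := mul_le_mul_of_nonneg_left (hbd y hyb) hr0.1
      have h3 := mul_le_mul_of_nonneg_left (hbd z hzb) (show 0 ≤ 1 - r by linarith)
      unfold edgeMgf edgeMean
      rw [← hy, ← hz]
      nlinarith
    refine h1.trans (le_trans ?_ (Real.add_one_le_exp _))
    have h4 : s ^ 2 * Real.exp (Θ * (c + 1)) * (r * y ^ 2 + (1 - r) * z ^ 2) ≤ C * s ^ 2 * I := by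
      calc _ ≤ s ^ 2 * Real.exp (Θ * (c + 1)) * ((c + 4) * (4 * c) * I) := by gcongr
        _ = (Real.exp (Θ * (c + 1)) * ((c + 4) * (4 * c))) * (s ^ 2 * I) := by ring
        _ ≤ C * (s ^ 2 * I) := by gcongr
        _ = _ := by ring
    linarith

end Bernoulli

section Moments

variable {n K : ℕ} {p q : ℝ} {Ω : Type*} [MeasurableSpace Ω] {μ : Measure Ω}
  {A : Ω → SimpleGraph (Fin n)} {Zs : Labels n K}

theorem IsSBM.integrable_comp [IsFiniteMeasure μ] {B : Matrix (Fin K) (Fin K) ℝ}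
    (h : IsSBM μ A Zs B) (F : SimpleGraph (Fin n) → ℝ) : Integrable (fun ω => F (A ω)) μ := by
  classical
  let _ : MeasurableSpace (SimpleGraph (Fin n)) := ⊤
  have hA : Measurable A := by
    refine measurable_to_countable' fun G => ?_
    have : A ⁻¹' {G} = ⋂ i, ⋂ j, {ω | (A ω).Adj i j ↔ G.Adj i j} := by
      ext ω
      simp only [Set.mem_preimage, Set.mem_singleton_iff, Set.mem_iInter, Set.mem_ofPred_eq]
      constructor
      · rintro rfl i j; rfl
      · intro h; ext i j; exact h i j
    rw [this]
    refine MeasurableSet.iInter fun i => MeasurableSet.iInter fun j => ?_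
    by_cases hG : G.Adj i j
    · simpa [hG] using h.measurableSet_adj i j
    · simp only [hG, iff_false]
      exact (h.measurableSet_adj i j).compl
  refine Integrable.of_bound (C := ∑ G, |F G|)
    (measurable_from_top.comp hA).aestronglyMeasurable (ae_of_all _ fun ω => ?_)
  rw [Real.norm_eq_abs]
  exact Finset.single_le_sum (f := fun G => |F G|) (fun G _ => abs_nonneg _)
    (Finset.mem_univ (A ω))

theorem prod_prod_Ioi_eq_prod_subtype (g : Fin n → Fin n → ℝ) :
    ∏ i, ∏ j ∈ Finset.Ioi i, g i j = ∏ e : {e : Fin n × Fin n // e.1 < e.2}, g e.1.1 e.1.2 := by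
  rw [← Finset.prod_subtype (Finset.univ.filter fun e : Fin n × Fin n => e.1 < e.2)
    (fun e => by simp) (fun e => g e.1 e.2), Finset.prod_filter, Fintype.prod_prod_type]
  refine Finset.prod_congr rfl fun i _ => ?_
  rw [← Finset.prod_filter]
  exact Finset.prod_congr (by ext; simp) fun _ _ => rfl

open scoped Classical in
theorem IsSBM.integral_prod [IsProbabilityMeasure μ] {B : Matrix (Fin K) (Fin K) ℝ}
    (h : IsSBM μ A Zs B) (φ ψ : Fin n → Fin n → ℝ) :
    ∫ ω, ∏ i, ∏ j ∈ Finset.Ioi i, (if (A ω).Adj i j then φ i j else ψ i j) ∂μ =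
      ∏ i, ∏ j ∈ Finset.Ioi i, (B (Zs i) (Zs j) * φ i j + (1 - B (Zs i) (Zs j)) * ψ i j) := by
  simp_rw [prod_prod_Ioi_eq_prod_subtype]
  set s : {e : Fin n × Fin n // e.1 < e.2} → Set Ω := fun e => {ω | (A ω).Adj e.1.1 e.1.2} with hs
  have hind : iIndepFun (fun e => (s e).indicator fun _ => (1 : ℝ)) μ := h.indep.iIndepFun_indicator
  have hmeas : ∀ e, MeasurableSet (s e) := fun e => h.measurableSet_adj _ _
  have hrepr : ∀ ω (e : {e : Fin n × Fin n // e.1 < e.2}),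
      (if (A ω).Adj e.1.1 e.1.2 then φ e.1.1 e.1.2 else ψ e.1.1 e.1.2) =
      (fun x : ℝ => x * φ e.1.1 e.1.2 + (1 - x) * ψ e.1.1 e.1.2)
        ((s e).indicator (fun _ => (1 : ℝ)) ω) := by
    intro ω e
    by_cases hω : (A ω).Adj e.1.1 e.1.2
    · rw [if_pos hω, Set.indicator_of_mem (show ω ∈ s e from hω)]; simp
    · rw [if_neg hω, Set.indicator_of_notMem (show ω ∉ s e from hω)]; simp
  simp_rw [hrepr]
  rw [hind.integral_fun_prod_comp
    (f := fun (e : {e : Fin n × Fin n // e.1 < e.2}) (x : ℝ) =>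
      x * φ e.1.1 e.1.2 + (1 - x) * ψ e.1.1 e.1.2)
    (fun e => (measurable_const.indicator (hmeas e)).aemeasurable)
    (fun e => Continuous.aestronglyMeasurable (by fun_prop))]
  refine Finset.prod_congr rfl fun e _ => ?_
  have hintegral : Integrable ((s e).indicator fun _ => (1 : ℝ)) μ :=
    (integrable_const 1).indicator (hmeas e)
  have hval : ∫ ω, (s e).indicator (fun _ => (1 : ℝ)) ω ∂μ = B (Zs e.1.1) (Zs e.1.2) := by
    rw [integral_indicator (hmeas e)]
    simp only [integral_const, MeasurableSet.univ, measureReal_restrict_apply, Set.univ_inter,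
      smul_eq_mul, mul_one]
    exact h.prob_adj _ _ e.2
  have hlin : (fun ω => (s e).indicator (fun _ => (1 : ℝ)) ω * φ e.1.1 e.1.2
      + (1 - (s e).indicator (fun _ => (1 : ℝ)) ω) * ψ e.1.1 e.1.2) =
      fun ω => (s e).indicator (fun _ => (1 : ℝ)) ω * (φ e.1.1 e.1.2 - ψ e.1.1 e.1.2)
        + ψ e.1.1 e.1.2 := by
    ext ω; ring
  change ∫ ω, ((s e).indicator (fun _ => (1 : ℝ)) ω * φ e.1.1 e.1.2
      + (1 - (s e).indicator (fun _ => (1 : ℝ)) ω) * ψ e.1.1 e.1.2) ∂μ = _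
  rw [hlin, integral_add (hintegral.mul_const _) (integrable_const _), integral_mul_const, hval]
  simp only [integral_const, probReal_univ, smul_eq_mul, one_mul]
  ring

theorem IsSBM.integral_exp [IsProbabilityMeasure μ]
    (h : IsSBM μ A Zs (connMatrix K p q)) (c : Fin n → Fin n → ℝ) :
    ∫ ω, Real.exp (∑ i, ∑ j ∈ Finset.Ioi i, c i j * edgeScore p q (A ω) i j) ∂μ =
      ∏ i, ∏ j ∈ Finset.Ioi i, edgeMgf p q (connMatrix K p q (Zs i) (Zs j)) (c i j) := by
  classical
  have h1 := h.integral_prod (fun i j => Real.exp (c i j * Real.log (p / q)))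
    (fun i j => Real.exp (c i j * Real.log ((1 - p) / (1 - q))))
  unfold edgeMgf
  rw [← h1]
  congr 1
  ext ω
  simp_rw [Real.exp_sum]
  refine Finset.prod_congr rfl fun i _ => Finset.prod_congr rfl fun j _ => ?_
  unfold edgeScore
  split_ifs <;> rfl

end Moments

section MomentBounds

variable {n K : ℕ} {p q : ℝ} {Ω : Type*} [MeasurableSpace Ω] {μ : Measure Ω}
  {A : Ω → SimpleGraph (Fin n)} {Zs : Labels n K}

theorem sum_offdiag_eq_sum_Ioi (g : Fin n → Fin n → ℝ) :
    ∑ i, ∑ j ∈ ({i}ᶜ : Finset (Fin n)), g i j = ∑ i, ∑ j ∈ Finset.Ioi i, (g i j + g j i) :=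
  (Finset.sum_sum_Ioi_add_eq_sum_sum_off_diag fun i j => g j i).symm

theorem IsSBM.integral_exp_offdiag_le [IsProbabilityMeasure μ]
    (h : IsSBM μ A Zs (connMatrix K p q)) {C Θ : ℝ} (hC : 0 ≤ C) (hI : 0 ≤ renyiHalf p q)
    (hq : 0 ≤ q) (hqp : q ≤ p) (hp : p ≤ 1)
    (hmgf : ∀ r, (r = p ∨ r = q) → ∀ s, |s| ≤ Θ →
      edgeMgf p q r s ≤ Real.exp (s * edgeMean p q r + C * s ^ 2 * renyiHalf p q))
    (c : Fin n → Fin n → ℝ) (hc : ∀ i j, |c i j + c j i| ≤ Θ) :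
    ∫ ω, Real.exp (∑ i, ∑ j ∈ {i}ᶜ, c i j * edgeScore p q (A ω) i j) ∂μ ≤
      Real.exp (∑ i, ∑ j ∈ {i}ᶜ, (c i j * edgeMean p q (connMatrix K p q (Zs i) (Zs j))
        + 2 * C * c i j ^ 2 * renyiHalf p q)) := by
  have hcomm : ∀ i j, connMatrix K p q (Zs i) (Zs j) = connMatrix K p q (Zs j) (Zs i) :=
    fun i j => by simp [connMatrix, eq_comm]
  have h1 : ∀ ω, ∑ i, ∑ j ∈ {i}ᶜ, c i j * edgeScore p q (A ω) i j
      = ∑ i, ∑ j ∈ Finset.Ioi i, (c i j + c j i) * edgeScore p q (A ω) i j := fun ω => by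
    rw [sum_offdiag_eq_sum_Ioi]
    refine Finset.sum_congr rfl fun i _ => Finset.sum_congr rfl fun j _ => ?_
    rw [edgeScore_comm (A ω) j i]
    ring
  simp_rw [h1]
  rw [h.integral_exp fun i j => c i j + c j i, sum_offdiag_eq_sum_Ioi]
  simp_rw [Real.exp_sum]
  have hr : ∀ i j, connMatrix K p q (Zs i) (Zs j) = p ∨ connMatrix K p q (Zs i) (Zs j) = q :=
    fun i j => by
      unfold connMatrix
      split_ifs
      · exact Or.inl rfl
      · exact Or.inr rfl
  have hnn : ∀ i j s, 0 ≤ edgeMgf p q (connMatrix K p q (Zs i) (Zs j)) s := fun i j s => by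
    have h0 : 0 ≤ connMatrix K p q (Zs i) (Zs j) ∧ connMatrix K p q (Zs i) (Zs j) ≤ 1 := by
      rcases hr i j with h | h <;> rw [h] <;> constructor <;> linarith
    unfold edgeMgf
    have := h0.1
    have : 0 ≤ 1 - connMatrix K p q (Zs i) (Zs j) := by linarith [h0.2]
    positivity
  refine Finset.prod_le_prod (fun i _ => Finset.prod_nonneg fun j _ => hnn i j _) fun i _ =>
    Finset.prod_le_prod (fun j _ => hnn i j _) fun j _ => ?_
  refine (hmgf _ (hr i j) _ (hc i j)).trans (Real.exp_le_exp.mpr ?_)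
  rw [hcomm j i]
  have h2 : 0 ≤ C * renyiHalf p q := mul_nonneg hC hI
  nlinarith [mul_nonneg h2 (sq_nonneg (c i j - c j i))]

theorem IsSBM.measureReal_le_div [IsProbabilityMeasure μ] {B : Matrix (Fin K) (Fin K) ℝ}
    (h : IsSBM μ A Zs B) (F : SimpleGraph (Fin n) → ℝ) (hF : ∀ G, 0 ≤ F G) {a : ℝ} (ha : 0 < a) :
    μ.real {ω | a ≤ F (A ω)} ≤ (∫ ω, F (A ω) ∂μ) / a := by
  rw [le_div_iff₀ ha, mul_comm]
  exact mul_meas_ge_le_integral_of_nonneg (ae_of_all _ fun ω => hF (A ω)) (h.integrable_comp F) a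

theorem IsSBM.measureReal_le_exp [IsProbabilityMeasure μ] {B : Matrix (Fin K) (Fin K) ℝ}
    (h : IsSBM μ A Zs B) (F : SimpleGraph (Fin n) → ℝ) (a : ℝ) :
    μ.real {ω | a ≤ F (A ω)} ≤ Real.exp (-a) * ∫ ω, Real.exp (F (A ω)) ∂μ := by
  have h1 := h.measureReal_le_div (fun G => Real.exp (F G)) (fun G => (Real.exp_pos _).le)
    (Real.exp_pos a)
  simp only [Real.exp_le_exp] at h1
  rwa [Real.exp_neg, mul_comm, ← div_eq_mul_inv]

/-- The number of ordered pairs of nodes that are together in one of two labelings only. -/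
noncomputable def mismatch (Z W : Labels n K) : ℝ :=
  ∑ i, ∑ j, |sameLabel Z i j - sameLabel W i j|

theorem IsSBM.integral_sqrt_likelihood [IsProbabilityMeasure μ]
    (h : IsSBM μ A Zs (connMatrix K p q)) (hq : 0 < q) (hqp : q < p) (hp : p < 1)
    (W : Labels n K) :
    ∫ ω, √(likelihood (connMatrix K p q) (A ω) W / likelihood (connMatrix K p q) (A ω) Zs) ∂μ
      = Real.exp (-(renyiHalf p q / 4 * mismatch W Zs)) := by
  have h1 : ∀ ω, √(likelihood (connMatrix K p q) (A ω) W /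
      likelihood (connMatrix K p q) (A ω) Zs) = Real.exp (∑ i, ∑ j ∈ Finset.Ioi i,
        ((sameLabel W i j - sameLabel Zs i j) / 2) * edgeScore p q (A ω) i j) := by
    intro ω
    rw [likelihood_eq_mul_exp hq hqp hp (A ω) Zs W,
      mul_div_cancel_left₀ _ (likelihood_pos hq hqp hp (A ω) Zs).ne', Real.sqrt_eq_rpow,
      ← Real.exp_mul, Finset.sum_mul]
    simp_rw [Finset.sum_mul]
    congr 1
    exact Finset.sum_congr rfl fun i _ => Finset.sum_congr rfl fun j _ => by ring
  simp_rw [h1]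
  rw [h.integral_exp fun i j => (sameLabel W i j - sameLabel Zs i j) / 2]
  have h2 : ∀ i j, edgeMgf p q (connMatrix K p q (Zs i) (Zs j))
      ((sameLabel W i j - sameLabel Zs i j) / 2)
      = Real.exp (-(renyiHalf p q / 2) * |sameLabel W i j - sameLabel Zs i j|) := by
    intro i j
    by_cases hZ : Zs i = Zs j <;> by_cases hW : W i = W j
    · simp [sameLabel, hZ, hW, edgeMgf_zero]
    · have := edgeMgf_neg_half hq hqp hp
      simp [sameLabel, hZ, hW, connMatrix] at this ⊢
      rw [← this]; congr 1; norm_num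
    · have := edgeMgf_half hq hqp hp
      simp [sameLabel, hZ, hW, connMatrix] at this ⊢
      exact this
    · simp [sameLabel, hZ, hW, edgeMgf_zero]
  simp_rw [h2, ← Real.exp_sum]
  congr 1
  have h3 : mismatch W Zs = ∑ i, ∑ j ∈ ({i}ᶜ : Finset (Fin n)),
      |sameLabel W i j - sameLabel Zs i j| := by
    unfold mismatch
    refine Finset.sum_congr rfl fun i _ => ?_
    rw [← Finset.sum_add_sum_compl {i}, Finset.sum_singleton]
    simp [sameLabel]
  rw [h3, sum_offdiag_eq_sum_Ioi, ← neg_mul, Finset.mul_sum]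
  refine Finset.sum_congr rfl fun i _ => ?_
  rw [Finset.mul_sum]
  refine Finset.sum_congr rfl fun j _ => ?_
  rw [sameLabel_comm W j, sameLabel_comm Zs j]
  ring

end MomentBounds

section Counting

variable {n K : ℕ} {α β : ℝ}

theorem sum_pow_hammingDist (Zs : Labels n K) (x : ℝ) :
    ∑ Z : Labels n K, x ^ hammingDist Z Zs = (1 + (K - 1) * x) ^ n := by
  have h1 : ∀ Z : Labels n K, x ^ hammingDist Z Zs = ∏ i, if Z i = Zs i then 1 else x := by
    intro Z
    rw [Finset.prod_ite, Finset.prod_const_one, one_mul, Finset.prod_const]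
    rfl
  simp_rw [h1]
  have h2 := Finset.prod_univ_sum (fun _ : Fin n => (Finset.univ : Finset (Fin K)))
    (fun i k => if k = Zs i then (1 : ℝ) else x)
  rw [Fintype.piFinset_univ] at h2
  rw [← h2]
  have h3 : ∀ i : Fin n, ∑ k, (if k = Zs i then (1 : ℝ) else x) = 1 + (K - 1) * x := by
    intro i
    have h : ∀ k, (if k = Zs i then (1 : ℝ) else x) = x + if k = Zs i then 1 - x else 0 :=
      fun k => by split_ifs <;> ring
    simp_rw [h, Finset.sum_add_distrib]
    simp
    ring
  rw [Finset.prod_congr rfl fun i _ => h3 i]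
  simp

theorem sum_pow_hammingDist_le (Zs : Labels n K) {x : ℝ} (hx : 0 ≤ x) (hK : 1 ≤ K)
    (h : n * K * x ≤ 1) :
    ∑ Z : Labels n K, x ^ hammingDist Z Zs ≤ 1 + 2 * (n * K * x) := by
  have hK' : (1 : ℝ) ≤ K := by exact_mod_cast hK
  have h0 : 0 ≤ n * K * x := by positivity
  rw [sum_pow_hammingDist]
  calc (1 + (K - 1) * x) ^ n ≤ (Real.exp (K * x)) ^ n := by
        apply pow_le_pow_left₀
        · nlinarith
        · have := Real.add_one_le_exp (K * x)
          linarith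
    _ = Real.exp (n * K * x) := by rw [← Real.exp_nat_mul]; congr 1; ring
    _ ≤ _ := by
        have h1 := (abs_le.mp (Real.abs_exp_sub_one_sub_id_le
          (x := n * K * x) (by rw [abs_of_nonneg h0]; exact h))).2
        nlinarith

theorem sum_pow_hammingDist_ne_le (Zs : Labels n K) {x : ℝ} (hx : 0 ≤ x) (hK : 1 ≤ K)
    (h : n * K * x ≤ 1) :
    ∑ Z : Labels n K with Z ≠ Zs, x ^ hammingDist Z Zs ≤ 2 * (n * K * x) := by
  have h1 := sum_pow_hammingDist_le Zs hx hK h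
  rw [← Finset.sum_filter_add_sum_filter_not _ (fun Z => Z ≠ Zs)] at h1
  have h2 : ∑ Z : Labels n K with ¬Z ≠ Zs, x ^ hammingDist Z Zs = 1 := by
    rw [Finset.sum_eq_single_of_mem Zs (by simp)]
    · simp
    · intro Z hZ hne
      simp [hne] at hZ
  linarith

theorem mismatch_comp (σ : Equiv.Perm (Fin K)) (Z W : Labels n K) :
    mismatch (σ ∘ Z) W = mismatch Z W := by
  simp [mismatch, sameLabel]

theorem communitySize_eq_sum (Z : Labels n K) (k : Fin K) :
    (communitySize Z k : ℝ) = ∑ i, if Z i = k then 1 else 0 := by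
  simp [communitySize]

theorem hammingDist_eq_sum (Z W : Labels n K) :
    (hammingDist Z W : ℝ) = ∑ i, if Z i ≠ W i then 1 else 0 := by
  rw [Finset.sum_boole]
  rfl

theorem two_mul_effSize_le {Zs : Labels n K} (hZs : Zs ∈ feasible n K β) {a b : Fin K}
    (hab : a ≠ b) : 2 * effSize K β n ≤ communitySize Zs a + communitySize Zs b := by
  unfold effSize
  split_ifs with h
  · subst h
    have huniv : (Finset.univ : Finset (Fin 2)) = {a, b} := by
      revert a b; decide
    have h1 := card_filter_mem_eq_sum Zs Finset.univ
    rw [huniv, Finset.sum_pair hab, ← huniv] at h1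
    simp only [Finset.mem_univ, Finset.filter_true, Finset.card_univ, Fintype.card_fin] at h1
    have h2 : (n : ℝ) = communitySize Zs a + communitySize Zs b := by exact_mod_cast h1
    linarith
  · have h1 := (mem_feasible.mp hZs a).1
    have h2 := (mem_feasible.mp hZs b).1
    rw [mul_comm β] at h1 h2
    linarith

theorem le_mismatch_of_hammingDist {Zs : Labels n K} (hZs : Zs ∈ feasible n K β)
    (Z : Labels n K) :
    2 * hammingDist Z Zs * (2 * effSize K β n - hammingDist Z Zs) ≤ mismatch Z Zs := by
  set d : Fin n → Fin n → ℝ := fun i j => |sameLabel Z i j - sameLabel Zs i j| with hd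
  have hd0 : ∀ i j, 0 ≤ d i j := fun i j => abs_nonneg _
  have hsymm : ∀ i j, d i j = d j i := fun i j => by
    simp only [hd]; rw [sameLabel_comm Z, sameLabel_comm Zs]
  set g : Fin n → Fin n → ℝ := fun i j => if Z i ≠ Zs i ∧ Z j = Zs j then d i j else 0 with hg
  have h1 : 2 * ∑ i, ∑ j, g i j ≤ mismatch Z Zs := by
    have h2 : ∑ i, ∑ j, g i j = ∑ i, ∑ j, g j i := Finset.sum_comm
    have h3 : 2 * ∑ i, ∑ j, g i j = ∑ i, ∑ j, (g i j + g j i) := by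
      simp_rw [Finset.sum_add_distrib]
      linarith
    rw [h3]
    refine Finset.sum_le_sum fun i _ => Finset.sum_le_sum fun j _ => ?_
    simp only [hg]
    rw [hsymm j i]
    change _ ≤ d i j
    have := hd0 i j
    by_cases hi : Z i = Zs i <;> by_cases hj : Z j = Zs j <;> simp [hi, hj, this]
  have h4 : ∀ i, (if Z i ≠ Zs i then 1 else 0) * (2 * effSize K β n - hammingDist Z Zs)
      ≤ ∑ j, g i j := by
    intro i
    by_cases hi : Z i = Zs i
    · simp [hi, hg]
    · have hi' : ¬Zs i = Z i := fun h => hi h.symm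
      have h5 := two_mul_effSize_le hZs hi
      rw [communitySize_eq_sum, communitySize_eq_sum] at h5
      rw [if_pos hi, one_mul, hammingDist_eq_sum]
      refine (sub_le_sub_right h5 _).trans ?_
      rw [← Finset.sum_add_distrib, ← Finset.sum_sub_distrib]
      refine Finset.sum_le_sum fun j _ => ?_
      simp only [hg, hd, sameLabel]
      by_cases hj : Z j = Zs j
      · rw [hj]
        by_cases h6 : Zs j = Z i
        · simp [h6, hi, hi']
        · by_cases h7 : Zs j = Zs i
          · simp [h7, hi, hi']
          · simp [h6, h7]
            split_ifs <;> simp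
      · have h0 : ¬(Z i ≠ Zs i ∧ Z j = Zs j) := fun h => hj h.2
        rw [if_neg h0, if_pos hj]
        by_cases h6 : Zs j = Z i
        · simp [h6, hi]
        · by_cases h7 : Zs j = Zs i <;> simp [h6, h7, hi']
  have h8 := Finset.sum_le_sum fun i (_ : i ∈ Finset.univ) => h4 i
  rw [← Finset.sum_mul, ← hammingDist_eq_sum] at h8
  linarith

theorem card_mul_card_le_mismatch {Z W : Labels n K} (S T : Finset (Fin n))
    (h : ∀ i ∈ S, ∀ j ∈ T, |sameLabel Z i j - sameLabel W i j| = 1) :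
    (S.card : ℝ) * T.card ≤ mismatch Z W := by
  calc (S.card : ℝ) * T.card = ∑ i ∈ S, ∑ j ∈ T, |sameLabel Z i j - sameLabel W i j| := by
        rw [Finset.sum_congr rfl fun i hi => Finset.sum_congr rfl fun j hj => h i hi j hj]
        simp
    _ ≤ ∑ i ∈ S, ∑ j, |sameLabel Z i j - sameLabel W i j| :=
        Finset.sum_le_sum fun i _ => Finset.sum_le_univ_sum_of_nonneg fun j => abs_nonneg _
    _ ≤ _ := Finset.sum_le_univ_sum_of_nonneg fun i => Finset.sum_nonneg fun j _ => abs_nonneg _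

/-- Labelings with few mismatched pairs agree, up to a relabeling, on most nodes. -/
theorem exists_perm_of_mismatch_le (hα : 0 < α) (hK : 1 ≤ K) (hn : 1 ≤ n) {κ c : ℝ}
    (hc1 : 2 * c ≤ (1 / (α * K ^ 2)) ^ 2) (hc2 : K * c ≤ κ * (1 / (α * K ^ 2)))
    {Z Zs : Labels n K} (hZ : Z ∈ feasible n K α) (h : mismatch Z Zs ≤ c * n ^ 2) :
    ∃ σ : Equiv.Perm (Fin K), (hammingDist (σ ∘ Z) Zs : ℝ) ≤ κ * n := by
  have hK' : (1 : ℝ) ≤ K := by exact_mod_cast hK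
  have hn' : (1 : ℝ) ≤ n := by exact_mod_cast hn
  set w := 1 / (α * (K : ℝ) ^ 2) with hw
  have hw0 : 0 < w := by positivity
  let S : Fin K → Fin K → Finset (Fin n) := fun a b =>
    Finset.univ.filter fun i => Z i = a ∧ Zs i = b
  have hex : ∀ a, ∃ b, w * n ≤ (S a b).card := by
    intro a
    by_contra! hlt
    have h1 : (communitySize Z a : ℝ) = ∑ b, ((S a b).card : ℝ) := by
      have := Finset.card_eq_sum_card_fiberwise (s := Finset.univ.filter fun i => Z i = a)
        (f := Zs) (t := Finset.univ) (fun i _ => by simp)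
      unfold communitySize
      rw [this, Nat.cast_sum]
      simp [S, Finset.filter_filter]
    have h2 := (mem_feasible.mp hZ a).1
    have h3 : ∑ b, ((S a b).card : ℝ) < ∑ _b : Fin K, w * n :=
      Finset.sum_lt_sum_of_nonempty ⟨a, Finset.mem_univ a⟩ fun b _ => hlt b
    rw [Finset.sum_const, Finset.card_univ, Fintype.card_fin, nsmul_eq_mul, ← h1] at h3
    have h4 : (K : ℝ) * (w * n) = n / (α * K) := by rw [hw]; field_simp
    linarith
  choose f hf using hex
  have hsmall : ∀ a (T : Finset (Fin n)), (∀ i ∈ S a (f a), ∀ j ∈ T,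
      |sameLabel Z i j - sameLabel Zs i j| = 1) → w * T.card ≤ c * n := by
    intro a T hT
    have h1 := (card_mul_card_le_mismatch _ _ hT).trans h
    have h2 : w * n * T.card ≤ c * n ^ 2 :=
      (mul_le_mul_of_nonneg_right (hf a) (by positivity)).trans h1
    have : n * (w * T.card) ≤ n * (c * n) := by nlinarith
    exact le_of_mul_le_mul_left this (by linarith)
  have hinj : Function.Injective f := by
    intro a a' haa
    by_contra hne
    have h1 := hsmall a (S a' (f a')) (by
      intro i hi j hj
      simp only [S, Finset.mem_filter, Finset.mem_univ, true_and] at hi hj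
      simp [sameLabel, hi.1, hi.2, hj.1, hj.2, hne, haa])
    have h2 := hf a'
    nlinarith
  let σ : Equiv.Perm (Fin K) := Equiv.ofBijective f (Finite.injective_iff_bijective.mp hinj)
  refine ⟨σ, ?_⟩
  have h1 : (hammingDist (σ ∘ Z) Zs : ℝ)
      = ∑ a, ((Finset.univ.filter fun i => Z i = a ∧ f a ≠ Zs i).card : ℝ) := by
    have := Finset.card_eq_sum_card_fiberwise (s := Finset.univ.filter fun i => (σ ∘ Z) i ≠ Zs i)
      (f := Z) (t := Finset.univ) (fun i _ => by simp)
    unfold hammingDist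
    rw [this, Nat.cast_sum]
    refine Finset.sum_congr rfl fun a _ => ?_
    congr 2
    ext i
    simp only [Finset.mem_filter, Finset.mem_univ, true_and, Function.comp]
    constructor
    · rintro ⟨h1, rfl⟩; exact ⟨rfl, h1⟩
    · rintro ⟨rfl, h1⟩; exact ⟨h1, rfl⟩
  have h2 : ∀ a, w * ((Finset.univ.filter fun i => Z i = a ∧ f a ≠ Zs i).card : ℝ) ≤ c * n := by
    intro a
    refine hsmall a _ ?_
    intro i hi j hj
    simp only [S, Finset.mem_filter, Finset.mem_univ, true_and] at hi hj
    simp [sameLabel, hi.1, hi.2, hj.1, hj.2]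
  have h3 := Finset.sum_le_sum fun a (_ : a ∈ Finset.univ) => h2 a
  rw [← Finset.mul_sum, ← h1, Finset.sum_const, Finset.card_univ, Fintype.card_fin,
    nsmul_eq_mul] at h3
  have h4 : w * (hammingDist (σ ∘ Z) Zs : ℝ) ≤ w * (κ * n) := by nlinarith
  exact le_of_mul_le_mul_left h4 hw0

end Counting

section GoodGraphs

variable {n K : ℕ} {α β p q : ℝ}

/-- The standing assumptions on the edge probabilities at a fixed number `n` of nodes. -/
structure StrongSignal (K : ℕ) (β c ε₁ : ℝ) (n : ℕ) (p q : ℝ) : Prop where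
  q_pos : 0 < q
  q_lt_p : q < p
  p_le : p ≤ 1 / 2
  p_le_mul : p ≤ c * q
  log_le : (1 + ε₁) * Real.log n ≤ effSize K β n * renyiHalf p q

theorem StrongSignal.p_lt_one {c ε₁ : ℝ} (h : StrongSignal K β c ε₁ n p q) : p < 1 := by
  linarith [h.p_le]

theorem StrongSignal.renyiHalf_pos {c ε₁ : ℝ} (h : StrongSignal K β c ε₁ n p q) :
    0 < renyiHalf p q := SBM.renyiHalf_pos h.q_pos h.q_lt_p h.p_lt_one

theorem effSize_le (hK : 2 ≤ K) (hβ : 1 ≤ β) : effSize K β n ≤ n := by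
  have hK' : (2 : ℝ) ≤ K := by exact_mod_cast hK
  have hn : (0 : ℝ) ≤ n := by positivity
  unfold effSize
  split_ifs
  · linarith
  · exact div_le_self hn (by nlinarith)

theorem le_effSize (hK : 2 ≤ K) (hβ : 1 ≤ β) : (n : ℝ) / (K * β) ≤ effSize K β n := by
  have hn : (0 : ℝ) ≤ n := by positivity
  unfold effSize
  split_ifs with h
  · subst h
    push_cast
    gcongr
    linarith
  · exact le_rfl

theorem StrongSignal.log_le_mul {c ε₁ : ℝ} (h : StrongSignal K β c ε₁ n p q) (hK : 2 ≤ K)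
    (hβ : 1 ≤ β) (hε : 0 ≤ ε₁) (hn : 1 ≤ n) : Real.log n ≤ n * renyiHalf p q := by
  have h1 : 0 ≤ Real.log n := Real.log_nonneg (by exact_mod_cast hn)
  have h2 := h.log_le
  have h3 := mul_le_mul_of_nonneg_right (effSize_le (n := n) hK hβ) h.renyiHalf_pos.le
  nlinarith

theorem StrongSignal.exp_le_rpow {c ε₁ : ℝ} (h : StrongSignal K β c ε₁ n p q) (hε : 0 < ε₁)
    (hε1 : ε₁ ≤ 1) (hn : 1 ≤ n) {x : ℝ} (hx : x ≤ ε₁ / 4 * effSize K β n) :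
    n * Real.exp (-(renyiHalf p q * (effSize K β n - x))) ≤ (n : ℝ) ^ (-(ε₁ / 2)) := by
  have hn' : (1 : ℝ) ≤ n := by exact_mod_cast hn
  have hn0 : (0 : ℝ) < n := by linarith
  have hlog : 0 ≤ Real.log n := Real.log_nonneg hn'
  have hI := h.renyiHalf_pos
  have h1 := h.log_le
  have h2 : (1 + ε₁ / 2) * Real.log n ≤ renyiHalf p q * (effSize K β n - x) := by
    have h3 : renyiHalf p q * (effSize K β n - x) ≥
        (1 - ε₁ / 4) * (effSize K β n * renyiHalf p q) := by nlinarith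
    have h4 : (1 - ε₁ / 4) * ((1 + ε₁) * Real.log n) ≤
        (1 - ε₁ / 4) * (effSize K β n * renyiHalf p q) :=
      mul_le_mul_of_nonneg_left h1 (by linarith)
    nlinarith [mul_nonneg hlog (mul_nonneg hε.le (sub_nonneg.mpr hε1))]
  calc (n : ℝ) * Real.exp (-(renyiHalf p q * (effSize K β n - x)))
      ≤ n * Real.exp (-((1 + ε₁ / 2) * Real.log n)) := by gcongr
    _ = (n : ℝ) ^ (-(ε₁ / 2)) := by
        rw [Real.rpow_def_of_pos hn0]
        nth_rewrite 1 [← Real.exp_log hn0]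
        rw [← Real.exp_add]
        congr 1
        ring

theorem exp_neg_le_rpow {ε₁ : ℝ} (hε1 : ε₁ ≤ 1) (hn : 1 ≤ n) :
    1 / (n : ℝ) ≤ (n : ℝ) ^ (-(ε₁ / 2)) ∧ Real.exp (-n) ≤ (n : ℝ) ^ (-(ε₁ / 2)) := by
  have hn' : (1 : ℝ) ≤ n := by exact_mod_cast hn
  have h1 : 1 / (n : ℝ) ≤ (n : ℝ) ^ (-(ε₁ / 2)) := by
    rw [one_div, ← Real.rpow_neg_one]
    exact Real.rpow_le_rpow_of_exponent_le hn' (by linarith)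
  refine ⟨h1, le_trans ?_ h1⟩
  rw [Real.exp_neg, ← one_div]
  exact one_div_le_one_div_of_le (by linarith) (by linarith [Real.add_one_le_exp (n : ℝ)])

theorem exists_large (R : ℝ) {e : ℝ} (he : 0 < e) (B : ℝ) : ∃ N : ℕ, ∀ n : ℕ, N ≤ n →
    1 ≤ n ∧ R ≤ n ∧ R ≤ Real.log n ∧ B * (n : ℝ) ^ (-e) ≤ 1 := by
  have h1 : ∀ᶠ n : ℕ in atTop, 1 ≤ n := eventually_ge_atTop 1
  have h2 : ∀ᶠ n : ℕ in atTop, R ≤ (n : ℝ) := tendsto_natCast_atTop_atTop.eventually_ge_atTop R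
  have h3 : ∀ᶠ n : ℕ in atTop, R ≤ Real.log n :=
    (Real.tendsto_log_atTop.comp tendsto_natCast_atTop_atTop).eventually_ge_atTop R
  have h4 : ∀ᶠ n : ℕ in atTop, B * (n : ℝ) ^ (-e) ≤ 1 := by
    have : Tendsto (fun n : ℕ => B * (n : ℝ) ^ (-e)) atTop (𝓝 (B * 0)) :=
      ((tendsto_rpow_neg_atTop he).comp tendsto_natCast_atTop_atTop).const_mul B
    rw [mul_zero] at this
    exact this.eventually_le_const zero_lt_one
  obtain ⟨N, hN⟩ := eventually_atTop.mp (h1.and (h2.and (h3.and h4)))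
  exact ⟨N, hN⟩

theorem sum_exp_mismatch_le (hK : 2 ≤ K) (hα : 0 < α) (hn : 1 ≤ n) {κ c' : ℝ}
    (hc1 : 2 * c' ≤ (1 / (α * K ^ 2)) ^ 2) (hc2 : K * c' ≤ κ * (1 / (α * K ^ 2)))
    {Zs : Labels n K} (hZs : Zs ∈ feasible n K β) {I : ℝ} (hI : 0 ≤ I)
    (hsmall : n * K * Real.exp (-(I * (effSize K β n - κ * n / 2))) ≤ 1) :
    ∑ W ∈ feasible n K α with W ∉ cluster Zs, Real.exp (-(I / 4 * mismatch W Zs)) ≤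
      K.factorial * (2 * (n * K * Real.exp (-(I * (effSize K β n - κ * n / 2)))))
        + (K : ℝ) ^ n * Real.exp (-(I / 4 * (c' * n ^ 2))) := by
  set x := Real.exp (-(I * (effSize K β n - κ * n / 2))) with hx
  have hx0 : 0 ≤ x := (Real.exp_pos _).le
  set g : Labels n K → ℝ := fun Z => if Z ≠ Zs then x ^ hammingDist Z Zs else 0 with hg
  have hg0 : ∀ Z, 0 ≤ g Z := fun Z => by
    simp only [hg]; split_ifs <;> positivity
  have hterm : ∀ W ∈ (feasible n K α).filter (fun W => W ∉ cluster Zs),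
      Real.exp (-(I / 4 * mismatch W Zs)) ≤
        ∑ σ : Equiv.Perm (Fin K), g (σ ∘ W) + Real.exp (-(I / 4 * (c' * n ^ 2))) := by
    intro W hW
    obtain ⟨hWf, hWc⟩ := Finset.mem_filter.mp hW
    have hsum0 : 0 ≤ ∑ σ : Equiv.Perm (Fin K), g (σ ∘ W) := Finset.sum_nonneg fun σ _ => hg0 _
    by_cases hm : mismatch W Zs ≤ c' * n ^ 2
    · obtain ⟨σ, hσ⟩ := exists_perm_of_mismatch_le hα (by omega) hn hc1 hc2 hWf hm
      have hne : σ ∘ W ≠ Zs := fun h => hWc (by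
        have : Zs ∈ cluster W := mem_cluster.mpr ⟨σ, h⟩
        rw [cluster_eq_of_mem this]
        exact self_mem_cluster W)
      have h1 : Real.exp (-(I / 4 * mismatch W Zs)) ≤ g (σ ∘ W) := by
        simp only [hg]
        rw [if_pos hne, hx, ← Real.exp_nat_mul, Real.exp_le_exp, ← mismatch_comp σ]
        have h2 := le_mismatch_of_hammingDist hZs (σ ∘ W)
        set m : ℝ := (hammingDist (σ ∘ W) Zs : ℝ)
        have hm0 : 0 ≤ m := by positivity
        have h3 : I * (2 * m * (2 * effSize K β n - m)) ≤ I * mismatch (σ ∘ W) Zs :=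
          mul_le_mul_of_nonneg_left h2 hI
        nlinarith [mul_nonneg (mul_nonneg hI hm0) (sub_nonneg.mpr hσ)]
      refine h1.trans ((Finset.single_le_sum (f := fun σ : Equiv.Perm (Fin K) => g (σ ∘ W))
        (fun σ _ => hg0 _) (Finset.mem_univ σ)).trans ?_)
      linarith [Real.exp_pos (-(I / 4 * (c' * n ^ 2)))]
    · push Not at hm
      have : Real.exp (-(I / 4 * mismatch W Zs)) ≤ Real.exp (-(I / 4 * (c' * n ^ 2))) := by
        rw [Real.exp_le_exp, neg_le_neg_iff]
        exact mul_le_mul_of_nonneg_left hm.le (by linarith)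
      linarith
  refine (Finset.sum_le_sum hterm).trans ?_
  refine (Finset.sum_le_univ_sum_of_nonneg fun W => add_nonneg
    (Finset.sum_nonneg fun σ _ => hg0 _) (Real.exp_pos _).le).trans ?_
  rw [Finset.sum_add_distrib, Finset.sum_comm]
  have h1 : ∀ σ : Equiv.Perm (Fin K), ∑ W : Labels n K, g (σ ∘ W) ≤ 2 * (n * K * x) := by
    intro σ
    have h2 : ∑ W : Labels n K, g (σ ∘ W) = ∑ Z, g Z :=
      Equiv.sum_comp (Equiv.arrowCongr (Equiv.refl (Fin n)) σ) g
    rw [h2, hg, ← Finset.sum_filter]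
    exact sum_pow_hammingDist_ne_le Zs hx0 (by omega) hsmall
  have h3 := Finset.sum_le_sum fun σ (_ : σ ∈ (Finset.univ : Finset (Equiv.Perm (Fin K)))) => h1 σ
  rw [Finset.sum_const, Finset.card_univ, Fintype.card_perm, Fintype.card_fin, nsmul_eq_mul] at h3
  refine add_le_add h3 (le_of_eq ?_)
  simp

/-- The posterior concentrates on the true clustering. -/
theorem exists_contraction_bound (hK : 2 ≤ K) (hβ : 1 ≤ β) (hαβ : β < α) (c : ℝ) {ε₁ a : ℝ}
    (hε : 0 < ε₁) (hε1 : ε₁ ≤ 1) (ha : 0 < a) :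
    ∃ (C : ℝ) (N : ℕ), ∀ n : ℕ, N ≤ n → ∀ p q : ℝ, StrongSignal K β c ε₁ n p q →
      ∀ Zs ∈ feasible n K β, ∀ (Ω : Type*) [MeasurableSpace Ω] (μ : Measure Ω)
        [IsProbabilityMeasure μ] (A : Ω → SimpleGraph (Fin n)),
        IsSBM μ A Zs (connMatrix K p q) →
        μ.real {ω | a ≤ ∑ W ∈ feasible n K α with W ∉ cluster Zs,
          √(likelihood (connMatrix K p q) (A ω) W / likelihood (connMatrix K p q) (A ω) Zs)} ≤
        C * (n : ℝ) ^ (-(ε₁ / 2)) := by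
  have hα : 0 < α := by linarith
  have hK' : (2 : ℝ) ≤ K := by exact_mod_cast hK
  set κ := ε₁ / (2 * (K * β)) with hκ
  have hκ0 : 0 < κ := by positivity
  set w := 1 / (α * (K : ℝ) ^ 2) with hw
  have hw0 : 0 < w := by positivity
  set c' := min (w ^ 2 / 2) (κ * w / K) with hc'
  have hc0 : 0 < c' := by positivity
  have hc1 : 2 * c' ≤ w ^ 2 := by
    have : c' ≤ w ^ 2 / 2 := min_le_left _ _
    linarith
  have hc2 : K * c' ≤ κ * w := by
    have : c' ≤ κ * w / K := min_le_right _ _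
    rwa [le_div_iff₀ (by linarith), mul_comm] at this
  obtain ⟨N, hN⟩ := exists_large ((Real.log K + 1) * (4 / c')) (half_pos hε) K
  refine ⟨(K.factorial * (2 * K) + 1) / a, N, ?_⟩
  intro n hn p q hs Zs hZs Ω _ μ _ A hA
  obtain ⟨hn1, -, hlog, hsm⟩ := hN n hn
  have hI := hs.renyiHalf_pos
  set I := renyiHalf p q with hIdef
  have hn' : (1 : ℝ) ≤ n := by exact_mod_cast hn1
  have hbd := (hA.measureReal_le_div (fun G => ∑ W ∈ feasible n K α with W ∉ cluster Zs,
    √(likelihood (connMatrix K p q) G W / likelihood (connMatrix K p q) G Zs))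
    (fun G => Finset.sum_nonneg fun _ _ => Real.sqrt_nonneg _) ha)
  refine hbd.trans ?_
  rw [integral_finsetSum _ fun W _ => hA.integrable_comp fun G =>
    √(likelihood (connMatrix K p q) G W / likelihood (connMatrix K p q) G Zs)]
  simp_rw [hA.integral_sqrt_likelihood hs.q_pos hs.q_lt_p hs.p_lt_one]
  rw [div_mul_eq_mul_div]
  refine div_le_div_of_nonneg_right ?_ ha.le
  have hx := hs.exp_le_rpow hε hε1 hn1 (x := κ * n / 2) (by
    have := le_effSize (n := n) hK hβ
    calc κ * n / 2 = ε₁ / 4 * (n / (K * β)) := by rw [hκ]; field_simp; ring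
      _ ≤ _ := by gcongr)
  rw [← hIdef] at hx
  have hx2 : n * K * Real.exp (-(I * (effSize K β n - κ * n / 2))) ≤
      K * (n : ℝ) ^ (-(ε₁ / 2)) := by
    calc _ = K * (n * Real.exp (-(I * (effSize K β n - κ * n / 2)))) := by ring
      _ ≤ _ := by gcongr
  refine (sum_exp_mismatch_le hK hα hn1 hc1 hc2 hZs hI.le (hx2.trans hsm)).trans ?_
  have h1 : (K : ℝ) ^ n * Real.exp (-(I / 4 * (c' * n ^ 2))) ≤ (n : ℝ) ^ (-(ε₁ / 2)) := by
    refine le_trans ?_ (exp_neg_le_rpow hε1 hn1).2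
    have hK0 : (0 : ℝ) < K := by linarith
    nth_rewrite 1 [← Real.exp_log hK0]
    rw [← Real.exp_nat_mul, ← Real.exp_add, Real.exp_le_exp]
    have h2 := hs.log_le_mul hK hβ hε.le hn1
    have h3 : Real.log K + 1 ≤ c' / 4 * Real.log n := by
      have h4 := mul_le_mul_of_nonneg_left hlog (show 0 ≤ c' / 4 by positivity)
      have h5 : c' / 4 * ((Real.log K + 1) * (4 / c')) = Real.log K + 1 := by field_simp
      linarith
    have h6 : Real.log K + 1 ≤ c' / 4 * (n * I) :=
      h3.trans (mul_le_mul_of_nonneg_left h2 (by positivity))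
    nlinarith
  have h7 : (K.factorial : ℝ) * (2 * (n * K * Real.exp (-(I * (effSize K β n - κ * n / 2))))) ≤
      K.factorial * (2 * (K * (n : ℝ) ^ (-(ε₁ / 2)))) := by gcongr
  linarith

/-- If no labeling of at least `r` nodes has a large total advantage, few flips are accepted. -/
theorem flipMass_le (A : SimpleGraph (Fin n)) (Zs Z : Labels n K) (R : Fin n → Fin K → ℝ)
    (hR : ∀ i, R i (Zs i) = 0) {h r : ℝ}
    (hW : ∀ W : Labels n K, r ≤ hammingDist W Zs →
      ∑ i, (advantage p q A Z i (W i) (Zs i) - R i (W i)) < hammingDist W Zs * h) :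
    flipMass p q A Zs Z ≤ K * r
      + Real.exp (h / 2) * ∑ i, ∑ b ∈ {Zs i}ᶜ, Real.exp (R i b / 2) := by
  classical
  let W : Labels n K := fun i =>
    if hb : ∃ b, b ≠ Zs i ∧ h ≤ advantage p q A Z i b (Zs i) - R i b then hb.choose else Zs i
  have hself : ∀ i, advantage p q A Z i (Zs i) (Zs i) = 0 := fun i => by simp [advantage]
  have hWne : ∀ i, W i ≠ Zs i → h ≤ advantage p q A Z i (W i) (Zs i) - R i (W i) := by
    intro i hi
    by_cases hb : ∃ b, b ≠ Zs i ∧ h ≤ advantage p q A Z i b (Zs i) - R i b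
    · have : W i = hb.choose := dif_pos hb
      rw [this]
      exact hb.choose_spec.2
    · exact absurd (dif_neg hb) hi
  have hWeq : ∀ i, W i = Zs i → ∀ b, b ≠ Zs i →
      advantage p q A Z i b (Zs i) - R i b < h := by
    intro i hi b hb
    by_contra hlt
    push Not at hlt
    have hex : ∃ b, b ≠ Zs i ∧ h ≤ advantage p q A Z i b (Zs i) - R i b := ⟨b, hb, hlt⟩
    have : W i = hex.choose := dif_pos hex
    exact hex.choose_spec.1 (this ▸ hi)
  have hlt : (hammingDist W Zs : ℝ) < r := by
    by_contra hle
    push Not at hle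
    have h1 := hW W hle
    rw [hammingDist_eq_sum, Finset.sum_mul] at h1
    refine absurd h1 (not_lt.mpr (Finset.sum_le_sum fun i _ => ?_))
    by_cases hi : W i = Zs i
    · simp [hi, hself, hR]
    · rw [if_pos hi, one_mul]
      exact hWne i hi
  have hterm : ∀ i, ∑ b ∈ ({Zs i}ᶜ : Finset (Fin K)),
      min 1 (Real.exp (advantage p q A Z i b (Zs i) / 2)) ≤
      K * (if W i ≠ Zs i then 1 else 0)
        + Real.exp (h / 2) * ∑ b ∈ {Zs i}ᶜ, Real.exp (R i b / 2) := by
    intro i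
    have hnn : 0 ≤ Real.exp (h / 2) * ∑ b ∈ ({Zs i}ᶜ : Finset (Fin K)), Real.exp (R i b / 2) :=
      mul_nonneg (Real.exp_pos _).le (Finset.sum_nonneg fun b _ => (Real.exp_pos _).le)
    by_cases hi : W i = Zs i
    · rw [if_neg (not_not.mpr hi), mul_zero, zero_add, Finset.mul_sum]
      refine Finset.sum_le_sum fun b hb => (min_le_right _ _).trans ?_
      rw [← Real.exp_add, Real.exp_le_exp]
      have := hWeq i hi b (by simpa using hb)
      linarith
    · rw [if_pos hi, mul_one]
      have h1 : ∑ b ∈ ({Zs i}ᶜ : Finset (Fin K)),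
          min 1 (Real.exp (advantage p q A Z i b (Zs i) / 2)) ≤ K := by
        refine (Finset.sum_le_sum fun b _ => min_le_left _ _).trans ?_
        rw [Finset.sum_const, nsmul_eq_mul, mul_one]
        exact_mod_cast (Finset.card_le_univ _).trans (Fintype.card_fin K).le
      linarith
  unfold flipMass
  refine (Finset.sum_le_sum fun i _ => hterm i).trans ?_
  rw [Finset.sum_add_distrib, ← Finset.mul_sum, ← Finset.mul_sum, ← hammingDist_eq_sum]
  have : (0 : ℝ) ≤ K := by positivity
  nlinarith

end GoodGraphs

section FewErrors

variable {n K : ℕ} {α β p q : ℝ} {Ω : Type*} [MeasurableSpace Ω] {μ : Measure Ω}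
  {A : Ω → SimpleGraph (Fin n)} {Zs : Labels n K}

theorem IsSBM.integral_exp_half_advantage_le [IsProbabilityMeasure μ]
    (h : IsSBM μ A Zs (connMatrix K p q)) (hq : 0 < q) (hqp : q < p) (hp : p < 1)
    (hZs : Zs ∈ feasible n K β) {i : Fin n} {b : Fin K} (hb : b ≠ Zs i) :
    ∫ ω, Real.exp (advantage p q (A ω) Zs i b (Zs i) / 2) ∂μ ≤
      Real.exp (-(renyiHalf p q * (effSize K β n - 1 / 2))) := by
  simp_rw [Real.exp_half, ← likelihood_ratio_update hq hqp hp]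
  rw [h.integral_sqrt_likelihood hq hqp hp, Real.exp_le_exp]
  have h1 := le_mismatch_of_hammingDist hZs (Function.update Zs i b)
  have h2 : hammingDist (Function.update Zs i b) Zs = 1 := by
    have := hammingDist_update_add_one (Z := Function.update Zs i b) (W := Zs) i (by simpa using hb)
    rw [Function.update_idem, Function.update_eq_self, hammingDist_self] at this
    omega
  rw [h2] at h1
  have hI := renyiHalf_pos hq hqp hp
  push_cast at h1
  nlinarith

theorem sum_sum_compl_le_mul {f : Fin n → Fin n → ℝ} {Z W : Labels n K} {a : ℝ} (ha : 0 ≤ a)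
    (hf : ∀ i j, f i j ≤ a * ((if W i ≠ Zs i then 1 else 0) * if Z j ≠ Zs j then 1 else 0)) :
    ∑ i, ∑ j ∈ ({i}ᶜ : Finset (Fin n)), f i j ≤ a * (hammingDist W Zs * hammingDist Z Zs) := by
  rw [hammingDist_eq_sum, hammingDist_eq_sum, Finset.sum_mul_sum, Finset.mul_sum]
  refine Finset.sum_le_sum fun i _ => ?_
  rw [Finset.mul_sum]
  refine (Finset.sum_le_sum fun j _ => hf i j).trans ?_
  refine Finset.sum_le_univ_sum_of_nonneg fun j => mul_nonneg ha ?_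
  split_ifs <;> norm_num

/-- The change of the advantages at the nodes relabeled by `W` when the truth is replaced by
`Z`. -/
theorem IsSBM.measureReal_shift_le [IsProbabilityMeasure μ]
    (h : IsSBM μ A Zs (connMatrix K p q)) {C θ : ℝ} (hC : 0 ≤ C) (hI : 0 ≤ renyiHalf p q)
    (hq : 0 ≤ q) (hqp : q ≤ p) (hp : p ≤ 1) (hθ : 0 ≤ θ)
    (hmgf : ∀ r, (r = p ∨ r = q) → |edgeMean p q r| ≤ C * renyiHalf p q ∧ ∀ s, |s| ≤ 4 * θ →
      edgeMgf p q r s ≤ Real.exp (s * edgeMean p q r + C * s ^ 2 * renyiHalf p q))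
    (Z W : Labels n K) (a : ℝ) :
    μ.real {ω | a ≤ ∑ i, (advantage p q (A ω) Z i (W i) (Zs i)
        - advantage p q (A ω) Zs i (W i) (Zs i))} ≤
      Real.exp (-(θ * a) + C * θ * (2 + 8 * θ) * renyiHalf p q
        * (hammingDist W Zs * hammingDist Z Zs)) := by
  set I := renyiHalf p q
  let d : Fin n → Fin n → ℝ := fun i j =>
    ((if Z j = W i then 1 else 0) - if Z j = Zs i then 1 else 0)
      - ((if Zs j = W i then 1 else 0) - if Zs j = Zs i then 1 else 0)
  have hd2 : ∀ i j, |d i j| ≤ 2 := fun i j => by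
    simp only [d]
    rw [abs_le]
    split_ifs <;> norm_num
  have hd0 : ∀ i j, W i = Zs i ∨ Z j = Zs j → d i j = 0 := fun i j hij => by
    simp only [d]
    rcases hij with hij | hij <;> simp [hij]
  have hsum : ∀ G : SimpleGraph (Fin n), θ * ∑ i, (advantage p q G Z i (W i) (Zs i)
      - advantage p q G Zs i (W i) (Zs i))
      = ∑ i, ∑ j ∈ {i}ᶜ, (θ * d i j) * edgeScore p q G i j := fun G => by
    rw [Finset.mul_sum]
    refine Finset.sum_congr rfl fun i _ => ?_
    unfold advantage
    rw [← Finset.sum_sub_distrib, Finset.mul_sum]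
    refine Finset.sum_congr rfl fun j _ => ?_
    simp only [d]
    ring
  have h1 : μ.real {ω | a ≤ ∑ i, (advantage p q (A ω) Z i (W i) (Zs i)
        - advantage p q (A ω) Zs i (W i) (Zs i))} ≤
      μ.real {ω | θ * a ≤ ∑ i, ∑ j ∈ {i}ᶜ, (θ * d i j) * edgeScore p q (A ω) i j} := by
    refine measureReal_mono fun ω hω => ?_
    have hω' : a ≤ ∑ i, (advantage p q (A ω) Z i (W i) (Zs i)
        - advantage p q (A ω) Zs i (W i) (Zs i)) := hω
    change θ * a ≤ ∑ i, ∑ j ∈ {i}ᶜ, (θ * d i j) * edgeScore p q (A ω) i j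
    rw [← hsum]
    exact mul_le_mul_of_nonneg_left hω' hθ
  refine h1.trans ((h.measureReal_le_exp
    (fun G => ∑ i, ∑ j ∈ {i}ᶜ, (θ * d i j) * edgeScore p q G i j) (θ * a)).trans ?_)
  rw [Real.exp_add]
  refine mul_le_mul_of_nonneg_left ?_ (Real.exp_pos _).le
  refine (h.integral_exp_offdiag_le hC hI hq hqp hp (fun r hr => (hmgf r hr).2)
    (fun i j => θ * d i j) ?_).trans ?_
  · intro i j
    rw [← mul_add, abs_mul, abs_of_nonneg hθ]
    have := (abs_add_le (d i j) (d j i)).trans (add_le_add (hd2 i j) (hd2 j i))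
    nlinarith
  · rw [Real.exp_le_exp]
    refine sum_sum_compl_le_mul (by positivity) fun i j => ?_
    by_cases hij : W i = Zs i ∨ Z j = Zs j
    · rw [hd0 i j hij]
      rcases hij with hij | hij <;> simp [hij]
    · push Not at hij
      rw [if_pos hij.1, if_pos hij.2, mul_one, mul_one]
      have hr : connMatrix K p q (Zs i) (Zs j) = p ∨ connMatrix K p q (Zs i) (Zs j) = q := by
        unfold connMatrix
        split_ifs
        · exact Or.inl rfl
        · exact Or.inr rfl
      have hmean := (hmgf _ hr).1
      have h2 : d i j * edgeMean p q (connMatrix K p q (Zs i) (Zs j)) ≤ 2 * (C * I) := by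
        refine (le_abs_self _).trans ?_
        rw [abs_mul]
        exact mul_le_mul (hd2 i j) hmean (abs_nonneg _) (by norm_num)
      have h3 : d i j ^ 2 ≤ 4 := by
        rw [← sq_abs]
        nlinarith [hd2 i j, abs_nonneg (d i j)]
      have h4 : θ * (d i j * edgeMean p q (connMatrix K p q (Zs i) (Zs j))) ≤ θ * (2 * (C * I)) :=
        mul_le_mul_of_nonneg_left h2 hθ
      have h5 : (C * θ ^ 2 * I) * d i j ^ 2 ≤ (C * θ ^ 2 * I) * 4 :=
        mul_le_mul_of_nonneg_left h3 (by positivity)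
      nlinarith

end FewErrors

/-- With few errors, few flips away from the truth are accepted. -/
theorem exists_flipMass_bound_few {K : ℕ} {β : ℝ} (hK : 2 ≤ K) (hβ : 1 ≤ β) (c : ℝ) {ε₁ ρ : ℝ}
    (hε : 0 < ε₁) (hε1 : ε₁ ≤ 1) (hρ : 0 < ρ) :
    ∃ κ : ℝ, 0 < κ ∧ ∃ (C : ℝ) (N : ℕ), ∀ n : ℕ, N ≤ n → ∀ p q : ℝ,
      StrongSignal K β c ε₁ n p q →
      ∀ Zs ∈ feasible n K β, ∀ (Ω : Type*) [MeasurableSpace Ω] (μ : Measure Ω)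
        [IsProbabilityMeasure μ] (A : Ω → SimpleGraph (Fin n)),
        IsSBM μ A Zs (connMatrix K p q) →
        μ.real {ω | ∃ Z : Labels n K, Z ≠ Zs ∧ (hammingDist Z Zs : ℝ) ≤ κ * n ∧
          ρ * hammingDist Z Zs < flipMass p q (A ω) Zs Z} ≤ C * (n : ℝ) ^ (-(ε₁ / 2)) := by
  have hK' : (2 : ℝ) ≤ K := by exact_mod_cast hK
  set ρ' := ρ / (2 * K) with hρ'
  have hρ'0 : 0 < ρ' := by positivity
  set ε' := ε₁ / (4 * (K * β)) with hε'
  have hε'0 : 0 < ε' := by positivity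
  set θ := 4 * (1 + 1 / ρ') / ε' with hθ
  have hθ0 : 0 < θ := by positivity
  obtain ⟨C₀, hC₀, hmgf⟩ := exists_edgeMgf_le c (4 * θ) (by positivity)
  set κ := ε' / (2 * (C₀ * (2 + 8 * θ))) with hκ
  have hκ0 : 0 < κ := by positivity
  obtain ⟨N, hN⟩ := exists_large (max K (4 * (K * β) / ε₁)) (half_pos hε) 1
  refine ⟨κ, hκ0, 2 * K / ρ + 6 * K, N, ?_⟩
  intro n hn p q hs Zs hZs Ω _ μ _ A hA
  obtain ⟨hn1, hnR, -, -⟩ := hN n hn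
  have hn' : (1 : ℝ) ≤ n := by exact_mod_cast hn1
  have hn0 : (0 : ℝ) < n := by linarith
  have hnK : (K : ℝ) ≤ n := (le_max_left _ _).trans hnR
  have hnε : 4 * (K * β) / ε₁ ≤ n := (le_max_right _ _).trans hnR
  have hI := hs.renyiHalf_pos
  have hp1 := hs.p_lt_one
  set I := renyiHalf p q with hIdef
  have hlogI := hs.log_le_mul hK hβ hε.le hn1
  have hlog0 : 0 ≤ Real.log n := Real.log_nonneg hn'
  set h := ε' * n * I with hh
  set S : SimpleGraph (Fin n) → ℝ := fun G =>
    ∑ i, ∑ b ∈ {Zs i}ᶜ, Real.exp (advantage p q G Zs i b (Zs i) / 2) with hS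
  set y := Real.exp (-(2 * Real.log n)) with hy
  have hy0 : 0 ≤ y := (Real.exp_pos _).le
  have hyn : n * y = 1 / n := by
    have : y = (n : ℝ)⁻¹ * (n : ℝ)⁻¹ := by
      rw [hy, two_mul, neg_add, Real.exp_add, Real.exp_neg, Real.exp_log hn0]
    rw [this]
    field_simp
  have hnKy : n * K * y = K * (1 / n) := by rw [← hyn]; ring
  have hnKy1 : n * K * y ≤ 1 := by
    rw [hnKy, mul_one_div, div_le_one hn0]
    exact hnK
  set E₀ : Set Ω := {ω | ρ / 2 * Real.exp (-(h / 2)) ≤ S (A ω)} with hE₀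
  let E : Labels n K × Labels n K → Set Ω := fun ZW =>
    {ω | hammingDist ZW.2 Zs * h ≤ ∑ i, (advantage p q (A ω) ZW.1 i (ZW.2 i) (Zs i)
        - advantage p q (A ω) Zs i (ZW.2 i) (Zs i))}
  set J : Finset (Labels n K × Labels n K) := Finset.univ.filter fun ZW =>
    ZW.1 ≠ Zs ∧ (hammingDist ZW.1 Zs : ℝ) ≤ κ * n ∧
      ρ' * hammingDist ZW.1 Zs ≤ hammingDist ZW.2 Zs with hJ
  have hsub : {ω | ∃ Z : Labels n K, Z ≠ Zs ∧ (hammingDist Z Zs : ℝ) ≤ κ * n ∧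
      ρ * hammingDist Z Zs < flipMass p q (A ω) Zs Z} ⊆ E₀ ∪ ⋃ ZW ∈ J, E ZW := by
    rintro ω ⟨Z, hZ, hZκ, hflip⟩
    by_contra hω
    simp only [Set.mem_union, not_or, Set.mem_iUnion, not_exists] at hω
    obtain ⟨hω0, hωE⟩ := hω
    have hω0' : S (A ω) < ρ / 2 * Real.exp (-(h / 2)) := not_le.mp hω0
    have h1 := flipMass_le (p := p) (q := q) (A ω) Zs Z
      (fun i b => advantage p q (A ω) Zs i b (Zs i)) (fun i => by simp [advantage])
      (h := h) (r := ρ' * hammingDist Z Zs) (by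
        intro W hW
        have := hωE (Z, W) (by simp only [hJ, Finset.mem_filter, Finset.mem_univ, true_and];
                                exact ⟨hZ, hZκ, hW⟩)
        exact not_le.mp this)
    have h2 : Real.exp (h / 2) * S (A ω) ≤ ρ / 2 := by
      calc Real.exp (h / 2) * S (A ω) ≤ Real.exp (h / 2) * (ρ / 2 * Real.exp (-(h / 2))) := by
            gcongr
        _ = ρ / 2 * (Real.exp (h / 2) * Real.exp (-(h / 2))) := by ring
        _ = ρ / 2 := by rw [← Real.exp_add]; simp
    have h3 : (1 : ℝ) ≤ hammingDist Z Zs := by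
      exact_mod_cast hammingDist_pos.mpr hZ
    have h4 : K * (ρ' * hammingDist Z Zs) = ρ / 2 * hammingDist Z Zs := by
      rw [hρ']; field_simp
    rw [h4] at h1
    have h5 : flipMass p q (A ω) Zs Z ≤ ρ / 2 * hammingDist Z Zs + ρ / 2 := h1.trans (by
      gcongr)
    nlinarith
  have hprob0 : μ.real E₀ ≤ 2 * K / ρ * (n : ℝ) ^ (-(ε₁ / 2)) := by
    have hpos : 0 < ρ / 2 * Real.exp (-(h / 2)) := by positivity
    refine (hA.measureReal_le_div S (fun G => Finset.sum_nonneg fun i _ =>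
      Finset.sum_nonneg fun b _ => (Real.exp_pos _).le) hpos).trans ?_
    have hintegral : ∫ ω, S (A ω) ∂μ ≤ n * (K * Real.exp (-(I * (effSize K β n - 1 / 2)))) := by
      simp only [hS]
      rw [integral_finsetSum _ fun i _ => hA.integrable_comp fun G =>
        ∑ b ∈ {Zs i}ᶜ, Real.exp (advantage p q G Zs i b (Zs i) / 2)]
      have hi : ∀ i, ∫ ω, ∑ b ∈ {Zs i}ᶜ, Real.exp (advantage p q (A ω) Zs i b (Zs i) / 2) ∂μ ≤
          K * Real.exp (-(I * (effSize K β n - 1 / 2))) := by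
        intro i
        rw [integral_finsetSum _ fun b _ => hA.integrable_comp fun G =>
          Real.exp (advantage p q G Zs i b (Zs i) / 2)]
        refine (Finset.sum_le_sum fun b hb => hA.integral_exp_half_advantage_le hs.q_pos hs.q_lt_p
          hp1 hZs (by simpa using hb)).trans ?_
        rw [Finset.sum_const, nsmul_eq_mul]
        refine mul_le_mul_of_nonneg_right ?_ (Real.exp_pos _).le
        exact_mod_cast (Finset.card_le_univ _).trans (Fintype.card_fin K).le
      refine (Finset.sum_le_sum fun i _ => hi i).trans ?_
      simp
    have hx := hs.exp_le_rpow hε hε1 hn1 (x := 1 / 2 + ε' * n / 2) (by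
      have h1 := le_effSize (n := n) hK hβ
      have h2 : ε' * n / 2 = ε₁ / 8 * (n / (K * β)) := by rw [hε']; field_simp; ring
      have h3 : 1 / 2 ≤ ε₁ / 8 * (n / (K * β)) := by
        rw [div_le_iff₀ hε] at hnε
        rw [← mul_div_assoc, le_div_iff₀ (by positivity)]
        linarith
      nlinarith)
    rw [div_le_iff₀ hpos]
    calc ∫ ω, S (A ω) ∂μ ≤ n * (K * Real.exp (-(I * (effSize K β n - 1 / 2)))) := hintegral
      _ = K * (n * Real.exp (-(I * (effSize K β n - (1 / 2 + ε' * n / 2)))))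
            * Real.exp (-(h / 2)) := by
          have : -(I * (effSize K β n - 1 / 2)) =
            -(I * (effSize K β n - (1 / 2 + ε' * n / 2))) + -(h / 2) := by rw [hh]; ring
          rw [this, Real.exp_add]
          ring
      _ ≤ K * (n : ℝ) ^ (-(ε₁ / 2)) * Real.exp (-(h / 2)) := by gcongr
      _ = _ := by field_simp
  have hprobE : ∀ ZW ∈ J, μ.real (E ZW) ≤
      y ^ hammingDist ZW.1 Zs * y ^ hammingDist ZW.2 Zs := by
    rintro ⟨Z, W⟩ hZW
    simp only [hJ, Finset.mem_filter, Finset.mem_univ, true_and] at hZW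
    obtain ⟨hZ, hZκ, hW⟩ := hZW
    refine (hA.measureReal_shift_le (C := C₀) (θ := θ) (by linarith) hI.le hs.q_pos.le hs.q_lt_p.le
      hp1.le hθ0.le (hmgf p q hs.q_pos hs.q_lt_p hs.p_le hs.p_le_mul) Z W _).trans ?_
    simp only
    rw [hy, ← Real.exp_nat_mul, ← Real.exp_nat_mul, ← Real.exp_add, Real.exp_le_exp]
    set m : ℝ := (hammingDist Z Zs : ℝ)
    set s : ℝ := (hammingDist W Zs : ℝ)
    have hm0 : 0 ≤ m := by positivity
    have hs0 : 0 ≤ s := by positivity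
    have h1 : C₀ * θ * (2 + 8 * θ) * I * (s * m) ≤ θ * s * (ε' / 2 * n * I) := by
      have h2 : C₀ * (2 + 8 * θ) * m ≤ ε' / 2 * n := by
        calc C₀ * (2 + 8 * θ) * m ≤ C₀ * (2 + 8 * θ) * (κ * n) := by gcongr
          _ = ε' / 2 * n := by rw [hκ]; field_simp
      calc C₀ * θ * (2 + 8 * θ) * I * (s * m) = (C₀ * (2 + 8 * θ) * m) * (θ * s * I) := by ring
        _ ≤ (ε' / 2 * n) * (θ * s * I) := by gcongr
        _ = _ := by ring
    have h3 : m + s ≤ (1 + 1 / ρ') * s := by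
      have : m ≤ s / ρ' := by rw [le_div_iff₀ hρ'0]; linarith
      calc m + s ≤ s / ρ' + s := by linarith
        _ = _ := by ring
    have h4 : 2 * (m + s) * Real.log n ≤ θ * s * (ε' / 2 * n * I) := by
      calc 2 * (m + s) * Real.log n ≤ 2 * ((1 + 1 / ρ') * s) * (n * I) := by gcongr
        _ = θ * s * (ε' / 2 * n * I) := by rw [hθ]; field_simp; ring
    have h5 : θ * (s * h) = 2 * (θ * s * (ε' / 2 * n * I)) := by rw [hh]; ring
    linarith
  have hprob1 : μ.real (⋃ ZW ∈ J, E ZW) ≤ 6 * K * (n : ℝ) ^ (-(ε₁ / 2)) := by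
    refine (measureReal_biUnion_finset_le J E).trans ((Finset.sum_le_sum hprobE).trans ?_)
    have hsubJ : J ⊆ (Finset.univ.filter fun Z : Labels n K => Z ≠ Zs) ×ˢ Finset.univ := by
      intro ZW hZW
      simp only [hJ, Finset.mem_filter, Finset.mem_univ, true_and] at hZW
      simp [hZW.1]
    refine (Finset.sum_le_sum_of_subset_of_nonneg hsubJ fun ZW _ _ => by positivity).trans ?_
    rw [Finset.sum_product]
    simp_rw [← Finset.mul_sum]
    rw [← Finset.sum_mul]
    have h1 := sum_pow_hammingDist_ne_le Zs hy0 (by omega) hnKy1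
    have h2 := sum_pow_hammingDist_le Zs hy0 (by omega) hnKy1
    have h3 : 0 ≤ ∑ Z : Labels n K, y ^ hammingDist Z Zs :=
      Finset.sum_nonneg fun _ _ => by positivity
    calc _ ≤ 2 * (n * K * y) * (1 + 2 * (n * K * y)) := by
          refine mul_le_mul h1 h2 h3 (by positivity)
      _ ≤ 2 * (n * K * y) * 3 := by gcongr; linarith
      _ = 6 * K * (1 / n) := by rw [hnKy]; ring
      _ ≤ _ := by
          have := (exp_neg_le_rpow (n := n) hε1 hn1).1
          gcongr
  refine (measureReal_mono hsub).trans ((measureReal_union_le _ _).trans ?_)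
  linarith

section ManyErrors

variable {n K : ℕ} {α p q : ℝ} {Ω : Type*} [MeasurableSpace Ω] {μ : Measure Ω}
  {A : Ω → SimpleGraph (Fin n)} {Zs : Labels n K}

/-- The mean advantage of a wrong label is negative as long as the misclassified nodes are fewer
than any community. -/
theorem sum_mean_advantage_le {Z : Labels n K} (hZ : Z ∈ feasible n K α)
    (hq : 0 < q) (hqp : q < p) (hp : p < 1) {i : Fin n} {b : Fin K} (hb : b ≠ Zs i)
    (hclose : (hammingDist Z Zs : ℝ) ≤ n / (α * K) - 1) :
    ∑ j ∈ {i}ᶜ, ((if Z j = b then 1 else 0) - if Z j = Zs i then 1 else 0)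
        * edgeMean p q (connMatrix K p q (Zs i) (Zs j)) ≤
      -(2 * renyiHalf p q * (n / (α * K) - 1 - hammingDist Z Zs)) := by
  have h1 := renyiHalf_le_edgeMean hq hqp hp
  have h2 := edgeMean_le_neg_renyiHalf hq hqp hp
  have hI := renyiHalf_pos hq hqp hp
  set u := edgeMean p q p
  set v := edgeMean p q q
  have hterm : ∀ j, ((if Z j = b then (1 : ℝ) else 0) - if Z j = Zs i then 1 else 0)
        * edgeMean p q (connMatrix K p q (Zs i) (Zs j)) ≤
      u * ((if Z j ≠ Zs j then 1 else 0) - if Z j = Zs i then 1 else 0)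
        + (-v) * ((if Z j ≠ Zs j then 1 else 0) - if Z j = b then 1 else 0) := by
    intro j
    have hu : 0 ≤ u := by linarith
    have hv : v ≤ 0 := by linarith
    by_cases hij : Zs i = Zs j
    · rw [connMatrix, if_pos hij]
      change _ * u ≤ _
      by_cases h3 : Z j = Zs j
      · have h4 : ¬Zs j = b := fun h => hb (h.symm.trans hij.symm)
        simp [h3, hij, h4]
      · rw [hij]
        by_cases h4 : Z j = b
        · rw [h4] at h3
          simp [h4, h3]
        · simp [h3, h4]; linarith
    · rw [connMatrix, if_neg hij]
      change _ * v ≤ _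
      by_cases h3 : Z j = Zs j
      · have h4 : ¬Zs j = Zs i := fun h => hij h.symm
        rw [h3]
        by_cases h5 : Zs j = b <;> simp [h4, h5]
        have h6 : ¬b = Zs i := hb
        simp [h6]
      · by_cases h4 : Z j = Zs i
        · have h5 : ¬Zs i = b := fun h => hb h.symm
          simp [h4, h5]
          simp [hij]
        · by_cases h5 : Z j = b
          · simp [h5, hb]
            split_ifs <;> linarith
          · simp [h3, h4, h5]
            linarith
  refine (Finset.sum_le_sum fun j _ => hterm j).trans ?_
  rw [Finset.sum_add_distrib, ← Finset.mul_sum, ← Finset.mul_sum, Finset.sum_sub_distrib,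
    Finset.sum_sub_distrib]
  have herr : ∑ j ∈ ({i}ᶜ : Finset (Fin n)), (if Z j ≠ Zs j then (1 : ℝ) else 0) ≤
      hammingDist Z Zs := by
    rw [hammingDist_eq_sum]
    exact Finset.sum_le_univ_sum_of_nonneg fun j => by split_ifs <;> norm_num
  have hsize : ∀ k, n / (α * K) - 1 ≤
      ∑ j ∈ ({i}ᶜ : Finset (Fin n)), if Z j = k then (1 : ℝ) else 0 := by
    intro k
    have h3 := (mem_feasible.mp hZ k).1
    rw [communitySize_eq_sum, ← Finset.sum_add_sum_compl {i}, Finset.sum_singleton] at h3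
    have : (if Z i = k then (1 : ℝ) else 0) ≤ 1 := by split_ifs <;> norm_num
    linarith
  have ha := hsize (Zs i)
  have hb' := hsize b
  set e := ∑ j ∈ ({i}ᶜ : Finset (Fin n)), (if Z j ≠ Zs j then (1 : ℝ) else 0)
  have hx : 0 ≤ n / (α * K) - 1 - (hammingDist Z Zs : ℝ) := by linarith
  nlinarith

theorem IsSBM.measureReal_advantage_le [IsProbabilityMeasure μ]
    (h : IsSBM μ A Zs (connMatrix K p q)) {C θ : ℝ} (hC : 0 ≤ C)
    (hq : 0 < q) (hqp : q < p) (hp : p < 1) (hθ : 0 ≤ θ)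
    (hmgf : ∀ r, (r = p ∨ r = q) → ∀ s, |s| ≤ 2 * θ →
      edgeMgf p q r s ≤ Real.exp (s * edgeMean p q r + C * s ^ 2 * renyiHalf p q))
    {Z : Labels n K} (hZ : Z ∈ feasible n K α)
    (hclose : (hammingDist Z Zs : ℝ) ≤ n / (α * K) - 1) (W : Labels n K) (a : ℝ) :
    μ.real {ω | a ≤ ∑ i, advantage p q (A ω) Z i (W i) (Zs i)} ≤
      Real.exp (-(θ * a) + hammingDist W Zs * renyiHalf p q *
        (2 * C * θ ^ 2 * n - 2 * θ * (n / (α * K) - 1 - hammingDist Z Zs))) := by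
  have hI := renyiHalf_pos hq hqp hp
  set I := renyiHalf p q
  let d : Fin n → Fin n → ℝ := fun i j =>
    (if Z j = W i then 1 else 0) - if Z j = Zs i then 1 else 0
  have hd1 : ∀ i j, |d i j| ≤ 1 := fun i j => by
    simp only [d]
    rw [abs_le]
    split_ifs <;> norm_num
  have hsum : ∀ G : SimpleGraph (Fin n), θ * ∑ i, advantage p q G Z i (W i) (Zs i)
      = ∑ i, ∑ j ∈ {i}ᶜ, (θ * d i j) * edgeScore p q G i j := fun G => by
    rw [Finset.mul_sum]
    refine Finset.sum_congr rfl fun i _ => ?_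
    unfold advantage
    rw [Finset.mul_sum]
    exact Finset.sum_congr rfl fun j _ => by simp only [d]; ring
  have h1 : μ.real {ω | a ≤ ∑ i, advantage p q (A ω) Z i (W i) (Zs i)} ≤
      μ.real {ω | θ * a ≤ ∑ i, ∑ j ∈ {i}ᶜ, (θ * d i j) * edgeScore p q (A ω) i j} := by
    refine measureReal_mono fun ω hω => ?_
    have hω' : a ≤ ∑ i, advantage p q (A ω) Z i (W i) (Zs i) := hω
    change θ * a ≤ ∑ i, ∑ j ∈ {i}ᶜ, (θ * d i j) * edgeScore p q (A ω) i j
    rw [← hsum]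
    exact mul_le_mul_of_nonneg_left hω' hθ
  refine h1.trans ((h.measureReal_le_exp
    (fun G => ∑ i, ∑ j ∈ {i}ᶜ, (θ * d i j) * edgeScore p q G i j) (θ * a)).trans ?_)
  rw [Real.exp_add]
  refine mul_le_mul_of_nonneg_left ?_ (Real.exp_pos _).le
  refine (h.integral_exp_offdiag_le hC hI.le hq.le hqp.le hp.le hmgf
    (fun i j => θ * d i j) ?_).trans ?_
  · intro i j
    rw [← mul_add, abs_mul, abs_of_nonneg hθ]
    have := (abs_add_le (d i j) (d j i)).trans (add_le_add (hd1 i j) (hd1 j i))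
    nlinarith
  · rw [Real.exp_le_exp, hammingDist_eq_sum W Zs, mul_assoc, Finset.sum_mul]
    refine Finset.sum_le_sum fun i _ => ?_
    by_cases hi : W i = Zs i
    · have : ∀ j, d i j = 0 := fun j => by simp [d, hi]
      simp [hi, this]
    · rw [if_pos hi, one_mul, Finset.sum_add_distrib]
      have h2 := sum_mean_advantage_le (Zs := Zs) hZ hq hqp hp hi hclose
      have h3 : ∑ j ∈ ({i}ᶜ : Finset (Fin n)),
          θ * d i j * edgeMean p q (connMatrix K p q (Zs i) (Zs j)) ≤
          θ * -(2 * I * (n / (α * K) - 1 - hammingDist Z Zs)) := by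
        refine le_trans (le_of_eq ?_) (mul_le_mul_of_nonneg_left h2 hθ)
        rw [Finset.mul_sum]
        exact Finset.sum_congr rfl fun j _ => by simp only [d]; ring
      have h4 : ∑ j ∈ ({i}ᶜ : Finset (Fin n)), 2 * C * (θ * d i j) ^ 2 * I ≤
          n * (2 * C * θ ^ 2 * I) := by
        have h5 : ∀ j, 2 * C * (θ * d i j) ^ 2 * I ≤ 2 * C * θ ^ 2 * I := fun j => by
          have : d i j ^ 2 ≤ 1 := by
            rw [← sq_abs]
            nlinarith [hd1 i j, abs_nonneg (d i j)]
          have h6 : (2 * C * θ ^ 2 * I) * d i j ^ 2 ≤ (2 * C * θ ^ 2 * I) * 1 :=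
            mul_le_mul_of_nonneg_left this (by positivity)
          linarith
        refine (Finset.sum_le_univ_sum_of_nonneg fun j => by positivity).trans ?_
        refine (Finset.sum_le_sum fun j _ => h5 j).trans ?_
        simp
      nlinarith

end ManyErrors

/-- With many errors, but fewer than any community has nodes, few flips away from the truth are
accepted. -/
theorem exists_flipMass_bound_many {K : ℕ} {α β : ℝ} (hK : 2 ≤ K) (hβ : 1 ≤ β) (hαβ : β < α)
    (c : ℝ) {ε₁ ρ κ : ℝ} (hε1 : ε₁ ≤ 1) (hρ : 0 < ρ) (hκ : 0 < κ) :
    ∃ H : ℝ, 0 < H ∧ ∀ n : ℕ, 1 ≤ n → ∀ p q : ℝ,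
      StrongSignal K β c ε₁ n p q → ∀ γ : ℝ, 0 < γ → K * α * γ < 1 →
      H ≤ (1 - K * α * γ) ^ 2 * n * renyiHalf p q →
      ∀ Zs : Labels n K, ∀ (Ω : Type*) [MeasurableSpace Ω] (μ : Measure Ω)
        [IsProbabilityMeasure μ] (A : Ω → SimpleGraph (Fin n)),
        IsSBM μ A Zs (connMatrix K p q) →
        μ.real {ω | ∃ Z ∈ feasible n K α, κ * n ≤ hammingDist Z Zs ∧
          (hammingDist Z Zs : ℝ) < γ * n ∧
          ρ * hammingDist Z Zs < flipMass p q (A ω) Zs Z} ≤ (n : ℝ) ^ (-(ε₁ / 2)) := by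
  have hK' : (2 : ℝ) ≤ K := by exact_mod_cast hK
  have hK0 : (0 : ℝ) < K := by linarith
  have hα : 1 < α := by linarith
  have hα0 : 0 < α := by linarith
  set ρ' := ρ / (2 * K) with hρ'
  have hρ'0 : 0 < ρ' := by positivity
  set h₂ := 2 * Real.log (2 * K / (ρ * κ)) with hh₂
  obtain ⟨C, hC, hmgf⟩ := exists_edgeMgf_le c 2 (by norm_num)
  have hC0 : 0 < C := by linarith
  set c₅ := 1 / (8 * C * (K * α) ^ 2) with hc₅
  have hc₅0 : 0 < c₅ := by positivity
  set H := max (4 * (K * α)) (max (4 * (K * α) * h₂)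
    (2 * (2 * Real.log K + 1) / (ρ' * κ * c₅))) with hH
  have hH1 : 4 * (K * α) ≤ H := le_max_left _ _
  have hH2 : 4 * (K * α) * h₂ ≤ H := (le_max_left _ _).trans (le_max_right _ _)
  have hH3 : 2 * (2 * Real.log K + 1) / (ρ' * κ * c₅) ≤ H :=
    (le_max_right _ _).trans (le_max_right _ _)
  have hKα : 0 < K * α := by positivity
  refine ⟨H, by linarith, ?_⟩
  intro n hn p q hs γ hγ hγ1 hHn Zs Ω _ μ _ A hA
  have hn' : (1 : ℝ) ≤ n := by exact_mod_cast hn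
  have hn0 : (0 : ℝ) < n := by linarith
  have hI := hs.renyiHalf_pos
  have hI2 := renyiHalf_le_two hs.q_pos hs.q_lt_p hs.p_le
  set I := renyiHalf p q with hIdef
  set δ := 1 - K * α * γ with hδ
  have hδ0 : 0 < δ := by linarith
  have hδ1 : δ ≤ 1 := by
    have : 0 < K * α * γ := by positivity
    linarith
  have hδnI : H ≤ δ * n * I := by
    refine hHn.trans ?_
    have : δ ^ 2 ≤ δ := by nlinarith
    gcongr
  have hδn : 2 * (K * α) ≤ δ * n := by
    have h1 : δ * n * I ≤ δ * n * 2 := by gcongr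
    linarith
  let E : Labels n K × Labels n K → Set Ω := fun ZW =>
    {ω | hammingDist ZW.2 Zs * (-h₂) ≤ ∑ i, advantage p q (A ω) ZW.1 i (ZW.2 i) (Zs i)}
  set J : Finset (Labels n K × Labels n K) := Finset.univ.filter fun ZW =>
    ZW.1 ∈ feasible n K α ∧ (hammingDist ZW.1 Zs : ℝ) < γ * n ∧
      ρ' * κ * n ≤ hammingDist ZW.2 Zs with hJ
  have hsub : {ω | ∃ Z ∈ feasible n K α, κ * n ≤ hammingDist Z Zs ∧
      (hammingDist Z Zs : ℝ) < γ * n ∧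
      ρ * hammingDist Z Zs < flipMass p q (A ω) Zs Z} ⊆ ⋃ ZW ∈ J, E ZW := by
    rintro ω ⟨Z, hZ, hZκ, hZγ, hflip⟩
    by_contra hω
    simp only [Set.mem_iUnion, not_exists] at hω
    have h1 := flipMass_le (p := p) (q := q) (A ω) Zs Z (fun i b => 0) (fun i => rfl)
      (h := -h₂) (r := ρ' * κ * n) (by
        intro W hW
        have := hω (Z, W) (by simp only [hJ, Finset.mem_filter, Finset.mem_univ, true_and];
                              exact ⟨hZ, hZγ, hW⟩)
        simp only [sub_zero]
        exact not_le.mp this)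
    have h2 : Real.exp (-h₂ / 2) = ρ * κ / (2 * K) := by
      rw [hh₂, show -(2 * Real.log (2 * K / (ρ * κ))) / 2 = -Real.log (2 * K / (ρ * κ)) by ring,
        Real.exp_neg, Real.exp_log (by positivity), inv_div]
    have h3 : ∑ i, ∑ b ∈ ({Zs i}ᶜ : Finset (Fin K)), Real.exp ((0 : ℝ) / 2) ≤ n * K := by
      have h4 : ∀ i : Fin n, ∑ b ∈ ({Zs i}ᶜ : Finset (Fin K)), Real.exp ((0 : ℝ) / 2) ≤ K := by
        intro i
        rw [zero_div, Real.exp_zero, Finset.sum_const, nsmul_eq_mul, mul_one]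
        exact_mod_cast (Finset.card_le_univ _).trans (Fintype.card_fin K).le
      refine (Finset.sum_le_sum fun i _ => h4 i).trans ?_
      simp
    have h5 : flipMass p q (A ω) Zs Z ≤ K * (ρ' * κ * n) + ρ * κ / (2 * K) * (n * K) := by
      refine h1.trans ?_
      rw [h2]
      gcongr
    have h6 : K * (ρ' * κ * n) + ρ * κ / (2 * K) * (n * K) = ρ * (κ * n) := by
      rw [hρ']; field_simp; ring
    have h7 : ρ * (κ * n) ≤ ρ * hammingDist Z Zs := by gcongr
    linarith
  set θ := δ / (4 * C * (K * α)) with hθ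
  have hθ0 : 0 < θ := by positivity
  have hθ1 : θ ≤ 1 := by
    rw [hθ, div_le_one (by positivity)]
    have : 1 ≤ K * α := by nlinarith
    nlinarith
  have hprob : ∀ ZW ∈ J, μ.real (E ZW) ≤ Real.exp (-(n * (2 * Real.log K + 1))) := by
    rintro ⟨Z, W⟩ hZW
    simp only [hJ, Finset.mem_filter, Finset.mem_univ, true_and] at hZW
    obtain ⟨hZ, hZγ, hW⟩ := hZW
    have hgap : δ * n / (2 * (K * α)) ≤ n / (α * K) - 1 - hammingDist Z Zs := by
      have h1 : γ * n = n / (α * K) - δ * n / (K * α) := by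
        rw [hδ]; field_simp; ring
      have h2 : 1 ≤ δ * n / (2 * (K * α)) := by rwa [le_div_iff₀ (by positivity), one_mul]
      have h3 : δ * n / (K * α) = 2 * (δ * n / (2 * (K * α))) := by field_simp
      linarith
    have hclose : (hammingDist Z Zs : ℝ) ≤ n / (α * K) - 1 := by
      have : 0 ≤ δ * n / (2 * (K * α)) := by positivity
      linarith
    refine (hA.measureReal_advantage_le (C := C) (θ := θ) hC0.le hs.q_pos hs.q_lt_p hs.p_lt_one
      hθ0.le (fun r hr s hs' => (hmgf p q hs.q_pos hs.q_lt_p hs.p_le hs.p_le_mul r hr).2 s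
        (hs'.trans (by linarith))) hZ hclose W _).trans ?_
    rw [Real.exp_le_exp]
    simp only
    set s : ℝ := (hammingDist W Zs : ℝ)
    have hs0 : 0 ≤ s := by positivity
    have h1 : 2 * C * θ ^ 2 * n - 2 * θ * (n / (α * K) - 1 - hammingDist Z Zs) ≤
        -(c₅ * (δ ^ 2 * n)) := by
      have h2 : 2 * θ * (δ * n / (2 * (K * α))) ≤
          2 * θ * (n / (α * K) - 1 - hammingDist Z Zs) := by gcongr
      have h3 : 2 * C * θ ^ 2 * n - 2 * θ * (δ * n / (2 * (K * α))) = -(c₅ * (δ ^ 2 * n)) := by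
        rw [hθ, hc₅]; field_simp; ring
      linarith
    have h4 : s * I * (2 * C * θ ^ 2 * n - 2 * θ * (n / (α * K) - 1 - hammingDist Z Zs)) ≤
        s * I * -(c₅ * (δ ^ 2 * n)) := mul_le_mul_of_nonneg_left h1 (by positivity)
    have h5 : θ * h₂ ≤ c₅ / 2 * (δ ^ 2 * n * I) := by
      calc θ * h₂ = δ / (16 * C * (K * α) ^ 2) * (4 * (K * α) * h₂) := by
            rw [hθ]; field_simp; ring
        _ ≤ δ / (16 * C * (K * α) ^ 2) * (δ * n * I) :=
            mul_le_mul_of_nonneg_left (hH2.trans hδnI) (by positivity)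
        _ = _ := by rw [hc₅]; field_simp; ring
    have h6 : s * (θ * h₂) ≤ s * (c₅ / 2 * (δ ^ 2 * n * I)) := mul_le_mul_of_nonneg_left h5 hs0
    have h7 : n * (2 * Real.log K + 1) ≤ s * (c₅ / 2 * (δ ^ 2 * n * I)) := by
      calc (n : ℝ) * (2 * Real.log K + 1)
          = ρ' * κ * n * (c₅ / 2 * (2 * (2 * Real.log K + 1) / (ρ' * κ * c₅))) := by field_simp
        _ ≤ s * (c₅ / 2 * (δ ^ 2 * n * I)) := by
            have hlogK : 0 ≤ Real.log K := Real.log_nonneg (by linarith)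
            have := hH3.trans hHn
            gcongr
    linarith
  refine (measureReal_mono hsub (measure_ne_top _ _)).trans
    ((measureReal_biUnion_finset_le J E).trans
    ((Finset.sum_le_sum hprob).trans ?_))
  rw [Finset.sum_const, nsmul_eq_mul]
  refine le_trans ?_ (exp_neg_le_rpow hε1 hn).2
  have hcard : (J.card : ℝ) ≤ Real.exp (n * (2 * Real.log K)) := by
    have h1 : J.card ≤ K ^ n * K ^ n := by
      refine (Finset.card_le_univ J).trans (le_of_eq ?_)
      simp [Fintype.card_prod]
    have h2 : Real.exp (n * (2 * Real.log K)) = (K : ℝ) ^ n * (K : ℝ) ^ n := by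
      rw [Real.exp_nat_mul, two_mul, Real.exp_add, Real.exp_log hK0, mul_pow]
    rw [h2]
    exact_mod_cast h1
  calc (J.card : ℝ) * Real.exp (-(n * (2 * Real.log K + 1)))
      ≤ Real.exp (n * (2 * Real.log K)) * Real.exp (-(n * (2 * Real.log K + 1))) := by gcongr
    _ = Real.exp (-n) := by rw [← Real.exp_add]; congr 1; ring

section Asymptotics

variable {K : ℕ} {α β ε₀ : ℝ} {p q γ₀ ξ : ℕ → ℝ}

theorem eventually_strongSignal (hK : 2 ≤ K) (hβ : 1 ≤ β)
    (hpq : ∀ n, 0 < q n ∧ q n < p n ∧ p n < 1) (hp : Tendsto p atTop (𝓝 0)) {c : ℝ}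
    (hc : ∀ n, p n ≤ c * q n) (hε₀ : 0 < ε₀) (hsignal : SignalCondition K β ε₀ p q) :
    ∀ᶠ n in atTop, StrongSignal K β c (min (ε₀ / 2) 1) n (p n) (q n) := by
  have hK' : (2 : ℝ) ≤ K := by exact_mod_cast hK
  have h1 : ∀ᶠ n : ℕ in atTop,
      ((Real.log n / (effSize K β n * renyiHalf (p n) (q n)) : ℝ) : EReal)
        < ((1 - ε₀ / 2 : ℝ) : EReal) := by
    refine eventually_lt_of_limsup_lt ?_
    unfold SignalCondition at hsignal
    rw [hsignal, EReal.coe_lt_coe_iff]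
    linarith
  filter_upwards [h1, hp.eventually_le_const (show (0 : ℝ) < 1 / 2 by norm_num),
    eventually_ge_atTop 1] with n h1 h2 hn
  obtain ⟨hq, hqp, hp1⟩ := hpq n
  refine ⟨hq, hqp, h2, hc n, ?_⟩
  have hn' : (1 : ℝ) ≤ n := by exact_mod_cast hn
  have hlog : 0 ≤ Real.log n := Real.log_nonneg hn'
  have hI := renyiHalf_pos hq hqp hp1
  have heff : 0 < effSize K β n := lt_of_lt_of_le (by positivity) (le_effSize hK hβ)
  have hpos : 0 < effSize K β n * renyiHalf (p n) (q n) := mul_pos heff hI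
  rw [EReal.coe_lt_coe_iff, div_lt_iff₀ hpos] at h1
  have h3 : min (ε₀ / 2) 1 ≤ ε₀ / 2 := min_le_left _ _
  generalize effSize K β n * renyiHalf (p n) (q n) = y at *
  calc (1 + min (ε₀ / 2) 1) * Real.log n ≤ (1 + ε₀ / 2) * Real.log n := by gcongr
    _ ≤ (1 + ε₀ / 2) * ((1 - ε₀ / 2) * y) := by gcongr
    _ = (1 - (ε₀ / 2) ^ 2) * y := by ring
    _ ≤ 1 * y := by gcongr; nlinarith [sq_nonneg (ε₀ / 2)]
    _ = y := one_mul y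

/-- A radius `γ` beyond `γ₀` up to which the errors get corrected. -/
theorem eventually_exists_radius (hK : 2 ≤ K) (hβ : 1 ≤ β) (hαβ : β < α)
    (hpq : ∀ n, 0 < q n ∧ q n < p n ∧ p n < 1) (hp : Tendsto p atTop (𝓝 0))
    (hγ₀ : ∀ n, 0 < γ₀ n) (hcond : InitTempCondition K α β ε₀ p q γ₀ ξ)
    {κ : ℝ} (hκ : 0 < κ) (H R : ℝ) :
    ∀ᶠ n : ℕ in atTop, ∃ γ : ℝ, 0 < γ ∧ K * α * γ < 1 ∧ R ≤ (γ - γ₀ n) * n ∧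
      (γ ≤ κ ∨ H ≤ (1 - K * α * γ) ^ 2 * n * renyiHalf (p n) (q n)) := by
  have hK' : (2 : ℝ) ≤ K := by exact_mod_cast hK
  have hα : 1 < α := by linarith
  have hKα : 0 < K * α := by positivity
  rcases hcond with ⟨h0, -⟩ | ⟨h1, h2, -⟩
  · set κ' := min κ (1 / (2 * (K * α))) with hκ'
    have hκ'0 : 0 < κ' := by positivity
    filter_upwards [h0.eventually_le_const (half_pos hκ'0),
      tendsto_natCast_atTop_atTop.eventually_ge_atTop (R / (κ' / 2))] with n h3 h4
    refine ⟨κ', hκ'0, ?_, ?_, Or.inl (min_le_left _ _)⟩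
    · have h5 : κ' ≤ 1 / (2 * (K * α)) := min_le_right _ _
      calc K * α * κ' ≤ K * α * (1 / (2 * (K * α))) := by gcongr
        _ = 1 / 2 := by field_simp
        _ < 1 := by norm_num
    · rw [div_le_iff₀ (by positivity)] at h4
      have : (0 : ℝ) ≤ n := by positivity
      nlinarith
  · filter_upwards [h1, h2.eventually_ge_atTop (max (4 * H) (4 * (K * α) * R)),
      hp.eventually_le_const (show (0 : ℝ) < 1 / 2 by norm_num)] with n h3 h4 h5
    obtain ⟨hq, hqp, hp1⟩ := hpq n
    have hI := renyiHalf_pos hq hqp hp1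
    have hI2 := renyiHalf_le_two hq hqp h5
    have hH := (le_max_left _ _).trans h4
    have hR := (le_max_right _ _).trans h4
    have hγ := hγ₀ n
    set δ := 1 - K * α * γ₀ n with hδ
    have hδ0 : 0 < δ := by linarith
    have hδ1 : δ ≤ 1 := by
      have : 0 < K * α * γ₀ n := by positivity
      linarith
    set I := renyiHalf (p n) (q n)
    have hn : (0 : ℝ) ≤ n := by positivity
    have hshift : K * α * (δ / (2 * (K * α))) = δ / 2 := by field_simp
    have hval : 1 - K * α * (γ₀ n + δ / (2 * (K * α))) = δ / 2 := by
      rw [mul_add, hshift, ← sub_sub, ← hδ]; ring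
    refine ⟨γ₀ n + δ / (2 * (K * α)), by positivity, by linarith, ?_, Or.inr ?_⟩
    · rw [add_sub_cancel_left]
      have h6 : δ ^ 2 * n * I ≤ δ * n * 2 := by
        have : δ ^ 2 ≤ δ := by nlinarith
        gcongr
      rw [div_mul_eq_mul_div, le_div_iff₀ (by positivity)]
      linarith
    · rw [hval]
      linarith

theorem eventually_decay {b e : ℝ} (hb : 0 < b) (he : 0 < e) :
    ∀ᶠ n : ℕ in atTop, (n : ℝ) * Real.exp (1 - b * √(n : ℝ)) ≤ e := by
  have h1 := tendsto_rpow_mul_exp_neg_mul_atTop_nhds_zero 2 b hb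
  have h2 : Tendsto (fun n : ℕ => √(n : ℝ)) atTop atTop :=
    Real.tendsto_sqrt_atTop.comp tendsto_natCast_atTop_atTop
  have h3 := (h1.comp h2).const_mul (Real.exp 1)
  rw [mul_zero] at h3
  filter_upwards [h3.eventually_le_const he] with n hn
  refine le_trans (le_of_eq ?_) hn
  simp only [Function.comp]
  rw [Real.rpow_two, Real.sq_sqrt (by positivity), sub_eq_add_neg, Real.exp_add, ← neg_mul]
  ring

theorem time_bound {n K : ℕ} (hK : 2 ≤ K) (hn : 1 ≤ n) {c l e τ γ x T : ℝ} (hc : 0 < c)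
    (hc1 : c ≤ 1) (hl : 0 < l) (hτ : τ ≤ 1 / 2) (hx : l ≤ x)
    (hdecay : (n : ℝ) * Real.exp (1 - c * l * √(n : ℝ)) ≤ e)
    (hT : T = 4 * K * (n : ℝ) ^ 2 * max γ ((n : ℝ) ^ (-τ)) * x) :
    0 ≤ T ∧ ∀ t : ℕ, T < t + 1 → (1 - c / (4 * n * (K - 1))) ^ t * n ≤ e := by
  have hK' : (2 : ℝ) ≤ K := by exact_mod_cast hK
  have hn' : (1 : ℝ) ≤ n := by exact_mod_cast hn
  have hn0 : (0 : ℝ) < n := by linarith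
  have hpow : (n : ℝ) * √(n : ℝ) ≤ (n : ℝ) ^ 2 * max γ ((n : ℝ) ^ (-τ)) := by
    have h1 : (n : ℝ) ^ (-(1 / 2 : ℝ)) ≤ max γ ((n : ℝ) ^ (-τ)) :=
      (Real.rpow_le_rpow_of_exponent_le hn' (by linarith)).trans (le_max_right _ _)
    refine le_trans (le_of_eq ?_) (mul_le_mul_of_nonneg_left h1 (by positivity))
    rw [Real.rpow_neg hn0.le, ← Real.sqrt_eq_rpow]
    have h2 : √(n : ℝ) ≠ 0 := (Real.sqrt_pos.mpr hn0).ne'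
    field_simp
    rw [Real.sq_sqrt hn0.le]
  have hsqrt : 0 < √(n : ℝ) := Real.sqrt_pos.mpr hn0
  have hTl : 4 * K * (n * √(n : ℝ)) * l ≤ T := by
    rw [hT, mul_assoc (4 * (K : ℝ)) ((n : ℝ) ^ 2)]
    gcongr
  refine ⟨le_trans (by positivity) hTl, fun t ht => ?_⟩
  have hden : (0 : ℝ) < 4 * n * (K - 1) := by
    have : (0 : ℝ) < K - 1 := by linarith
    positivity
  set r := c / (4 * n * (K - 1)) with hr
  have hr0 : 0 < r := by positivity
  have hr1 : r ≤ 1 := by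
    rw [hr, div_le_one hden]
    nlinarith
  have hpw : (1 - r) ^ t ≤ Real.exp (1 - c * l * √(n : ℝ)) := by
    calc (1 - r) ^ t ≤ (Real.exp (-r)) ^ t := by
          refine pow_le_pow_left₀ (by linarith) ?_ t
          have := Real.add_one_le_exp (-r)
          linarith
      _ = Real.exp (-(r * t)) := by rw [← Real.exp_nat_mul]; congr 1; ring
      _ ≤ _ := by
          rw [Real.exp_le_exp]
          have h3 : r * (4 * K * (n * √(n : ℝ)) * l) ≤ r * (t + 1) :=
            mul_le_mul_of_nonneg_left (hTl.trans ht.le) hr0.le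
          have h4 : c * l * √(n : ℝ) ≤ r * (4 * K * (n * √(n : ℝ)) * l) := by
            have h5 : r * (4 * K * (n * √(n : ℝ)) * l) = c * l * √(n : ℝ) * (K / (K - 1)) := by
              have : (K : ℝ) - 1 ≠ 0 := by linarith
              rw [hr]; field_simp
            rw [h5]
            refine le_mul_of_one_le_right (by positivity) ?_
            rw [le_div_iff₀ (by linarith)]
            linarith
          linarith
  calc (1 - r) ^ t * n ≤ Real.exp (1 - c * l * √(n : ℝ)) * n := by gcongr
    _ = n * Real.exp (1 - c * l * √(n : ℝ)) := by ring
    _ ≤ e := hdecay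

/-- On a good graph the mixing time is finite and satisfies the bound. -/
theorem mixing_time_le_of_good {n K : ℕ} {α β p q ξ : ℝ} (hq : 0 < q) (hqp : q < p) (hp : p < 1)
    (hn : 1 ≤ n) (hK : 2 ≤ K) (hξ : 1 ≤ ξ) (hβ : 1 ≤ β) (hαβ : β < α) {c : ℝ} (hc0 : 0 < c)
    (hc1 : c ≤ 1) (hc : 2 * K * c = 1 / β - 1 / α) (hcn : 1 ≤ c * n)
    (A : SimpleGraph (Fin n)) {Zs : Labels n K} (hZs : Zs ∈ feasible n K β) {M : ℝ}
    (hM : M ≤ n / (α * K))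
    (hflip : ∀ Z ∈ feasible n K α, Z ≠ Zs → (hammingDist Z Zs : ℝ) < M →
      flipMass p q A Zs Z ≤ c / 8 * hammingDist Z Zs)
    {ε : ℝ} (hε0 : 0 < ε) (hε1 : ε < 1)
    (hcontr : ∑ W ∈ feasible n K α with W ∉ cluster Zs,
      √(likelihood (connMatrix K p q) A W / likelihood (connMatrix K p q) A Zs) ≤ ε / 4)
    (Z : feasible n K α) {γ τ : ℝ} (hγ : loss Z.1 Zs ≤ γ)
    (hexit : (2 : ℝ) ^ (γ * n - M) ≤ ε / 4) (hτ : τ ≤ 1 / 2)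
    (hdecay : (n : ℝ) * Real.exp (1 - c * Real.log ε⁻¹ * √(n : ℝ)) ≤ ε / 4) :
    ∀ P ∈ ({transition α (connMatrix K p q) ξ A, lazyTransition α (connMatrix K p q) ξ A} :
        Set (Matrix (clusterSpace n K α) (clusterSpace n K α) ℝ)),
      ∃ t : ℕ, mixingTime P (target α (connMatrix K p q) ξ A) ε (toCluster Z) = t ∧
        (t : ℝ) ≤ 4 * K * (n : ℝ) ^ 2 * max γ ((n : ℝ) ^ (-τ)) *
          (ξ * Real.log (posterior α (connMatrix K p q) A Z.1)⁻¹ + Real.log ε⁻¹) := by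
  have hlε : 0 < Real.log ε⁻¹ := Real.log_pos ((one_lt_inv₀ hε0).mpr hε1)
  have hpost : 0 ≤ Real.log (posterior α (connMatrix K p q) A Z.1)⁻¹ :=
    Real.log_nonneg ((one_le_inv₀ (posterior_pos hq hqp hp A Z.2)).mpr
      (posterior_le_one hq hqp hp A Z.2))
  obtain ⟨hT0, hT⟩ := time_bound hK hn (γ := γ) hc0 hc1 hlε hτ
    (show Real.log ε⁻¹ ≤ ξ * Real.log (posterior α (connMatrix K p q) A Z.1)⁻¹ + Real.log ε⁻¹ from
      le_add_of_nonneg_left (mul_nonneg (by linarith) hpost)) hdecay rfl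
  exact mixing_of_good hq hqp hp hn hK hξ hβ hαβ hc hcn A hZs hM hflip hε1.le hcontr hε0 Z hγ
    hexit hT0 hT

end Asymptotics

end SBM

theorem theorem4 (K : ℕ) (hK : 2 ≤ K) (α β : ℝ) (hβ : 1 ≤ β) (hαβ : β < α)
    (p q γ₀ ξ : ℕ → ℝ)
    (hpq : ∀ n, 0 < q n ∧ q n < p n ∧ p n < 1)
    (hp : Tendsto p atTop (𝓝 0))
    (hcomp : ∃ c : ℝ, ∀ n, p n ≤ c * q n)
    (hγ₀ : ∀ n, 0 < γ₀ n) (hξ : ∀ n, 1 ≤ ξ n)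
    (ε₀ : ℝ) (hε₀ : 0 < ε₀) (hsignal : SBM.SignalCondition K β ε₀ p q)
    (hcond : SBM.InitTempCondition K α β ε₀ p q γ₀ ξ) :
    ∃ τ₀ : ℝ, 0 < τ₀ ∧ ∀ τ : ℝ, 0 < τ → τ ≤ τ₀ → ∀ ε : ℝ, 0 < ε → ε < 1 →
      ∃ C₇ C₈ : ℝ, 0 < C₇ ∧ 0 < C₈ ∧
        ∀ n : ℕ, 1 ≤ n → ∀ Zstar ∈ SBM.feasible n K β,
        ∀ (Ω : Type*) [MeasurableSpace Ω] (μ : Measure Ω) [IsProbabilityMeasure μ]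
          (A : Ω → SimpleGraph (Fin n)) (Z₀ : Ω → SBM.feasible n K α) (η : ℝ),
          SBM.IsSBM μ A Zstar (SBM.connMatrix K (p n) (q n)) →
          Measurable Z₀ →
          0 < η →
          1 - η ≤ μ.real {ω | SBM.loss (Z₀ ω).1 Zstar ≤ γ₀ n} →
          1 - C₇ * (n : ℝ) ^ (-C₈) - η ≤
            μ.real {ω |
              ∀ P ∈ ({SBM.transition α (SBM.connMatrix K (p n) (q n)) (ξ n) (A ω),
                  SBM.lazyTransition α (SBM.connMatrix K (p n) (q n)) (ξ n) (A ω)} :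
                  Set (Matrix (SBM.clusterSpace n K α) (SBM.clusterSpace n K α) ℝ)),
                ∃ t : ℕ,
                  SBM.mixingTime P
                    (SBM.target α (SBM.connMatrix K (p n) (q n)) (ξ n) (A ω)) ε
                    (SBM.toCluster (Z₀ ω)) = t ∧
                  (t : ℝ) ≤ 4 * K * (n : ℝ) ^ 2 * max (γ₀ n) ((n : ℝ) ^ (-τ)) *
                    (ξ n * Real.log (SBM.posterior α (SBM.connMatrix K (p n) (q n)) (A ω)
                        (Z₀ ω).1)⁻¹
                      + Real.log ε⁻¹)} := by
  have hK' : (2 : ℝ) ≤ K := by exact_mod_cast hK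
  have hα0 : 0 < α := by linarith
  obtain ⟨c, hc⟩ := hcomp
  refine ⟨1 / 2, by norm_num, fun τ _ hτ ε hε hε1 => ?_⟩
  set ε₁ := min (ε₀ / 2) 1 with hε₁
  have hε₁0 : 0 < ε₁ := by positivity
  have hε₁1 : ε₁ ≤ 1 := min_le_right _ _
  have hinv : 1 / α < 1 / β := one_div_lt_one_div_of_lt (by linarith) hαβ
  set c₁ := (1 / β - 1 / α) / (2 * K) with hc₁
  have hc₁0 : 0 < c₁ := div_pos (by linarith) (by positivity)
  have hc₁eq : 2 * K * c₁ = 1 / β - 1 / α := by rw [hc₁]; field_simp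
  have hc₁1 : c₁ ≤ 1 := by
    have h1 : 1 / β ≤ 1 := by rw [div_le_one (by linarith)]; exact hβ
    have h2 : 0 < 1 / α := by positivity
    nlinarith
  have hlε : 0 < Real.log ε⁻¹ := Real.log_pos ((one_lt_inv₀ hε).mpr hε1)
  obtain ⟨C₁, N₁, hcontr⟩ := SBM.exists_contraction_bound (α := α) hK hβ hαβ c hε₁0 hε₁1
    (show 0 < ε / 4 by positivity)
  obtain ⟨κ, hκ0, C₂, N₂, hfew⟩ := SBM.exists_flipMass_bound_few hK hβ c hε₁0 hε₁1
    (show 0 < c₁ / 8 by positivity)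
  obtain ⟨H, -, hmany⟩ := SBM.exists_flipMass_bound_many hK hβ hαβ c hε₁1
    (show 0 < c₁ / 8 by positivity) hκ0
  set R := Real.logb 2 (4 / ε) with hR
  have hexit : (2 : ℝ) ^ (-R) = ε / 4 := by
    rw [Real.rpow_neg (by norm_num), hR, Real.rpow_logb (by norm_num) (by norm_num)
      (by positivity), inv_div]
  obtain ⟨N, hN⟩ := eventually_atTop.mp
    ((SBM.eventually_strongSignal hK hβ hpq hp hc hε₀ hsignal).and
    ((SBM.eventually_exists_radius hK hβ hαβ hpq hp hγ₀ hcond hκ0 H R).and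
    ((SBM.eventually_decay (mul_pos hc₁0 hlε) (show 0 < ε / 4 by positivity)).and
    ((tendsto_natCast_atTop_atTop.eventually_ge_atTop (1 / c₁)).and
    ((eventually_ge_atTop N₁).and (eventually_ge_atTop N₂))))))
  set D : ℝ := ((N : ℝ) + 1) ^ (ε₁ / 2) with hD
  have hD0 : 0 < D := by positivity
  refine ⟨|C₁| + |C₂| + 1 + D, ε₁ / 2, by positivity, by positivity, ?_⟩
  intro n hn Zs hZs Ω _ μ _ A Z₀ η hA _ hη hloss
  have hn' : (1 : ℝ) ≤ n := by exact_mod_cast hn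
  have hn0 : (0 : ℝ) < n := by linarith
  have hpow0 : 0 < (n : ℝ) ^ (-(ε₁ / 2)) := by positivity
  by_cases hnN : n < N
  · refine le_trans ?_ measureReal_nonneg
    have h1 : 1 ≤ D * (n : ℝ) ^ (-(ε₁ / 2)) := by
      rw [hD, Real.rpow_neg hn0.le, ← div_eq_mul_inv, one_le_div (by positivity)]
      refine Real.rpow_le_rpow hn0.le ?_ (by positivity)
      have : (n : ℝ) ≤ N := by exact_mod_cast hnN.le
      linarith
    have h2 : 0 ≤ (|C₁| + |C₂| + 1) * (n : ℝ) ^ (-(ε₁ / 2)) := by positivity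
    linarith
  push Not at hnN
  obtain ⟨hs, ⟨γ, hγ, hγ1, hγR, hγκ⟩, hdecay, hnc, hnN₁, hnN₂⟩ := hN n hnN
  obtain ⟨hq, hqp, hp1⟩ := hpq n
  set B₁ : Set Ω := {ω | ε / 4 ≤ ∑ W ∈ SBM.feasible n K α with W ∉ SBM.cluster Zs,
    √(SBM.likelihood (SBM.connMatrix K (p n) (q n)) (A ω) W /
      SBM.likelihood (SBM.connMatrix K (p n) (q n)) (A ω) Zs)}
  set B₂ : Set Ω := {ω | ∃ Z : SBM.Labels n K, Z ≠ Zs ∧ (hammingDist Z Zs : ℝ) ≤ κ * n ∧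
    c₁ / 8 * hammingDist Z Zs < SBM.flipMass (p n) (q n) (A ω) Zs Z}
  set B₃ : Set Ω := {ω | ∃ Z ∈ SBM.feasible n K α, κ * n ≤ hammingDist Z Zs ∧
    (hammingDist Z Zs : ℝ) < γ * n ∧
    c₁ / 8 * hammingDist Z Zs < SBM.flipMass (p n) (q n) (A ω) Zs Z}
  have hB₁ : μ.real B₁ ≤ C₁ * (n : ℝ) ^ (-(ε₁ / 2)) := hcontr n hnN₁ _ _ hs Zs hZs Ω μ A hA
  have hB₂ : μ.real B₂ ≤ C₂ * (n : ℝ) ^ (-(ε₁ / 2)) := hfew n hnN₂ _ _ hs Zs hZs Ω μ A hA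
  have hB₃ : μ.real B₃ ≤ (n : ℝ) ^ (-(ε₁ / 2)) := by
    rcases hγκ with hγκ | hH
    · have hempty : B₃ = ∅ := by
        rw [Set.eq_empty_iff_forall_notMem]
        rintro ω ⟨Z, -, h1, h2, -⟩
        nlinarith
      rw [hempty, measureReal_empty]
      exact hpow0.le
    · exact hmany n hn _ _ hs γ hγ hγ1 hH Zs Ω μ A hA
  have hM : γ * n ≤ n / (α * K) := by
    rw [le_div_iff₀ (by positivity)]
    nlinarith
  have hcn : 1 ≤ c₁ * n := by
    rwa [div_le_iff₀ hc₁0, mul_comm] at hnc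
  have hexit' : (2 : ℝ) ^ (γ₀ n * n - γ * n) ≤ ε / 4 := by
    rw [← hexit]
    exact Real.rpow_le_rpow_of_exponent_le (by norm_num) (by linarith)
  set G : Set Ω := {ω | ∀ P ∈ ({SBM.transition α (SBM.connMatrix K (p n) (q n)) (ξ n) (A ω),
      SBM.lazyTransition α (SBM.connMatrix K (p n) (q n)) (ξ n) (A ω)} :
      Set (Matrix (SBM.clusterSpace n K α) (SBM.clusterSpace n K α) ℝ)),
    ∃ t : ℕ, SBM.mixingTime P (SBM.target α (SBM.connMatrix K (p n) (q n)) (ξ n) (A ω)) ε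
        (SBM.toCluster (Z₀ ω)) = t ∧
      (t : ℝ) ≤ 4 * K * (n : ℝ) ^ 2 * max (γ₀ n) ((n : ℝ) ^ (-τ)) *
        (ξ n * Real.log (SBM.posterior α (SBM.connMatrix K (p n) (q n)) (A ω) (Z₀ ω).1)⁻¹
          + Real.log ε⁻¹)}
  have hsub : {ω | SBM.loss (Z₀ ω).1 Zs ≤ γ₀ n} ⊆ G ∪ (B₁ ∪ (B₂ ∪ B₃)) := by
    intro ω hω
    by_contra hnot
    simp only [Set.mem_union, not_or] at hnot
    obtain ⟨hG, hω₁, hω₂, hω₃⟩ := hnot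
    apply hG
    refine SBM.mixing_time_le_of_good hq hqp hp1 hn hK (hξ n) hβ hαβ hc₁0 hc₁1 hc₁eq hcn (A ω) hZs
      hM ?_ hε hε1 (not_le.mp hω₁).le (Z₀ ω) hω hexit' hτ hdecay
    intro Z hZ hne hlt
    by_contra hflip
    push Not at hflip
    rcases le_total (hammingDist Z Zs : ℝ) (κ * n) with h | h
    · exact hω₂ ⟨Z, hne, h, hflip⟩
    · exact hω₃ ⟨Z, hZ, h, hlt, hflip⟩
  have h1 := (hloss.trans (measureReal_mono hsub)).trans (measureReal_union_le _ _)
  have h2 : μ.real (B₁ ∪ (B₂ ∪ B₃)) ≤ μ.real B₁ + (μ.real B₂ + μ.real B₃) :=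
    (measureReal_union_le _ _).trans (add_le_add le_rfl (measureReal_union_le _ _))
  have h3 : C₁ * (n : ℝ) ^ (-(ε₁ / 2)) ≤ |C₁| * (n : ℝ) ^ (-(ε₁ / 2)) := by
    gcongr
    exact le_abs_self C₁
  have h4 : C₂ * (n : ℝ) ^ (-(ε₁ / 2)) ≤ |C₂| * (n : ℝ) ^ (-(ε₁ / 2)) := by
    gcongr
    exact le_abs_self C₂
  have h5 : 0 ≤ D * (n : ℝ) ^ (-(ε₁ / 2)) := by positivity
  linarith
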